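/- **Theorem 3.1 (Convergence of TSG, nonconvex $f$).** *Problem.* Let $f_1,f_2,f_3:\mathbb R^n\times\mathbb R^m\times\mathbb R^t\to\mathbb R$, with $f_1\in C^1$, $f_2\in C^2$, $f_3\in C^3$, and put $$z(x,y)=\arg\min_z f_3(x,y,z),\quad \bar f(x,y)=f_2(x,y,z(x,y)),\quad y(x)=\arg\min_y\bar f(x,y),$$ $$z(x)=z(x,y(x)),\quad f(x)=f_1(x,y(x),z(x)).$$ All norms are Euclidean norms of vectors and the induced (operator) norms of matrices and tensors. *Formulas.* At a point $(x,y,z)$ define, for $a\in\{x,y\}$, with $\nabla_a z^\top:=-[\nabla^2_{zz}f_3]^{-1}\nabla^2_{za}f_3$, $$\nabla_y\bar f:=\nabla_yf_2-\nabla^2_{yz}f_3[\nabla^2_{zz}f_3]^{-1}\nabla_zf_2,$$ $$\begin{aligned}\nabla^2_{ya}\bar f:={}&\nabla^2_{ya}f_2+\nabla^2_{yz}f_2\nabla_az^\top-\nabla^2_{yz}f_3[\nabla^2_{zz}f_3]^{-1}\big(\nabla^2_{za}f_2+\nabla^2_{zz}f_2\nabla_az^\top\big)\\&-\Big[\nabla^3_{yza}f_3+\nabla^3_{yzz}f_3\nabla_az^\top-\nabla^2_{yz}f_3[\nabla^2_{zz}f_3]^{-1}\big(\nabla^3_{zza}f_3+\nabla^3_{zzz}f_3\nabla_az^\top\big)\Big][\nabla^2_{zz}f_3]^{-1}\nabla_zf_2,\end{aligned}$$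 (in the bracket the second index of the third derivatives, the first $z$, is contracted with $[\nabla^2_{zz}f_3]^{-1}\nabla_zf_2$), $\nabla^2_{xy}\bar f:=(\nabla^2_{yx}\bar f)^\top$, and $$\nabla f:=\big(\nabla_xf_1-\nabla^2_{xz}f_3[\nabla^2_{zz}f_3]^{-1}\nabla_zf_1\big)-\nabla^2_{xy}\bar f\,[\nabla^2_{yy}\bar f]^{-1}\big(\nabla_yf_1-\nabla^2_{yz}f_3[\nabla^2_{zz}f_3]^{-1}\nabla_zf_1\big).$$ At $z=z(x,y)$, resp. at $y=y(x)$, $z=z(x)$, these are the true derivatives of $\bar f$, resp. the true gradient of $f$. Their stochastic versions are the same expressions with each derivative of $f_1,f_2,f_3$ replaced by its stochastic estimate (and each inverse by the inverse of the stochastic matrix). Factors that are multiplied with each other are evaluated with separate, independent samples of the batch: the batch of $\nabla_y\bar f$ has one sample for $\nabla f_2$, one for $\nabla^2_{yz}f_3$, one for the inverse; that of $\nabla^2_{ya}\bar f$ has one each for $\nabla^2f_2$, $\nabla^3f_3$, $\nabla^2_{yz}f_3$, for the two inverses, for $\nabla_zf_2$, and for the inverse and for $\nabla^2_{za}f_3$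 in $\nabla_az^\top$; that of $\nabla f$ has one each for $\nabla f_1$, for $\nabla^2_{xz}f_3,\nabla^2_{yz}f_3$, and for $[\nabla^2_{zz}f_3]^{-1}$, and separate batches for $\nabla^2_{xy}\bar f$ and $\nabla^2_{yy}\bar f$. *Assumptions.* 1. $f_1,\nabla f_1,\nabla f_2,\nabla^2f_2,\nabla f_3,\nabla^2f_3,\nabla^3f_3$ are Lipschitz continuous, and $f_2(x,y,\cdot)$ is Lipschitz continuous uniformly in $(x,y)$. 2. $f_3(x,y,\cdot)$ is $\mu_z$-strongly convex for all $(x,y)$, with $\mu_z>0$. 3. $\bar f(x,\cdot)$ is $\mu_y$-strongly convex for all $x$, with $\mu_y>0$. 4. The samples are i.i.d., and the stochastic estimates of $\nabla f_1,\nabla f_2,\nabla^2f_2,\nabla f_3,\nabla^2f_3,\nabla^3f_3$ are, at every point, unbiased with uniformly bounded variances. 5. At every point, almost surely, the stochastic $\nabla^2_{zz}f_3$ and $\nabla^2_{yy}\bar f$ are invertible, with $\|[\nabla^2_{zz}f_3(\cdot;\xi)]^{-1}\|\le b_{zz}$ and $\|[\nabla^2_{yy}\bar f(\cdot;\xi)]^{-1}\|\le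 b_{yy}$. 6. At every point $\nabla^2_{yy}\bar f$ is invertible and, with $\theta=\alpha_i\beta_i\gamma_i$, $\|[\nabla^2_{zz}f_3]^{-1}-\mathbb E[\nabla^2_{zz}f_3(\cdot;\xi)]^{-1}\|\le W_{zz}\theta$ and $\|[\nabla^2_{yy}\bar f]^{-1}-\mathbb E[\nabla^2_{yy}\bar f(\cdot;\xi)]^{-1}\|\le W_{yy}\theta$. 7. $f$ is bounded below by $f_{\min}$. *Algorithm (TSG).* Given deterministic $(x^0,y^0,z^0)$ and $I,J,K\ge1$, in iteration $i$ set $y^{i,0}=y^i$, $z^{i,0}=z^i$. For $j=0,\dots,J-1$, obtain $z^{i,j+1}$ from $z^{i,j}$ by $K$ steps $z\leftarrow z-\gamma_i\nabla_zf_3(x^i,y^{i,j},z;\xi^{i,j,k})$, then set $y^{i,j+1}=y^{i,j}-\beta_i\nabla_y\bar f(x^i,y^{i,j},z^{i,j+1};\xi^{i,j})$. Put $y^{i+1}=y^{i,J}$, obtain $z^{i+1}$ from $z^{i,J}$ by $K$ further steps of the same kind at $(x^i,y^{i+1})$, and set $x^{i+1}=x^i-\alpha_i\nabla f(x^i,y^{i+1},z^{i+1};\xi^i)$.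 The step sizes are $$\alpha_i=\frac1{\sqrt I},\qquad\beta_i=\frac{\alpha_i}{\sqrt J},\qquad\gamma_i=\frac{\alpha_i}{\sqrt J\sqrt K}.$$ *Claim.* There are $\varsigma,\varpi>0$ and $\Xi(I,J)>0$ with $\Xi(I,J)\le\kappa J^3I$ for all $I,J\ge1$, where $\varsigma,\varpi,\Xi,\kappa$ depend only on the constants in Assumptions 1–6 (Lipschitz constants, $\mu_z,\mu_y$, variance bounds, $b_{zz},b_{yy},W_{zz},W_{yy}$), and for every $D$ there is a constant $C$, depending only on $D$ and these constants, such that the following holds. If $$f(x^0)+\|y^0-y(x^0)\|^2+\|z^0-z(x^0)\|^2+\|z^0-z(x^0,y^0)\|^2-f_{\min}\le D$$ and $J\ge\varsigma$, $I\ge\varpi$, $K\ge\Xi(I,J)$, then $f$ is differentiable, $\mathbb E\|\nabla f(x^i)\|^2<\infty$ for $i<I$, and $$\frac1I\sum_{i=0}^{I-1}\mathbb E\big[\|\nabla f(x^i)\|^2\big]\le C\,\frac J{\sqrt I}.$$ -/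

import Mathlib

open MeasureTheory ProbabilityTheory
open scoped NNReal ENNReal

set_option maxSynthPendingDepth 3

namespace TSG

noncomputable section

/-! ### Euclidean spaces, points and blocks of derivatives -/

/-- `ℝ^d` with the Euclidean norm. -/
abbrev Vec (d : ℕ) : Type := EuclideanSpace ℝ (Fin d)

/-- The space `ℝ^(n+m+t)` of points `(x, y, z)`, with the Euclidean norm. -/
abbrev Pt (n m t : ℕ) : Type := EuclideanSpace ℝ (Fin n ⊕ Fin m ⊕ Fin t)

/-- The dual space. Gradients are elements of the dual, Hessian blocks are linear maps into the
dual; the Riesz isometry turns a gradient into a vector, so that all norms are the Euclidean norms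
of vectors and the spectral norms of matrices. -/
abbrev Dual (E : Type) [NormedAddCommGroup E] [NormedSpace ℝ E] : Type := E →L[ℝ] ℝ

section Points

variable {n m t : ℕ}

/-- The point `(x, y, z)`. -/
def pt (x : Vec n) (y : Vec m) (z : Vec t) : Pt n m t :=
  WithLp.toLp 2 (Sum.elim x (Sum.elim y z))

/-- The inclusion `x ↦ (x, 0, 0)`. -/
def inX : Vec n →L[ℝ] Pt n m t :=
  LinearMap.toContinuousLinearMap
    { toFun := fun x => pt x 0 0
      map_add' := fun _ _ => by ext (i | i | i) <;> simp [pt]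
      map_smul' := fun _ _ => by ext (i | i | i) <;> simp [pt] }

/-- The inclusion `y ↦ (0, y, 0)`. -/
def inY : Vec m →L[ℝ] Pt n m t :=
  LinearMap.toContinuousLinearMap
    { toFun := fun y => pt 0 y 0
      map_add' := fun _ _ => by ext (i | i | i) <;> simp [pt]
      map_smul' := fun _ _ => by ext (i | i | i) <;> simp [pt] }

/-- The inclusion `z ↦ (0, 0, z)`. -/
def inZ : Vec t →L[ℝ] Pt n m t :=
  LinearMap.toContinuousLinearMap
    { toFun := fun z => pt 0 0 z
      map_add' := fun _ _ => by ext (i | i | i) <;> simp [pt]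
      map_smul' := fun _ _ => by ext (i | i | i) <;> simp [pt] }

theorem pt_eq (x : Vec n) (y : Vec m) (z : Vec t) :
    pt x y z = inX x + inY y + inZ z := by
  ext (i | i | i) <;> simp [pt, inX, inY, inZ]

/-- A first derivative, a second derivative and a third derivative at a point. Second and third
derivatives are read as iterated Fréchet derivatives: the first argument is the direction in which
one differentiates last. -/
abbrev D1 (n m t : ℕ) : Type := Dual (Pt n m t)
abbrev D2 (n m t : ℕ) : Type := Pt n m t →L[ℝ] D1 n m t
abbrev D3 (n m t : ℕ) : Type := Pt n m t →L[ℝ] D2 n m t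

/-- The block `∇²_{ab} H` of a second derivative `H`, for two of the inclusions of variables (or any
linear maps) `a : A → Pt` and `b : B → Pt`, as the linear map `B → A*`, `w ↦ (v ↦ H (b w) (a v))`. -/
def blk {A B : Type} [NormedAddCommGroup A] [NormedSpace ℝ A] [NormedAddCommGroup B]
    [NormedSpace ℝ B] (H : D2 n m t) (a : A →L[ℝ] Pt n m t) (b : B →L[ℝ] Pt n m t) :
    B →L[ℝ] Dual A :=
  (ContinuousLinearMap.compL ℝ A (Pt n m t) ℝ).flip a ∘L H ∘L b

theorem blk_apply {A B : Type} [NormedAddCommGroup A] [NormedSpace ℝ A] [NormedAddCommGroup B]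
    [NormedSpace ℝ B] (H : D2 n m t) (a : A →L[ℝ] Pt n m t) (b : B →L[ℝ] Pt n m t) (w : B) (v : A) :
    blk H a b w v = H (b w) (a v) := rfl

/-- The Riesz vector of a gradient. -/
def riesz {d : ℕ} (g : Dual (Vec d)) : Vec d := (InnerProductSpace.toDual ℝ (Vec d)).symm g

/-! ### The adjoint formulas, for arbitrary derivative data -/

/-- `∇_a z^⊤ = -[∇²_{zz} f₃]⁻¹ ∇²_{za} f₃`, where `V` is the inverse and `a` is `inX` or `inY`. -/
def zJac {A : Type} [NormedAddCommGroup A] [NormedSpace ℝ A]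
    (V : Dual (Vec t) →L[ℝ] Vec t) (H3 : D2 n m t) (a : A →L[ℝ] Pt n m t) : A →L[ℝ] Vec t :=
  -(V ∘L blk H3 inZ a)

/-- The second derivative `∇²_{ya} f̄` (`a` is `inX` or `inY`) as a linear map `A → (ℝ^m)*`:

  `∇²_{ya} f₂ + ∇²_{yz} f₂ ∇_a z^⊤`
  `- [∇³_{yza} f₃ + ∇³_{yzz} f₃ ∇_a z^⊤ - ∇²_{yz} f₃ V₁ (∇³_{zza} f₃ + ∇³_{zzz} f₃ ∇_a z^⊤)] V₂ ∇_z f₂`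
  `- ∇²_{yz} f₃ V₁ (∇²_{za} f₂ + ∇²_{zz} f₂ ∇_a z^⊤)`,

where `V₁`, `V₂` stand for the two occurrences of `[∇²_{zz} f₃]⁻¹` and `∇_a z^⊤ = J`. The map
`u ↦ (u, ∇_a z^⊤ u)`, that is `a + inZ ∘ J`, collects the two directions of differentiation. -/
def fbarHess {A : Type} [NormedAddCommGroup A] [NormedSpace ℝ A] (a : A →L[ℝ] Pt n m t)
    (H2 : D2 n m t) (T3 : D3 n m t) (H3 : D2 n m t) (V1 V2 : Dual (Vec t) →L[ℝ] Vec t)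
    (g2 : D1 n m t) (J : A →L[ℝ] Vec t) : A →L[ℝ] Dual (Vec m) :=
  let τ : A →L[ℝ] Pt n m t := a + inZ ∘L J
  let w : Vec t := V2 (g2 ∘L inZ)
  blk H2 inY τ
    - blk (T3.flip (inZ w)) inY τ
    + blk H3 inY inZ ∘L V1 ∘L blk (T3.flip (inZ w)) inZ τ
    - blk H3 inY inZ ∘L V1 ∘L blk H2 inZ τ

/-- `[∇²_{zz} f₃]⁻¹`. -/
def invZZ (H3 : D2 n m t) : Dual (Vec t) →L[ℝ] Vec t :=
  (blk H3 (inZ : Vec t →L[ℝ] Pt n m t) inZ).inverse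

/-- The exact `∇²_{yy} f̄(x, y, z)`: the formula evaluated at an arbitrary point `p = (x, y, z)`
(it is the Hessian of `f̄(x, ·)` when `z = z(x, y)`). -/
def fbarHessYY (F2 F3 : Pt n m t → ℝ) (p : Pt n m t) : Vec m →L[ℝ] Dual (Vec m) :=
  let H3 := fderiv ℝ (fderiv ℝ F3) p
  fbarHess inY (fderiv ℝ (fderiv ℝ F2) p) (fderiv ℝ (fderiv ℝ (fderiv ℝ F3)) p) H3
    (invZZ H3) (invZZ H3) (fderiv ℝ F2 p) (zJac (invZZ H3) H3 inY)

/-! ### The trilevel problem -/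

/-- The lower-level solution `z(x, y)`, the minimizer of `f₃(x, y, ·)`. -/
def zSol (F3 : Pt n m t → ℝ) (x : Vec n) (y : Vec m) : Vec t :=
  Classical.epsilon fun z => ∀ z', F3 (pt x y z) ≤ F3 (pt x y z')

/-- The middle-level objective `f̄(x, y) = f₂(x, y, z(x, y))`. -/
def fbar (F2 F3 : Pt n m t → ℝ) (x : Vec n) (y : Vec m) : ℝ := F2 (pt x y (zSol F3 x y))

/-- The middle-level solution `y(x)`, the minimizer of `f̄(x, ·)`. -/
def ySol (F2 F3 : Pt n m t → ℝ) (x : Vec n) : Vec m :=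
  Classical.epsilon fun y => ∀ y', fbar F2 F3 x y ≤ fbar F2 F3 x y'

/-- The upper-level objective `f(x) = f₁(x, y(x), z(x, y(x)))`. -/
def upper (F1 F2 F3 : Pt n m t → ℝ) (x : Vec n) : ℝ :=
  F1 (pt x (ySol F2 F3 x) (zSol F3 x (ySol F2 F3 x)))

/-- `f(x) + ‖y - y(x)‖² + ‖z - z(x)‖² + ‖z - z(x, y)‖²`, where `z(x) = z(x, y(x))`. -/
def potential (F1 F2 F3 : Pt n m t → ℝ) (x : Vec n) (y : Vec m) (z : Vec t) : ℝ :=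
  upper F1 F2 F3 x + ‖y - ySol F2 F3 x‖ ^ 2 + ‖z - zSol F3 x (ySol F2 F3 x)‖ ^ 2
    + ‖z - zSol F3 x y‖ ^ 2

end Points

/-- The constants of the assumptions. -/
structure Constants where
  /-- Lipschitz constants of `f₁`, `∇f₁`. -/
  Lf1 : ℝ≥0
  Ldf1 : ℝ≥0
  /-- Lipschitz constants of `f₂` (in the variable `z`), `∇f₂`, `∇²f₂`. -/
  Lf2 : ℝ≥0
  Ldf2 : ℝ≥0
  Lddf2 : ℝ≥0
  /-- Lipschitz constants of `∇f₃`, `∇²f₃`, `∇³f₃`. -/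
  Ldf3 : ℝ≥0
  Lddf3 : ℝ≥0
  Ldddf3 : ℝ≥0
  /-- Strong convexity constants. -/
  μz : ℝ
  μy : ℝ
  μz_pos : 0 < μz
  μy_pos : 0 < μy
  /-- Standard deviation bounds of the stochastic `∇f₁`, `∇f₂`, `∇²f₂`, `∇f₃`, `∇²f₃`, `∇³f₃`. -/
  σdf1 : ℝ
  σdf2 : ℝ
  σddf2 : ℝ
  σdf3 : ℝ
  σddf3 : ℝ
  σdddf3 : ℝ
  /-- Bounds on the inverted stochastic Hessians. -/
  bzz : ℝ
  byy : ℝ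
  /-- Constants of the biases of the inverted stochastic Hessians. -/
  Wzz : ℝ
  Wyy : ℝ

section Assumptions

variable {n m t : ℕ}

/-- Differentiability and Lipschitz continuity. -/
structure Smooth (c : Constants) (F1 F2 F3 : Pt n m t → ℝ) : Prop where
  contDiff1 : ContDiff ℝ 1 F1
  contDiff2 : ContDiff ℝ 2 F2
  contDiff3 : ContDiff ℝ 3 F3
  lip_f1 : LipschitzWith c.Lf1 F1
  lip_df1 : LipschitzWith c.Ldf1 (fderiv ℝ F1)
  lip_f2 : ∀ x y, LipschitzWith c.Lf2 fun z => F2 (pt x y z)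
  lip_df2 : LipschitzWith c.Ldf2 (fderiv ℝ F2)
  lip_ddf2 : LipschitzWith c.Lddf2 (fderiv ℝ (fderiv ℝ F2))
  lip_df3 : LipschitzWith c.Ldf3 (fderiv ℝ F3)
  lip_ddf3 : LipschitzWith c.Lddf3 (fderiv ℝ (fderiv ℝ F3))
  lip_dddf3 : LipschitzWith c.Ldddf3 (fderiv ℝ (fderiv ℝ (fderiv ℝ F3)))

/-- `μ`-strong convexity through the gradient inequality. -/
def StronglyConvex {d : ℕ} (μ : ℝ) (h : Vec d → ℝ) : Prop :=
  ∀ v₁ v₂ : Vec d, h v₂ + fderiv ℝ h v₂ (v₁ - v₂) + μ / 2 * ‖v₁ - v₂‖ ^ 2 ≤ h v₁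

/-- Stochastic estimators of the derivatives of `f₁`, `f₂`, `f₃`, as functions of the point and of
the sample. -/
structure Oracle (n m t : ℕ) (S : Type*) where
  G1 : Pt n m t → S → D1 n m t
  G2 : Pt n m t → S → D1 n m t
  H2 : Pt n m t → S → D2 n m t
  G3 : Pt n m t → S → D1 n m t
  H3 : Pt n m t → S → D2 n m t
  T3 : Pt n m t → S → D3 n m t

/-- `G` is a (jointly measurable) unbiased estimator of `g` with variance at most `σ²` at every
point, when the sample has the law `P`. -/
structure IsUnbiasedEstimator {S : Type*} [MeasurableSpace S] (P : Measure S) {E : Type}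
    [NormedAddCommGroup E] [NormedSpace ℝ E] (G : Pt n m t → S → E) (g : Pt n m t → E) (σ : ℝ) :
    Prop where
  stronglyMeasurable :
    StronglyMeasurable fun q : (Vec n × Vec m × Vec t) × S => G (pt q.1.1 q.1.2.1 q.1.2.2) q.2
  memLp : ∀ p, MemLp (G p) 2 P
  unbiased : ∀ p, ∫ s, G p s ∂P = g p
  variance_le : ∀ p, ∫ s, ‖G p s - g p‖ ^ 2 ∂P ≤ σ ^ 2

/-- The stochastic derivatives are unbiased with bounded variances. -/
structure StochasticEstimates {S : Type*} [MeasurableSpace S] (c : Constants) (P : Measure S)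
    (F1 F2 F3 : Pt n m t → ℝ) (O : Oracle n m t S) : Prop where
  df1 : IsUnbiasedEstimator P O.G1 (fderiv ℝ F1) c.σdf1
  df2 : IsUnbiasedEstimator P O.G2 (fderiv ℝ F2) c.σdf2
  ddf2 : IsUnbiasedEstimator P O.H2 (fderiv ℝ (fderiv ℝ F2)) c.σddf2
  df3 : IsUnbiasedEstimator P O.G3 (fderiv ℝ F3) c.σdf3
  ddf3 : IsUnbiasedEstimator P O.H3 (fderiv ℝ (fderiv ℝ F3)) c.σddf3
  dddf3 : IsUnbiasedEstimator P O.T3 (fderiv ℝ (fderiv ℝ (fderiv ℝ F3))) c.σdddf3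

namespace Oracle

variable {S : Type*}

/-- The stochastic `∇²_{ya} f̄(x, y, z; ξ)` (`a` is `inX` or `inY`): each of the stochastic factors
of the formula is evaluated with its own sample of the batch. -/
def fbarHess {A : Type} [NormedAddCommGroup A] [NormedSpace ℝ A] (O : Oracle n m t S)
    (a : A →L[ℝ] Pt n m t) (p : Pt n m t) (s : Fin 8 → S) : A →L[ℝ] Dual (Vec m) :=
  TSG.fbarHess a (O.H2 p (s 0)) (O.T3 p (s 1)) (O.H3 p (s 2)) (invZZ (O.H3 p (s 3)))
    (invZZ (O.H3 p (s 4))) (O.G2 p (s 5)) (zJac (invZZ (O.H3 p (s 6))) (O.H3 p (s 7)) a)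

/-- The lower-level direction `∇_z f₃(x, y, z; ξ)`. -/
def llDir (O : Oracle n m t S) (p : Pt n m t) (s : S) : Dual (Vec t) := O.G3 p s ∘L inZ

/-- The middle-level direction `∇_y f₂ - ∇²_{yz} f₃ [∇²_{zz} f₃]⁻¹ ∇_z f₂`, at `(x, y, z; ξ)`. -/
def mlDir (O : Oracle n m t S) (p : Pt n m t) (s : Fin 3 → S) : Dual (Vec m) :=
  O.G2 p (s 0) ∘L inY
    - blk (O.H3 p (s 1)) inY inZ (invZZ (O.H3 p (s 2)) (O.G2 p (s 0) ∘L inZ))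

/-- The upper-level direction
`(∇_x f₁ - ∇²_{xz} f₃ [∇²_{zz} f₃]⁻¹ ∇_z f₁)`
`- ∇²_{xy} f̄ [∇²_{yy} f̄]⁻¹ (∇_y f₁ - ∇²_{yz} f₃ [∇²_{zz} f₃]⁻¹ ∇_z f₁)`, at `(x, y, z; ξ)`;
`sxy` and `syy` are the batches for `∇²_{xy} f̄` (the transpose of `∇²_{yx} f̄`) and `∇²_{yy} f̄`. -/
def ulDir (O : Oracle n m t S) (p : Pt n m t) (s : Fin 3 → S) (sxy syy : Fin 8 → S) :
    Dual (Vec n) :=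
  let g := O.G1 p (s 0)
  let H := O.H3 p (s 1)
  let l : Vec t := invZZ (O.H3 p (s 2)) (g ∘L inZ)
  (g ∘L inX - blk H inX inZ l)
    - (O.fbarHess inX p sxy).flip ((O.fbarHess inY p syy).inverse (g ∘L inY - blk H inY inZ l))

end Oracle

/-- Uniform bound on the inverted stochastic Hessians, at all points and for almost all samples. -/
structure InverseBound {S : Type*} [MeasurableSpace S] (c : Constants) (P : Measure S)
    (O : Oracle n m t S) : Prop where
  zz : ∀ p, ∀ᵐ s ∂P, (blk (O.H3 p s) (inZ : Vec t →L[ℝ] Pt n m t) inZ).IsInvertible ∧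
    ‖invZZ (O.H3 p s)‖ ≤ c.bzz
  yy : ∀ p, ∀ᵐ s ∂(Measure.pi fun _ : Fin 8 => P), (O.fbarHess inY p s).IsInvertible ∧
    ‖(O.fbarHess inY p s).inverse‖ ≤ c.byy

/-- Bounded bias of the inverted stochastic Hessians, with `θ = αβγ`. -/
structure InverseBias {S : Type*} [MeasurableSpace S] (c : Constants) (P : Measure S)
    (F2 F3 : Pt n m t → ℝ) (O : Oracle n m t S) (θ : ℝ) : Prop where
  zz : ∀ p, ‖invZZ (fderiv ℝ (fderiv ℝ F3) p) - ∫ s, invZZ (O.H3 p s) ∂P‖ ≤ c.Wzz * θ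
  yy_invertible : ∀ p, (fbarHessYY F2 F3 p).IsInvertible
  yy : ∀ p, ‖(fbarHessYY F2 F3 p).inverse
    - ∫ s, (O.fbarHess inY p s).inverse ∂(Measure.pi fun _ : Fin 8 => P)‖ ≤ c.Wyy * θ

end Assumptions

/-! ### The algorithm -/

/-- The labels of all samples drawn by the algorithm: `ll i j k` is the sample `ξ^{i,j,k}`, the
`ml i j ·` form the batch `ξ^{i,j}`, and the `ulGrad i ·`, `ulXY i ·`, `ulYY i ·` form the batch
`ξ^i`. -/
inductive SampleIdx : Type
  | ll (i j k : ℕ)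
  | ml (i j : ℕ) (r : Fin 3)
  | ulGrad (i : ℕ) (r : Fin 3)
  | ulXY (i : ℕ) (r : Fin 8)
  | ulYY (i : ℕ) (r : Fin 8)

section Algorithm

variable {n m t : ℕ} {S : Type*}

/-- Lower-level iterates: `z^{k+1} = z^k - γ ∇_z f₃(x, y, z^k; ξ^k)`. -/
def llIter (O : Oracle n m t S) (γ : ℝ) (x : Vec n) (y : Vec m) (ξ : ℕ → S) (z₀ : Vec t) :
    ℕ → Vec t
  | 0 => z₀
  | k + 1 =>
    let z := llIter O γ x y ξ z₀ k
    z - γ • riesz (O.llDir (pt x y z) (ξ k))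

/-- Middle-level iterates `(y^j, z^j)`: first `z^{j+1}` is obtained by `K` lower-level steps at
`(x, y^j)` from `z^j`, then `y^{j+1} = y^j - β g̃(x, y^j, z^{j+1})`. -/
def mlIter (O : Oracle n m t S) (β γ : ℝ) (K : ℕ) (x : Vec n) (ξll : ℕ → ℕ → S)
    (ξml : ℕ → Fin 3 → S) (y₀ : Vec m) (z₀ : Vec t) : ℕ → Vec m × Vec t
  | 0 => (y₀, z₀)
  | j + 1 =>
    let s := mlIter O β γ K x ξll ξml y₀ z₀ j
    let z' := llIter O γ x s.1 (ξll j) s.2 K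
    (s.1 - β • riesz (O.mlDir (pt x s.1 z') (ξml j)), z')

/-- The trilevel stochastic gradient method: the iterates `(x^i, y^i, z^i)`. In iteration `i`, the
middle-level method gives `y^{i+1} = y^{i,J}` and `z^{i,J}`, then `K` lower-level steps at
`(x^i, y^{i+1})` from `z^{i,J}` give `z^{i+1}`, and then
`x^{i+1} = x^i - α g̃(x^i, y^{i+1}, z^{i+1})`. -/
def tsgIter (O : Oracle n m t S) (α β γ : ℝ) (J K : ℕ) (x₀ : Vec n) (y₀ : Vec m) (z₀ : Vec t)
    (ξ : SampleIdx → S) : ℕ → Vec n × Vec m × Vec t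
  | 0 => (x₀, y₀, z₀)
  | i + 1 =>
    let s := tsgIter O α β γ J K x₀ y₀ z₀ ξ i
    let x := s.1
    let w := mlIter O β γ K x (fun j k => ξ (.ll i j k)) (fun j r => ξ (.ml i j r)) s.2.1 s.2.2 J
    let y' := w.1
    let z' := llIter O γ x y' (fun k => ξ (.ll i J k)) w.2 K
    (x - α • riesz (O.ulDir (pt x y' z') (fun r => ξ (.ulGrad i r)) (fun r => ξ (.ulXY i r))
        (fun r => ξ (.ulYY i r))), y', z')

end Algorithm

/-- The samples are independent and identically distributed with law `P`. -/
structure IIDSamples {Ω S : Type*} [MeasurableSpace Ω] [MeasurableSpace S] (μ : Measure Ω)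
    (P : Measure S) (ξ : SampleIdx → Ω → S) : Prop where
  measurable : ∀ a, Measurable (ξ a)
  indep : iIndepFun ξ μ
  law : ∀ a, μ.map (ξ a) = P

end

end TSG

/-!
The proof follows the Lyapunov function `f(x) - f_min + ‖y - y(x)‖² + ‖z - z(x, y)‖²` along the
iteration. One iteration decreases its mean by `α / 2 * 𝔼 ‖∇f(x)‖²`, up to a noise term
`C * α ^ 2`; summing over `I` iterations with `α = 1 / √I` gives a bound of order `1 / √I`, which is
stronger than the claimed `J / √I`. The ingredients are the following.

*Deterministic part.* Strong convexity makes the inner problems uniquely solvable, with coercive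
Hessians. Implicit differentiation along Lipschitz branches of zeros (`hasFDerivAt_of_zero`) gives
the derivatives of `z(x, y)`, `∇_y f̄`, `y(x)` and `f` (`Problem.hasFDerivAt_zSol`,
`Problem.hasFDerivAt_exGrad`, `Problem.hasFDerivAt_ySol`, `Problem.hasFDerivAt_upper`) and
identifies them with the adjoint formulas. All these formulas are built from bounded Lipschitz
quantities by sums, products and inverses with bounded norm; the relation `Near`, which is stable
under these operations, therefore bounds them and their variation by constants that depend on the
constants of the assumptions only. The result is `exists_regular`, which collects these Lipschitz
and Taylor estimates.

*Stochastic part.* In the stochastic directions, the factors of every product depend on disjoint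
groups of independent samples. Hence means and second moments of products factor (`Est.bilin`), the
mean of a direction is the same formula with the mean of every factor, and the bias comes only from
the means of the inverses, that is, it is of order `θ = α β γ`. This is `exists_directions`.

*One step.* At a fixed state, `Directions.ll_step`, `Directions.ml_step` and `Directions.ul_step`
bound the effect of one step of each level. A middle-level step moves `z(x, y)`, and the
upper-level step moves both `y(x)` and `z(x, y)`; expanding the square with the Taylor estimate of
`y(x)` shows that the middle-level error `‖y - y(x)‖²` is multiplied by at most
`1 + C α` in the upper-level step. The samples of a step are independent of the state they are used
in, so the bounds hold in mean along the iteration (`integral_le_of_indepFun`).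

*Step sizes.* With `K` at least a constant times `I * J`, one has `γ ≤ β ^ 2`, and the `K`
lower-level steps contract the lower-level error by any prescribed factor, as
`γ * K = √K / (√I * √J)`. A middle-level loop contracts by `(1 - μ_y / 4 * β) ^ J`, where
`β * J = √J * α`, so for large `J` it absorbs the factor `1 + C α` of the upper-level step. This is
`tuned_of_le`, which feeds `Directions.ml_loop`, `Directions.iterate` and
`Directions.sum_gradSq_le`.
-/

namespace TSG

noncomputable section

open Filter Topology

/-! ### The blocks of the space of points -/

section Blocks

variable {n m t : ℕ}

theorem norm_pt_sq (x : Vec n) (y : Vec m) (z : Vec t) :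
    ‖pt x y z‖ ^ 2 = ‖x‖ ^ 2 + ‖y‖ ^ 2 + ‖z‖ ^ 2 := by
  simp [EuclideanSpace.norm_sq_eq, pt, Fintype.sum_sum_type, add_assoc]

theorem inX_apply (x : Vec n) : (inX x : Pt n m t) = pt x 0 0 := rfl
theorem inY_apply (y : Vec m) : (inY y : Pt n m t) = pt 0 y 0 := rfl
theorem inZ_apply (z : Vec t) : (inZ z : Pt n m t) = pt 0 0 z := rfl

theorem norm_inX_apply (x : Vec n) : ‖(inX x : Pt n m t)‖ = ‖x‖ := by
  have h := norm_pt_sq x (0 : Vec m) (0 : Vec t)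
  rw [← sq_eq_sq₀ (norm_nonneg _) (norm_nonneg _), inX_apply, h]; simp

theorem norm_inY_apply (y : Vec m) : ‖(inY y : Pt n m t)‖ = ‖y‖ := by
  have h := norm_pt_sq (0 : Vec n) y (0 : Vec t)
  rw [← sq_eq_sq₀ (norm_nonneg _) (norm_nonneg _), inY_apply, h]; simp

theorem norm_inZ_apply (z : Vec t) : ‖(inZ z : Pt n m t)‖ = ‖z‖ := by
  have h := norm_pt_sq (0 : Vec n) (0 : Vec m) z
  rw [← sq_eq_sq₀ (norm_nonneg _) (norm_nonneg _), inZ_apply, h]; simp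

theorem norm_inX_le : ‖(inX : Vec n →L[ℝ] Pt n m t)‖ ≤ 1 :=
  ContinuousLinearMap.opNorm_le_bound _ zero_le_one fun x => by simp [norm_inX_apply]

theorem norm_inY_le : ‖(inY : Vec m →L[ℝ] Pt n m t)‖ ≤ 1 :=
  ContinuousLinearMap.opNorm_le_bound _ zero_le_one fun x => by simp [norm_inY_apply]

theorem norm_inZ_le : ‖(inZ : Vec t →L[ℝ] Pt n m t)‖ ≤ 1 :=
  ContinuousLinearMap.opNorm_le_bound _ zero_le_one fun x => by simp [norm_inZ_apply]

theorem pt_sub (x x' : Vec n) (y y' : Vec m) (z z' : Vec t) :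
    pt x y z - pt x' y' z' = inX (x - x') + inY (y - y') + inZ (z - z') := by
  simp only [pt_eq, map_sub]; abel

theorem norm_pt_sub_le (x x' : Vec n) (y y' : Vec m) (z z' : Vec t) :
    ‖pt x y z - pt x' y' z'‖ ≤ ‖x - x'‖ + ‖y - y'‖ + ‖z - z'‖ := by
  rw [pt_sub, ← norm_inX_apply (m := m) (t := t) (x - x'),
    ← norm_inY_apply (n := n) (t := t) (y - y'), ← norm_inZ_apply (n := n) (m := m) (z - z')]
  exact norm_add₃_le

theorem exists_eq_pt (p : Pt n m t) : ∃ x y z, p = pt x y z :=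
  ⟨WithLp.toLp 2 fun i => p (.inl i), WithLp.toLp 2 fun i => p (.inr (.inl i)),
    WithLp.toLp 2 fun i => p (.inr (.inr i)), by ext (i | i | i) <;> simp [pt]⟩

variable {A B : Type} [NormedAddCommGroup A] [NormedSpace ℝ A] [NormedAddCommGroup B]
    [NormedSpace ℝ B]

theorem norm_blk_le (H : D2 n m t) (a : A →L[ℝ] Pt n m t) (b : B →L[ℝ] Pt n m t) :
    ‖blk H a b‖ ≤ ‖H‖ * ‖a‖ * ‖b‖ := by
  refine ContinuousLinearMap.opNorm_le_bound₂ _ (by positivity) fun w v => ?_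
  rw [blk_apply]
  calc ‖H (b w) (a v)‖ ≤ ‖H‖ * ‖b w‖ * ‖a v‖ := H.le_opNorm₂ _ _
    _ ≤ ‖H‖ * (‖b‖ * ‖w‖) * (‖a‖ * ‖v‖) := by
        gcongr <;> exact ContinuousLinearMap.le_opNorm _ _
    _ = ‖H‖ * ‖a‖ * ‖b‖ * ‖w‖ * ‖v‖ := by ring

theorem blk_sub (H H' : D2 n m t) (a : A →L[ℝ] Pt n m t) (b : B →L[ℝ] Pt n m t) :
    blk (H - H') a b = blk H a b - blk H' a b := by
  ext w v; simp [blk_apply]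

end Blocks

/-! ### Strongly convex functions and coercive bilinear forms -/

section Convex

variable {d : ℕ} {μ : ℝ} {h : Vec d → ℝ}

theorem StronglyConvex.exists_isMinOn (hc : StronglyConvex μ h) (hμ : 0 < μ)
    (hd : Differentiable ℝ h) : ∃ v, ∀ v', h v ≤ h v' := by
  refine hd.continuous.exists_forall_le ?_
  have hb : ∀ v : Vec d, ‖v‖ * (μ / 2 * ‖v‖ - ‖fderiv ℝ h 0‖) + h 0 ≤ h v := fun v => by
    have h1 := hc v 0
    have h2 := neg_le_of_abs_le ((fderiv ℝ h 0).le_opNorm v)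
    simp only [sub_zero] at h1
    nlinarith
  refine tendsto_atTop_mono hb ?_
  have hn : Tendsto (fun v : Vec d => ‖v‖) (cocompact _) atTop := tendsto_norm_cocompact_atTop
  exact tendsto_atTop_add_const_right _ _ (hn.atTop_mul_atTop₀
    (tendsto_atTop_add_const_right _ _ (hn.const_mul_atTop (by positivity))))

/-- The gradient of a strongly convex function is strongly monotone. -/
theorem StronglyConvex.monotone (hc : StronglyConvex μ h) (a b : Vec d) :
    μ * ‖a - b‖ ^ 2 ≤ (fderiv ℝ h a - fderiv ℝ h b) (a - b) := by
  have h1 := hc a b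
  have h2 := hc b a
  have h3 : b - a = -(a - b) := by abel
  rw [h3, map_neg, norm_neg] at h2
  rw [sub_apply]
  linarith

/-- The derivative of a strongly monotone field is coercive. -/
theorem coercive_of_monotone {g : Vec d → Dual (Vec d)} {g' : Vec d →L[ℝ] Dual (Vec d)}
    {v : Vec d} (hg : ∀ a b, μ * ‖a - b‖ ^ 2 ≤ (g a - g b) (a - b)) (hd : HasFDerivAt g g' v)
    (w : Vec d) : μ * ‖w‖ ^ 2 ≤ g' w w := by
  have hφ : HasDerivAt (fun s : ℝ => g (v + s • w) w) (g' w w) 0 := by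
    have hl : HasDerivAt (fun s : ℝ => v + s • w) w 0 := by
      simpa using ((hasDerivAt_id (0 : ℝ)).smul_const w).const_add v
    have hg0 : HasFDerivAt g g' (v + (0 : ℝ) • w) := by simpa using hd
    exact (ContinuousLinearMap.apply ℝ ℝ w).hasFDerivAt.comp_hasDerivAt (0 : ℝ)
      (hg0.comp_hasDerivAt (0 : ℝ) hl)
  have hlim := hφ.tendsto_slope_zero_right
  refine ge_of_tendsto hlim ?_
  filter_upwards [self_mem_nhdsWithin] with s hs
  have hs : (0 : ℝ) < s := hs
  have := hg (v + s • w) v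
  rw [add_sub_cancel_left, norm_smul, map_smul, Real.norm_of_nonneg hs.le] at this
  simp only [smul_eq_mul, zero_add, zero_smul, add_zero, sub_apply] at this ⊢
  rw [inv_mul_eq_div, le_div_iff₀ hs]
  have h2 : s * (μ * ‖w‖ ^ 2 * s) ≤ s * (g (v + s • w) w - g v w) := by nlinarith
  exact le_of_mul_le_mul_left h2 hs

theorem isInvertible_of_coercive {A : Vec d →L[ℝ] Dual (Vec d)} (hμ : 0 < μ)
    (hA : ∀ w, μ * ‖w‖ ^ 2 ≤ A w w) : A.IsInvertible := by
  have hinj : Function.Injective A := by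
    refine (injective_iff_map_eq_zero A).2 fun w hw => ?_
    have := hA w
    rw [hw] at this
    have h0 : ‖w‖ ^ 2 ≤ 0 := by
      simp only [zero_apply] at this
      nlinarith
    simpa using le_antisymm h0 (by positivity)
  have hfr : Module.finrank ℝ (Vec d) = Module.finrank ℝ (Dual (Vec d)) :=
    (InnerProductSpace.toDual ℝ (Vec d)).toLinearEquiv.finrank_eq
  let e := (LinearMap.linearEquivOfInjective (A : Vec d →ₗ[ℝ] Dual (Vec d)) hinj
    hfr).toContinuousLinearEquiv
  exact ⟨e, by ext; rfl⟩

theorem norm_inverse_le_of_coercive {A : Vec d →L[ℝ] Dual (Vec d)} (hμ : 0 < μ)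
    (hA : ∀ w, μ * ‖w‖ ^ 2 ≤ A w w) : ‖A.inverse‖ ≤ μ⁻¹ := by
  refine ContinuousLinearMap.opNorm_le_bound _ (by positivity) fun ℓ => ?_
  have hi := isInvertible_of_coercive hμ hA
  have h1 := hA (A.inverse ℓ)
  rw [hi.self_apply_inverse] at h1
  have h2 := (le_abs_self _).trans (ℓ.le_opNorm (A.inverse ℓ))
  rw [inv_mul_eq_div, le_div_iff₀ hμ]
  rcases (norm_nonneg (A.inverse ℓ)).eq_or_lt with h0 | h0
  · rw [← h0]; simp
  · nlinarith

theorem inverse_symm {A : Vec d →L[ℝ] Dual (Vec d)} (hi : A.IsInvertible)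
    (hs : ∀ v w, A v w = A w v) (g ℓ : Dual (Vec d)) : g (A.inverse ℓ) = ℓ (A.inverse g) := by
  have h1 := hs (A.inverse g) (A.inverse ℓ)
  rwa [hi.self_apply_inverse, hi.self_apply_inverse] at h1

end Convex

/-! ### Perturbation of the adjoint formulas -/

/-- `a` and `b` are bounded by `R`, and at distance at most `R * δ`. -/
def Near {E : Type*} [NormedAddCommGroup E] (R δ : ℝ) (a b : E) : Prop :=
  ‖a‖ ≤ R ∧ ‖b‖ ≤ R ∧ ‖a - b‖ ≤ R * δ

namespace Near

variable {E F G : Type*} [NormedAddCommGroup E] [NormedAddCommGroup F] [NormedAddCommGroup G]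
  {R S δ : ℝ}

theorem nonneg {a b : E} (h : Near R δ a b) : 0 ≤ R := (norm_nonneg _).trans h.1

theorem mono {a b : E} (h : Near R δ a b) (hδ : 0 ≤ δ) (hRS : R ≤ S) : Near S δ a b :=
  ⟨h.1.trans hRS, h.2.1.trans hRS, h.2.2.trans (mul_le_mul_of_nonneg_right hRS hδ)⟩

theorem refl {a : E} (hδ : 0 ≤ δ) (h : ‖a‖ ≤ R) : Near R δ a a :=
  ⟨h, h, by simpa using mul_nonneg ((norm_nonneg _).trans h) hδ⟩

theorem add {a b : E} {a' b' : E} (h : Near R δ a b) (h' : Near S δ a' b') :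
    Near (R + S) δ (a + a') (b + b') := by
  refine ⟨norm_add_le_of_le h.1 h'.1, norm_add_le_of_le h.2.1 h'.2.1, ?_⟩
  rw [add_sub_add_comm, add_mul]
  exact norm_add_le_of_le h.2.2 h'.2.2

theorem neg {a b : E} (h : Near R δ a b) : Near R δ (-a) (-b) := by
  refine ⟨by simpa using h.1, by simpa using h.2.1, ?_⟩
  rw [neg_sub_neg, norm_sub_rev]; exact h.2.2

theorem sub {a b : E} {a' b' : E} (h : Near R δ a b) (h' : Near S δ a' b') :
    Near (R + S) δ (a - a') (b - b') := by
  simpa only [sub_eq_add_neg] using h.add h'.neg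

/-- Products of bounded quantities; `f` is any biadditive operation with `‖f a a'‖ ≤ ‖a‖ ‖a'‖`. -/
theorem bilin (f : E → F → G) (hf : ∀ a a', ‖f a a'‖ ≤ ‖a‖ * ‖a'‖)
    (hl : ∀ a b a', f (a - b) a' = f a a' - f b a')
    (hr : ∀ a a' b', f a (a' - b') = f a a' - f a b') {a b : E} {a' b' : F}
    (h : Near R δ a b) (h' : Near S δ a' b') : Near (2 * (R * S)) δ (f a a') (f b b') := by
  have hR := h.nonneg
  have hS := h'.nonneg
  have hRS := mul_nonneg hR hS
  refine ⟨?_, ?_, ?_⟩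
  · have := (hf a a').trans (mul_le_mul h.1 h'.1 (norm_nonneg _) hR)
    linarith
  · have := (hf b b').trans (mul_le_mul h.2.1 h'.2.1 (norm_nonneg _) hR)
    linarith
  · have e : f a a' - f b b' = f (a - b) a' + f b (a' - b') := by rw [hl, hr]; abel
    rw [e]
    have h1 := (hf (a - b) a').trans
      (mul_le_mul h.2.2 h'.1 (norm_nonneg _) ((norm_nonneg _).trans h.2.2))
    have h2 := (hf b (a' - b')).trans (mul_le_mul h.2.1 h'.2.2 (norm_nonneg _) hR)
    refine (norm_add_le_of_le h1 h2).trans (le_of_eq ?_)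
    ring

variable [NormedSpace ℝ E] [NormedSpace ℝ F] [NormedSpace ℝ G]

theorem clm_comp {a b : F →L[ℝ] G} {a' b' : E →L[ℝ] F} (h : Near R δ a b) (h' : Near S δ a' b') :
    Near (2 * (R * S)) δ (a ∘L a') (b ∘L b') :=
  bilin (fun a a' => a ∘L a') (fun a a' => a.opNorm_comp_le a') (fun _ _ _ => by ext; simp)
    (fun _ _ _ => by ext; simp) h h'

theorem clm_apply {a b : E →L[ℝ] F} {a' b' : E} (h : Near R δ a b) (h' : Near S δ a' b') :
    Near (2 * (R * S)) δ (a a') (b b') :=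
  bilin (fun a a' => a a') (fun a a' => a.le_opNorm a') (fun _ _ _ => by simp)
    (fun _ _ _ => by simp) h h'

theorem clm_flip {a b : E →L[ℝ] F →L[ℝ] G} (h : Near R δ a b) : Near R δ a.flip b.flip := by
  refine ⟨by simpa using h.1, by simpa using h.2.1, ?_⟩
  have e : a.flip - b.flip = (a - b).flip := by ext; simp
  rw [e, ContinuousLinearMap.opNorm_flip]; exact h.2.2

theorem inverse {a b : E →L[ℝ] F} (ha : a.IsInvertible) (hb : b.IsInvertible)
    (hδ : 0 ≤ δ) (ha' : ‖a.inverse‖ ≤ S) (hb' : ‖b.inverse‖ ≤ S) (h : Near R δ a b) :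
    Near (S + S * R * S) δ a.inverse b.inverse := by
  have hS : 0 ≤ S := (norm_nonneg _).trans ha'
  have hR := h.nonneg
  have h0 : 0 ≤ S * R * S := by positivity
  refine ⟨by linarith, by linarith, ?_⟩
  have e : a.inverse - b.inverse = -(a.inverse ∘L (a - b) ∘L b.inverse) := by
    ext x
    have h1 : a.inverse (a (b.inverse x)) = b.inverse x := ha.inverse_apply_self _
    simp [h1, hb.self_apply_inverse]
  rw [e, norm_neg]
  have h1 : ‖a.inverse ∘L (a - b) ∘L b.inverse‖ ≤ S * (R * δ * S) := by
    refine (ContinuousLinearMap.opNorm_comp_le _ _).trans ?_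
    refine mul_le_mul ha' ?_ (norm_nonneg _) hS
    refine (ContinuousLinearMap.opNorm_comp_le _ _).trans ?_
    exact mul_le_mul h.2.2 hb' (norm_nonneg _) (mul_nonneg hR hδ)
  nlinarith [mul_nonneg hS hδ]

end Near

section Formulas

variable {n m t : ℕ} {A B : Type} [NormedAddCommGroup A] [NormedSpace ℝ A] [NormedAddCommGroup B]
    [NormedSpace ℝ B] {R δ : ℝ}

theorem blk_eq_flip_comp (H : D2 n m t) (a : A →L[ℝ] Pt n m t) (b : B →L[ℝ] Pt n m t) :
    blk H a b = ((H ∘L b).flip ∘L a).flip := by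
  ext; rfl

theorem Near.blk {H H' : D2 n m t} {a a' : A →L[ℝ] Pt n m t} {b b' : B →L[ℝ] Pt n m t} {S T : ℝ}
    (h : Near R δ H H') (ha : Near S δ a a') (hb : Near T δ b b') :
    Near (2 * (2 * (R * T) * S)) δ (blk H a b) (blk H' a' b') := by
  rw [blk_eq_flip_comp, blk_eq_flip_comp]
  exact ((h.clm_comp hb).clm_flip.clm_comp ha).clm_flip

/-- The middle-level direction `∇_y f₂ - ∇²_{yz} f₃ V ∇_z f₂`. -/
def mlForm (g : D1 n m t) (H : D2 n m t) (V : Dual (Vec t) →L[ℝ] Vec t) : Dual (Vec m) :=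
  g ∘L inY - TSG.blk H inY inZ (V (g ∘L inZ))

/-- The upper-level direction, where `B` stands for `∇²_{yx} f̄` and `W` for `[∇²_{yy} f̄]⁻¹`. -/
def ulForm (g : D1 n m t) (H : D2 n m t) (V : Dual (Vec t) →L[ℝ] Vec t)
    (B : Vec n →L[ℝ] Dual (Vec m)) (W : Dual (Vec m) →L[ℝ] Vec m) : Dual (Vec n) :=
  (g ∘L inX - TSG.blk H inX inZ (V (g ∘L inZ)))
    - B.flip (W (g ∘L inY - TSG.blk H inY inZ (V (g ∘L inZ))))

theorem exists_near_zJac (R : ℝ) : ∃ C, ∀ {n m t : ℕ} {A : Type} [NormedAddCommGroup A]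
    [NormedSpace ℝ A] {δ : ℝ} {a : A →L[ℝ] Pt n m t} {V V' : Dual (Vec t) →L[ℝ] Vec t}
    {H H' : D2 n m t}, 0 ≤ δ → ‖a‖ ≤ 1 → Near R δ V V' → Near R δ H H' →
    Near C δ (zJac V H a) (zJac V' H' a) := by
  -- the value of `C` is the one that the rules of `Near` produce
  apply Exists.intro
  intro _ _ _ _ _ _ _ _ _ _ _ _ hδ ha hV hH
  exact (hV.clm_comp (hH.blk (Near.refl hδ norm_inZ_le) (Near.refl hδ ha))).neg

theorem exists_near_fbarHess (R : ℝ) : ∃ C, ∀ {n m t : ℕ} {A : Type} [NormedAddCommGroup A]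
    [NormedSpace ℝ A] {δ : ℝ} {a : A →L[ℝ] Pt n m t} {H H' : D2 n m t} {T T' : D3 n m t}
    {K K' : D2 n m t} {V₁ V₁' V₂ V₂' : Dual (Vec t) →L[ℝ] Vec t} {g g' : D1 n m t}
    {J J' : A →L[ℝ] Vec t},
    0 ≤ δ → ‖a‖ ≤ 1 → Near R δ H H' → Near R δ T T' → Near R δ K K' → Near R δ V₁ V₁' →
    Near R δ V₂ V₂' → Near R δ (g ∘L inZ) (g' ∘L inZ) → Near R δ J J' →
    Near C δ (fbarHess a H T K V₁ V₂ g J) (fbarHess a H' T' K' V₁' V₂' g' J') := by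
  apply Exists.intro
  intro n m t A _ _ δ a _ _ _ _ _ _ _ _ _ _ _ _ _ _ hδ ha hH hT hK hV₁ hV₂ hg hJ
  have hX := Near.refl (R := 1) (δ := δ) (a := (inX : Vec n →L[ℝ] Pt n m t)) hδ norm_inX_le
  have hY := Near.refl (R := 1) (δ := δ) (a := (inY : Vec m →L[ℝ] Pt n m t)) hδ norm_inY_le
  have hZ := Near.refl (R := 1) (δ := δ) (a := (inZ : Vec t →L[ℝ] Pt n m t)) hδ norm_inZ_le
  have hτ := (Near.refl hδ ha).add (hZ.clm_comp hJ)
  have hTw := hT.clm_flip.clm_apply (hZ.clm_apply (hV₂.clm_apply hg))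
  exact (((hH.blk hY hτ).sub (hTw.blk hY hτ)).add
    ((hK.blk hY hZ).clm_comp (hV₁.clm_comp (hTw.blk hZ hτ)))).sub
    ((hK.blk hY hZ).clm_comp (hV₁.clm_comp (hH.blk hZ hτ)))

theorem exists_near_ulForm (R : ℝ) : ∃ C, ∀ {n m t : ℕ} {δ : ℝ} {g g' : D1 n m t}
    {H H' : D2 n m t} {V V' : Dual (Vec t) →L[ℝ] Vec t} {B B' : Vec n →L[ℝ] Dual (Vec m)}
    {W W' : Dual (Vec m) →L[ℝ] Vec m},
    0 ≤ δ → Near R δ g g' → Near R δ H H' → Near R δ V V' → Near R δ B B' → Near R δ W W' →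
    Near C δ (ulForm g H V B W) (ulForm g' H' V' B' W') := by
  apply Exists.intro
  intro n m t δ _ _ _ _ _ _ _ _ _ _ hδ hg hH hV hB hW
  have hX := Near.refl (R := 1) (δ := δ) (a := (inX : Vec n →L[ℝ] Pt n m t)) hδ norm_inX_le
  have hY := Near.refl (R := 1) (δ := δ) (a := (inY : Vec m →L[ℝ] Pt n m t)) hδ norm_inY_le
  have hZ := Near.refl (R := 1) (δ := δ) (a := (inZ : Vec t →L[ℝ] Pt n m t)) hδ norm_inZ_le
  have hl := hV.clm_apply (hg.clm_comp hZ)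
  exact ((hg.clm_comp hX).sub ((hH.blk hX hZ).clm_apply hl)).sub
    (hB.clm_flip.clm_apply (hW.clm_apply ((hg.clm_comp hY).sub ((hH.blk hY hZ).clm_apply hl))))

end Formulas

theorem Near.mono_right {E : Type*} [NormedAddCommGroup E] {R δ δ' : ℝ} {a b : E}
    (h : Near R δ a b) (hδ : δ ≤ δ') : Near R δ' a b :=
  ⟨h.1, h.2.1, h.2.2.trans (mul_le_mul_of_nonneg_left hδ h.nonneg)⟩

/-! ### Zeros of strongly monotone fields depending on a parameter -/

section Implicit

variable {U E F : Type*} [NormedAddCommGroup U] [NormedSpace ℝ U] [NormedAddCommGroup E]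
  [NormedSpace ℝ E] [NormedAddCommGroup F] [NormedSpace ℝ F]

/-- The zeros of two fields, one of which is strongly monotone, are as close as the fields are. -/
theorem norm_sub_le_of_zero {d : ℕ} {μ ε : ℝ} (hμ : 0 < μ) {g g' : Vec d → Dual (Vec d)}
    (hg : ∀ a b, μ * ‖a - b‖ ^ 2 ≤ (g a - g b) (a - b)) {v v' : Vec d} (hv : g v = 0)
    (hv' : g' v' = 0) (hε : ‖g v' - g' v'‖ ≤ ε) : ‖v - v'‖ ≤ ε * μ⁻¹ := by
  have h1 := hg v v'
  have h2 : (g v - g v') (v - v') ≤ ε * ‖v - v'‖ := by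
    have e : g v - g v' = -(g v' - g' v') := by rw [hv, hv']; simp
    rw [e]
    refine (le_abs_self _).trans (((-(g v' - g' v')).le_opNorm _).trans ?_)
    rw [norm_neg]
    exact mul_le_mul_of_nonneg_right hε (norm_nonneg _)
  rw [← div_eq_mul_inv, le_div_iff₀ hμ]
  rcases (norm_nonneg (v - v')).eq_or_lt with h0 | h0
  · rw [← h0, zero_mul]; exact (norm_nonneg _).trans hε
  · nlinarith

/-- Implicit differentiation along a Lipschitz branch of zeros. -/
theorem hasFDerivAt_of_zero {Φ : U × E → F} {Φ' : U × E →L[ℝ] F} {v : U → E} {u : U} {L : ℝ}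
    (hΦ : HasFDerivAt Φ Φ' (u, v u)) (h0 : ∀ u', Φ (u', v u') = 0)
    (hL : ∀ u', ‖v u' - v u‖ ≤ L * ‖u' - u‖)
    (hi : (Φ' ∘L ContinuousLinearMap.inr ℝ U E).IsInvertible) :
    HasFDerivAt v (-((Φ' ∘L ContinuousLinearMap.inr ℝ U E).inverse ∘L
      (Φ' ∘L ContinuousLinearMap.inl ℝ U E))) u := by
  set A := Φ' ∘L ContinuousLinearMap.inr ℝ U E
  have hO : (fun u' => v u' - v u) =O[𝓝 u] fun u' => u' - u :=
    Asymptotics.IsBigO.of_bound L (Eventually.of_forall hL)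
  have hc : Tendsto v (𝓝 u) (𝓝 (v u)) := by
    rw [tendsto_iff_norm_sub_tendsto_zero]
    have h1 : Tendsto (fun u' => L * ‖u' - u‖) (𝓝 u) (𝓝 0) := by
      have : Continuous fun u' => L * ‖u' - u‖ := by fun_prop
      simpa using this.tendsto u
    exact squeeze_zero (fun _ => norm_nonneg _) hL h1
  have ht : Tendsto (fun u' => (u', v u')) (𝓝 u) (𝓝 (u, v u)) := tendsto_id.prodMk_nhds hc
  have hO2 : (fun u' => ((u', v u') : U × E) - (u, v u)) =O[𝓝 u] fun u' => u' - u := by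
    simpa using (Asymptotics.isBigO_refl (fun u' => u' - u) (𝓝 u)).prod_left hO
  have h1 := (hΦ.isLittleO.comp_tendsto ht).trans_isBigO hO2
  have h2 : (fun u' => A.inverse (Φ' (u' - u, v u' - v u))) =o[𝓝 u] fun u' => u' - u := by
    have h3 : (fun u' => Φ' (u' - u, v u' - v u)) =o[𝓝 u] fun u' => u' - u := by
      refine h1.neg_left.congr_left fun u' => ?_
      simp only [Function.comp_apply, h0, sub_zero, zero_sub, neg_neg, Prod.mk_sub_mk]
    exact (A.inverse.isBigO_comp _ _).trans_isLittleO h3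
  refine HasFDerivAt.of_isLittleO (h2.congr_left fun u' => ?_)
  have e : Φ' (u' - u, v u' - v u) = Φ' (u' - u, 0) + A (v u' - v u) := by
    rw [show A (v u' - v u) = Φ' (0, v u' - v u) from rfl, ← map_add]; simp
  rw [e, map_add, hi.inverse_apply_self]
  simp
  abel

theorem norm_taylor_le {f : E → F} {f' : E → E →L[ℝ] F} {L : ℝ} (hf : ∀ x, HasFDerivAt f (f' x) x)
    (hL : ∀ x y, ‖f' x - f' y‖ ≤ L * ‖x - y‖) (x y : E) :
    ‖f y - f x - f' x (y - x)‖ ≤ L * ‖y - x‖ ^ 2 := by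
  have h := (convex_segment (𝕜 := ℝ) x y).norm_image_sub_le_of_norm_hasFDerivWithin_le'
    (f := f) (f' := f') (φ := f' x) (C := L * ‖y - x‖)
    (fun z _ => (hf z).hasFDerivWithinAt) (fun z hz => ?_) (left_mem_segment ℝ x y)
    (right_mem_segment ℝ x y)
  · refine h.trans (le_of_eq ?_)
    ring
  · rcases eq_or_ne x y with rfl | hne
    · rw [segment_same, Set.mem_singleton_iff] at hz
      subst hz; simp
    have hxy : 0 < ‖x - y‖ := norm_pos_iff.2 (sub_ne_zero.2 hne)
    have hL0 : 0 ≤ L := nonneg_of_mul_nonneg_left ((norm_nonneg _).trans (hL x y)) hxy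
    refine (hL z x).trans (mul_le_mul_of_nonneg_left ?_ hL0)
    exact norm_sub_le_of_mem_segment hz

theorem norm_image_sub_le_of_deriv {f : E → F} {f' : E → E →L[ℝ] F} {C : ℝ}
    (hf : ∀ x, HasFDerivAt f (f' x) x) (hC : ∀ x, ‖f' x‖ ≤ C) (x y : E) :
    ‖f x - f y‖ ≤ C * ‖x - y‖ :=
  convex_univ.norm_image_sub_le_of_norm_hasFDerivWithin_le
    (fun z _ => (hf z).hasFDerivWithinAt) (fun z _ => hC z) (Set.mem_univ y) (Set.mem_univ x)

end Implicit

/-! ### Constants -/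

/-- The sum of the constants that bound the derivatives and the inverses. -/
def Constants.L (c : Constants) : ℝ :=
  c.Lf1 + c.Ldf1 + c.Lf2 + c.Ldf2 + c.Lddf2 + c.Ldf3 + c.Lddf3 + c.Ldddf3 + |c.bzz| + |c.byy|
    + |c.Wzz| + |c.Wyy| + c.μz⁻¹ + c.μy⁻¹ + 1

/-- A common bound on the derivatives and inverses, and on their Lipschitz constants. -/
def Constants.R (c : Constants) : ℝ := c.L + (c.μz⁻¹ + c.μz⁻¹ * c.L * c.μz⁻¹)

section

variable (c : Constants)

theorem Constants.μz_inv_nonneg : 0 ≤ c.μz⁻¹ := inv_nonneg.2 c.μz_pos.le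
theorem Constants.μy_inv_nonneg : 0 ≤ c.μy⁻¹ := inv_nonneg.2 c.μy_pos.le

theorem Constants.le_L : (c.Lf1 : ℝ) ≤ c.L ∧ (c.Ldf1 : ℝ) ≤ c.L ∧ (c.Lf2 : ℝ) ≤ c.L ∧
    (c.Ldf2 : ℝ) ≤ c.L ∧ (c.Lddf2 : ℝ) ≤ c.L ∧ (c.Ldf3 : ℝ) ≤ c.L ∧ (c.Lddf3 : ℝ) ≤ c.L ∧
    (c.Ldddf3 : ℝ) ≤ c.L ∧ |c.bzz| ≤ c.L ∧ |c.byy| + |c.Wyy| + c.μy⁻¹ ≤ c.L ∧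
    |c.Wzz| ≤ c.L ∧ |c.Wyy| ≤ c.L ∧ c.μz⁻¹ ≤ c.L ∧ c.μy⁻¹ ≤ c.L ∧ 1 ≤ c.L ∧
    |c.bzz| + |c.Wzz| ≤ c.L := by
  have h1 := c.Lf1.coe_nonneg
  have h2 := c.Ldf1.coe_nonneg
  have h3 := c.Lf2.coe_nonneg
  have h4 := c.Ldf2.coe_nonneg
  have h5 := c.Lddf2.coe_nonneg
  have h6 := c.Ldf3.coe_nonneg
  have h7 := c.Lddf3.coe_nonneg
  have h8 := c.Ldddf3.coe_nonneg
  have h9 := abs_nonneg c.bzz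
  have h10 := abs_nonneg c.byy
  have h11 := abs_nonneg c.Wzz
  have h12 := abs_nonneg c.Wyy
  have h13 := c.μz_inv_nonneg
  have h14 := c.μy_inv_nonneg
  unfold Constants.L
  refine ⟨?_, ?_, ?_, ?_, ?_, ?_, ?_, ?_, ?_, ?_, ?_, ?_, ?_, ?_, ?_, ?_⟩ <;> linarith

theorem Constants.one_le_L : 1 ≤ c.L := c.le_L.2.2.2.2.2.2.2.2.2.2.2.2.2.2.1

theorem Constants.L_le_R : c.L ≤ c.R := by
  have h1 := c.μz_inv_nonneg
  have h2 := c.one_le_L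
  unfold Constants.R
  have : 0 ≤ c.μz⁻¹ * c.L * c.μz⁻¹ := by positivity
  linarith

theorem Constants.one_le_R : 1 ≤ c.R := c.one_le_L.trans c.L_le_R

end

/-! ### The exact derivatives at an arbitrary point -/

section Exact

variable {n m t : ℕ}

/-- The deterministic assumptions of the trilevel problem. -/
structure Problem (c : Constants) (F1 F2 F3 : Pt n m t → ℝ) : Prop where
  smooth : Smooth c F1 F2 F3
  convZ : ∀ x y, StronglyConvex c.μz fun z => F3 (pt x y z)
  convY : ∀ x, StronglyConvex c.μy (fbar F2 F3 x)

/-- The exact `∇²_{ya} f̄` formula at an arbitrary point. -/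
def exHess {A : Type} [NormedAddCommGroup A] [NormedSpace ℝ A] (F2 F3 : Pt n m t → ℝ)
    (a : A →L[ℝ] Pt n m t) (p : Pt n m t) : A →L[ℝ] Dual (Vec m) :=
  fbarHess a (fderiv ℝ (fderiv ℝ F2) p) (fderiv ℝ (fderiv ℝ (fderiv ℝ F3)) p)
    (fderiv ℝ (fderiv ℝ F3) p) (invZZ (fderiv ℝ (fderiv ℝ F3) p))
    (invZZ (fderiv ℝ (fderiv ℝ F3) p)) (fderiv ℝ F2 p)
    (zJac (invZZ (fderiv ℝ (fderiv ℝ F3) p)) (fderiv ℝ (fderiv ℝ F3) p) a)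

/-- The exact `∇_y f̄` formula at an arbitrary point. -/
def exGrad (F2 F3 : Pt n m t → ℝ) (p : Pt n m t) : Dual (Vec m) :=
  mlForm (fderiv ℝ F2 p) (fderiv ℝ (fderiv ℝ F3) p) (invZZ (fderiv ℝ (fderiv ℝ F3) p))

/-- The exact `∇f` formula at an arbitrary point. -/
def exUpper (F1 F2 F3 : Pt n m t → ℝ) (p : Pt n m t) : Dual (Vec n) :=
  ulForm (fderiv ℝ F1 p) (fderiv ℝ (fderiv ℝ F3) p) (invZZ (fderiv ℝ (fderiv ℝ F3) p))
    (exHess F2 F3 inX p) (exHess F2 F3 inY p).inverse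

variable {c : Constants} {F1 F2 F3 : Pt n m t → ℝ}

theorem near_of_lipschitz {E : Type*} [NormedAddCommGroup E] {R δ : ℝ} {K L : ℝ≥0}
    {f : Pt n m t → E} (hf : LipschitzWith L f) (hb : ∀ p, ‖f p‖ ≤ K) (hK : (K : ℝ) ≤ R)
    (hL : (L : ℝ) ≤ R) (p p' : Pt n m t) (hδ : ‖p - p'‖ ≤ δ) : Near R δ (f p) (f p') := by
  refine ⟨(hb p).trans hK, (hb p').trans hK, ?_⟩
  have h := hf.norm_sub_le p p'
  exact h.trans (mul_le_mul hL hδ (norm_nonneg _) (L.coe_nonneg.trans hL))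

namespace Smooth

variable (h : Smooth c F1 F2 F3)
include h

theorem hasFDerivAt1 (p) : HasFDerivAt F1 (fderiv ℝ F1 p) p :=
  (h.contDiff1.differentiable (by norm_num) p).hasFDerivAt

theorem hasFDerivAt2 (p) : HasFDerivAt F2 (fderiv ℝ F2 p) p :=
  (h.contDiff2.differentiable (by norm_num) p).hasFDerivAt

theorem hasFDerivAt22 (p) : HasFDerivAt (fderiv ℝ F2) (fderiv ℝ (fderiv ℝ F2) p) p :=
  ((h.contDiff2.fderiv_right (m := 1) (by norm_num)).differentiable (by norm_num) p).hasFDerivAt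

theorem hasFDerivAt3 (p) : HasFDerivAt F3 (fderiv ℝ F3 p) p :=
  (h.contDiff3.differentiable (by norm_num) p).hasFDerivAt

theorem hasFDerivAt32 (p) : HasFDerivAt (fderiv ℝ F3) (fderiv ℝ (fderiv ℝ F3) p) p :=
  ((h.contDiff3.fderiv_right (m := 2) (by norm_num)).differentiable (by norm_num) p).hasFDerivAt

theorem hasFDerivAt33 (p) : HasFDerivAt (fderiv ℝ (fderiv ℝ F3))
    (fderiv ℝ (fderiv ℝ (fderiv ℝ F3)) p) p :=
  (((h.contDiff3.fderiv_right (m := 2) (by norm_num)).fderiv_right (m := 1)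
    (by norm_num)).differentiable (by norm_num) p).hasFDerivAt

theorem symm3 (p v w : Pt n m t) :
    fderiv ℝ (fderiv ℝ F3) p v w = fderiv ℝ (fderiv ℝ F3) p w v :=
  second_derivative_symmetric h.hasFDerivAt3 (h.hasFDerivAt32 p) v w

theorem norm_df1_le (p) : ‖fderiv ℝ F1 p‖ ≤ c.Lf1 := norm_fderiv_le_of_lipschitz ℝ h.lip_f1
theorem norm_ddf2_le (p) : ‖fderiv ℝ (fderiv ℝ F2) p‖ ≤ c.Ldf2 :=
  norm_fderiv_le_of_lipschitz ℝ h.lip_df2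
theorem norm_ddf3_le (p) : ‖fderiv ℝ (fderiv ℝ F3) p‖ ≤ c.Ldf3 :=
  norm_fderiv_le_of_lipschitz ℝ h.lip_df3
theorem norm_dddf3_le (p) : ‖fderiv ℝ (fderiv ℝ (fderiv ℝ F3)) p‖ ≤ c.Lddf3 :=
  norm_fderiv_le_of_lipschitz ℝ h.lip_ddf3

theorem norm_dzf2_le (p : Pt n m t) : ‖fderiv ℝ F2 p ∘L (inZ : Vec t →L[ℝ] Pt n m t)‖ ≤ c.Lf2 := by
  obtain ⟨x, y, z, rfl⟩ := exists_eq_pt p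
  have h1 : HasFDerivAt (fun z => pt x y z) (inZ : Vec t →L[ℝ] Pt n m t) z := by
    simp only [pt_eq]
    exact (inZ : Vec t →L[ℝ] Pt n m t).hasFDerivAt.const_add _
  have h2 := (h.hasFDerivAt2 (pt x y z)).comp z h1
  rw [← h2.fderiv]
  exact norm_fderiv_le_of_lipschitz ℝ (h.lip_f2 x y)

variable {p p' : Pt n m t} {δ : ℝ} (hδ : ‖p - p'‖ ≤ δ)
include hδ

theorem near_df1 : Near c.R δ (fderiv ℝ F1 p) (fderiv ℝ F1 p') :=
  near_of_lipschitz h.lip_df1 h.norm_df1_le (c.le_L.1.trans c.L_le_R)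
    (c.le_L.2.1.trans c.L_le_R) _ _ hδ

theorem near_dzf2 : Near c.R δ (fderiv ℝ F2 p ∘L (inZ : Vec t →L[ℝ] Pt n m t))
    (fderiv ℝ F2 p' ∘L (inZ : Vec t →L[ℝ] Pt n m t)) := by
  refine near_of_lipschitz (K := c.Lf2) (L := c.Ldf2)
    (f := fun p => fderiv ℝ F2 p ∘L (inZ : Vec t →L[ℝ] Pt n m t))
    (LipschitzWith.of_dist_le_mul fun q q' => ?_) h.norm_dzf2_le
    (c.le_L.2.2.1.trans c.L_le_R) (c.le_L.2.2.2.1.trans c.L_le_R) _ _ hδ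
  have h1 := h.lip_df2.dist_le_mul q q'
  rw [dist_eq_norm] at h1 ⊢
  rw [← ContinuousLinearMap.sub_comp]
  refine le_trans ?_ h1
  exact (ContinuousLinearMap.opNorm_comp_le _ _).trans
    (mul_le_of_le_one_right (norm_nonneg _) norm_inZ_le)

theorem near_ddf2 : Near c.R δ (fderiv ℝ (fderiv ℝ F2) p) (fderiv ℝ (fderiv ℝ F2) p') :=
  near_of_lipschitz h.lip_ddf2 h.norm_ddf2_le (c.le_L.2.2.2.1.trans c.L_le_R)
    (c.le_L.2.2.2.2.1.trans c.L_le_R) _ _ hδ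

theorem near_ddf3' : Near c.L δ (fderiv ℝ (fderiv ℝ F3) p) (fderiv ℝ (fderiv ℝ F3) p') :=
  near_of_lipschitz h.lip_ddf3 h.norm_ddf3_le c.le_L.2.2.2.2.2.1 c.le_L.2.2.2.2.2.2.1 _ _ hδ

theorem near_ddf3 : Near c.R δ (fderiv ℝ (fderiv ℝ F3) p) (fderiv ℝ (fderiv ℝ F3) p') :=
  (h.near_ddf3' hδ).mono ((norm_nonneg _).trans hδ) c.L_le_R

theorem near_dddf3 : Near c.R δ (fderiv ℝ (fderiv ℝ (fderiv ℝ F3)) p)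
    (fderiv ℝ (fderiv ℝ (fderiv ℝ F3)) p') :=
  near_of_lipschitz h.lip_dddf3 h.norm_dddf3_le (c.le_L.2.2.2.2.2.2.1.trans c.L_le_R)
    (c.le_L.2.2.2.2.2.2.2.1.trans c.L_le_R) _ _ hδ

end Smooth

end Exact

/-! ### The lower-level solution -/

section Lower

variable {n m t : ℕ} {c : Constants} {F1 F2 F3 : Pt n m t → ℝ}

/-- The inclusion `(x, y) ↦ (x, y, 0)`. -/
def inXY : Vec n × Vec m →L[ℝ] Pt n m t :=
  inX ∘L ContinuousLinearMap.fst ℝ _ _ + inY ∘L ContinuousLinearMap.snd ℝ _ _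

/-- The point `(x, y, z(x, y))`. -/
def llPt (F3 : Pt n m t → ℝ) (x : Vec n) (y : Vec m) : Pt n m t := pt x y (zSol F3 x y)

theorem hasFDerivAt_pt_z (x : Vec n) (y : Vec m) (z : Vec t) :
    HasFDerivAt (fun z => pt x y z) (inZ : Vec t →L[ℝ] Pt n m t) z := by
  simp only [pt_eq]
  exact (inZ : Vec t →L[ℝ] Pt n m t).hasFDerivAt.const_add _

/-- Restricting the values of a field along a fixed linear map commutes with differentiation. -/
theorem hasFDerivAt_comp_inclusion {A B : Type} [NormedAddCommGroup A] [NormedSpace ℝ A]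
    [NormedAddCommGroup B] [NormedSpace ℝ B] {g : B → D1 n m t} {g' : B →L[ℝ] D1 n m t} {u : B}
    (hg : HasFDerivAt g g' u) (a : A →L[ℝ] Pt n m t) :
    HasFDerivAt (fun u => g u ∘L a)
      ((ContinuousLinearMap.compL ℝ A (Pt n m t) ℝ).flip a ∘L g') u :=
  ((ContinuousLinearMap.compL ℝ A (Pt n m t) ℝ).flip a).hasFDerivAt.comp u hg

namespace Problem

variable (h : Problem c F1 F2 F3)
include h

theorem fderiv_z (x : Vec n) (y : Vec m) (z : Vec t) :
    fderiv ℝ (fun z => F3 (pt x y z)) z = fderiv ℝ F3 (pt x y z) ∘L inZ :=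
  ((h.smooth.hasFDerivAt3 (pt x y z)).comp z (hasFDerivAt_pt_z x y z)).fderiv

theorem monotone_z (x : Vec n) (y : Vec m) (a b : Vec t) : c.μz * ‖a - b‖ ^ 2 ≤
    (fderiv ℝ F3 (pt x y a) ∘L (inZ : Vec t →L[ℝ] Pt n m t)
      - fderiv ℝ F3 (pt x y b) ∘L (inZ : Vec t →L[ℝ] Pt n m t)) (a - b) := by
  have h1 := (h.convZ x y).monotone a b
  rwa [h.fderiv_z, h.fderiv_z] at h1

theorem coercive_z (p : Pt n m t) (w : Vec t) :
    c.μz * ‖w‖ ^ 2 ≤ blk (fderiv ℝ (fderiv ℝ F3) p) inZ inZ w w := by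
  obtain ⟨x, y, z, rfl⟩ := exists_eq_pt p
  exact coercive_of_monotone (h.monotone_z x y) (hasFDerivAt_comp_inclusion
    ((h.smooth.hasFDerivAt32 (pt x y z)).comp z (hasFDerivAt_pt_z x y z)) inZ) w

theorem isInvertible_z (p : Pt n m t) :
    (blk (fderiv ℝ (fderiv ℝ F3) p) (inZ : Vec t →L[ℝ] Pt n m t) inZ).IsInvertible :=
  isInvertible_of_coercive c.μz_pos (h.coercive_z p)

theorem norm_invZZ_le (p : Pt n m t) : ‖invZZ (fderiv ℝ (fderiv ℝ F3) p)‖ ≤ c.μz⁻¹ :=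
  norm_inverse_le_of_coercive c.μz_pos (h.coercive_z p)

theorem invZZ_symm (p : Pt n m t) (g ℓ : Dual (Vec t)) :
    g (invZZ (fderiv ℝ (fderiv ℝ F3) p) ℓ) = ℓ (invZZ (fderiv ℝ (fderiv ℝ F3) p) g) :=
  inverse_symm (h.isInvertible_z p) (fun _ _ => h.smooth.symm3 _ _ _) g ℓ

theorem zSol_spec (x : Vec n) (y : Vec m) (z' : Vec t) :
    F3 (pt x y (zSol F3 x y)) ≤ F3 (pt x y z') := by
  have h1 : ∃ z, ∀ z', F3 (pt x y z) ≤ F3 (pt x y z') :=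
    (h.convZ x y).exists_isMinOn c.μz_pos fun z =>
      ((h.smooth.hasFDerivAt3 (pt x y z)).comp z (hasFDerivAt_pt_z x y z)).differentiableAt
  exact Classical.epsilon_spec h1 z'

theorem fderiv_zSol (x : Vec n) (y : Vec m) :
    fderiv ℝ F3 (llPt F3 x y) ∘L (inZ : Vec t →L[ℝ] Pt n m t) = 0 := by
  have h1 : IsLocalMin (fun z => F3 (pt x y z)) (zSol F3 x y) :=
    Eventually.of_forall fun z' => h.zSol_spec x y z'
  have h2 := h1.fderiv_eq_zero
  rwa [h.fderiv_z] at h2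

theorem norm_zSol_sub_le (x x' : Vec n) (y y' : Vec m) :
    ‖zSol F3 x y - zSol F3 x' y'‖ ≤ c.R ^ 2 * (‖x - x'‖ + ‖y - y'‖) := by
  have h1 := norm_sub_le_of_zero (ε := c.R * (‖x - x'‖ + ‖y - y'‖))
    (g' := fun z => fderiv ℝ F3 (pt x' y' z) ∘L (inZ : Vec t →L[ℝ] Pt n m t))
    c.μz_pos (h.monotone_z x y) (h.fderiv_zSol x y) (h.fderiv_zSol x' y') ?_
  · refine h1.trans ?_
    have h2 : c.μz⁻¹ ≤ c.R := c.le_L.2.2.2.2.2.2.2.2.2.2.2.2.1.trans c.L_le_R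
    have hR := c.one_le_R
    calc c.R * (‖x - x'‖ + ‖y - y'‖) * c.μz⁻¹ ≤ c.R * (‖x - x'‖ + ‖y - y'‖) * c.R := by gcongr
      _ = _ := by ring
  · have h2 := h.smooth.lip_df3.norm_sub_le (pt x y (zSol F3 x' y')) (pt x' y' (zSol F3 x' y'))
    have h3 := norm_pt_sub_le x x' y y' (zSol F3 x' y') (zSol F3 x' y')
    rw [sub_self, norm_zero, add_zero] at h3
    rw [← ContinuousLinearMap.sub_comp]
    refine (ContinuousLinearMap.opNorm_comp_le _ _).trans ?_
    refine (mul_le_of_le_one_right (norm_nonneg _) norm_inZ_le).trans (h2.trans ?_)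
    have hL : (c.Ldf3 : ℝ) ≤ c.R := c.le_L.2.2.2.2.2.1.trans c.L_le_R
    have hR := c.one_le_R
    gcongr

/-- The lower-level solution is differentiable, with derivative `∇z^⊤`. -/
theorem hasFDerivAt_zSol (u : Vec n × Vec m) :
    HasFDerivAt (fun u : Vec n × Vec m => zSol F3 u.1 u.2)
      (zJac (invZZ (fderiv ℝ (fderiv ℝ F3) (llPt F3 u.1 u.2)))
        (fderiv ℝ (fderiv ℝ F3) (llPt F3 u.1 u.2)) inXY) u := by
  let τ : (Vec n × Vec m) × Vec t →L[ℝ] Pt n m t :=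
    inXY ∘L ContinuousLinearMap.fst ℝ _ _ + inZ ∘L ContinuousLinearMap.snd ℝ _ _
  have hτ : ∀ u z, τ (u, z) = pt u.1 u.2 z := fun u z => by rw [pt_eq]; rfl
  have h1 : HasFDerivAt (fun q => fderiv ℝ F3 (τ q) ∘L (inZ : Vec t →L[ℝ] Pt n m t))
      (blk (fderiv ℝ (fderiv ℝ F3) (llPt F3 u.1 u.2)) inZ τ) (u, zSol F3 u.1 u.2) := by
    have h2 := h.smooth.hasFDerivAt32 (τ (u, zSol F3 u.1 u.2))
    have h3 := hasFDerivAt_comp_inclusion (h2.comp (u, zSol F3 u.1 u.2) τ.hasFDerivAt)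
      (inZ : Vec t →L[ℝ] Pt n m t)
    rw [hτ] at h3
    exact h3
  have e1 : blk (fderiv ℝ (fderiv ℝ F3) (llPt F3 u.1 u.2)) inZ τ ∘L
      ContinuousLinearMap.inr ℝ (Vec n × Vec m) (Vec t)
      = blk (fderiv ℝ (fderiv ℝ F3) (llPt F3 u.1 u.2)) (inZ : Vec t →L[ℝ] Pt n m t) inZ := by
    ext w v; simp [blk_apply, τ]
  have e2 : blk (fderiv ℝ (fderiv ℝ F3) (llPt F3 u.1 u.2)) inZ τ ∘L
      ContinuousLinearMap.inl ℝ (Vec n × Vec m) (Vec t)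
      = blk (fderiv ℝ (fderiv ℝ F3) (llPt F3 u.1 u.2)) (inZ : Vec t →L[ℝ] Pt n m t) inXY := by
    ext w v <;> simp [blk_apply, τ]
  have h4 := hasFDerivAt_of_zero (L := c.R ^ 2 * 2) (v := fun u : Vec n × Vec m => zSol F3 u.1 u.2)
    h1 (fun u' => ?_) (fun u' => ?_) ?_
  · rw [e1, e2] at h4
    exact h4
  · simp only [hτ]
    exact h.fderiv_zSol _ _
  · refine (h.norm_zSol_sub_le _ _ _ _).trans ?_
    rw [mul_assoc]
    refine mul_le_mul_of_nonneg_left ?_ (sq_nonneg _)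
    have h5 : ‖u'.1 - u.1‖ ≤ ‖u' - u‖ := norm_fst_le (u' - u)
    have h6 : ‖u'.2 - u.2‖ ≤ ‖u' - u‖ := norm_snd_le (u' - u)
    linarith
  · rw [e1]
    exact h.isInvertible_z _

/-- The direction in which `(x, y, z(x, y))` moves with `(x, y)`. -/
theorem hasFDerivAt_llPt (u : Vec n × Vec m) :
    HasFDerivAt (fun u : Vec n × Vec m => llPt F3 u.1 u.2)
      (inXY + inZ ∘L zJac (invZZ (fderiv ℝ (fderiv ℝ F3) (llPt F3 u.1 u.2)))
        (fderiv ℝ (fderiv ℝ F3) (llPt F3 u.1 u.2)) inXY) u := by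
  simp only [llPt, pt_eq]
  have h1 := (inXY : Vec n × Vec m →L[ℝ] Pt n m t).hasFDerivAt (x := u)
  exact h1.add ((inZ : Vec t →L[ℝ] Pt n m t).hasFDerivAt.comp u
    (by simpa only [llPt, pt_eq] using h.hasFDerivAt_zSol u))

theorem norm_llPt_sub_le (x x' : Vec n) (y y' : Vec m) :
    ‖llPt F3 x y - llPt F3 x' y'‖ ≤ (1 + c.R ^ 2) * (‖x - x'‖ + ‖y - y'‖) := by
  refine (norm_pt_sub_le _ _ _ _ _ _).trans ?_
  have := h.norm_zSol_sub_le x x' y y'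
  linarith

/-- The derivative of the field `w = V g` solving `A w = g` is `V (g' - A' w)`; this gives the
derivative of the formula for `∇_y f̄` in all directions of the space of points. -/
theorem hasFDerivAt_exGrad (p : Pt n m t) :
    HasFDerivAt (exGrad F2 F3) (fbarHess (ContinuousLinearMap.id ℝ (Pt n m t))
      (fderiv ℝ (fderiv ℝ F2) p) (fderiv ℝ (fderiv ℝ (fderiv ℝ F3)) p)
      (fderiv ℝ (fderiv ℝ F3) p) (invZZ (fderiv ℝ (fderiv ℝ F3) p))
      (invZZ (fderiv ℝ (fderiv ℝ F3) p)) (fderiv ℝ F2 p) 0) p := by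
  set H : Pt n m t → D2 n m t := fderiv ℝ (fderiv ℝ F3)
  set T := fderiv ℝ H p
  have hH : HasFDerivAt H T p := h.smooth.hasFDerivAt33 p
  have hg : HasFDerivAt (fderiv ℝ F2) (fderiv ℝ (fderiv ℝ F2) p) p := h.smooth.hasFDerivAt22 p
  -- a block of `H`, applied to a fixed inclusion on either side
  have hblk : ∀ {A B : Type} [NormedAddCommGroup A] [NormedSpace ℝ A] [NormedAddCommGroup B]
      [NormedSpace ℝ B] (a : A →L[ℝ] Pt n m t) (b : B →L[ℝ] Pt n m t),
      ∃ Φ : D2 n m t →L[ℝ] B →L[ℝ] Dual A, ∀ K, Φ K = blk K a b := by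
    intro A B _ _ _ _ a b
    exact ⟨(ContinuousLinearMap.compL ℝ B (D1 n m t) (Dual A)
      ((ContinuousLinearMap.compL ℝ A (Pt n m t) ℝ).flip a)) ∘L
      (ContinuousLinearMap.compL ℝ B (Pt n m t) (D1 n m t)).flip b, fun K => rfl⟩
  obtain ⟨ΦZ, hΦZ⟩ := hblk (inZ : Vec t →L[ℝ] Pt n m t) (inZ : Vec t →L[ℝ] Pt n m t)
  obtain ⟨ΦY, hΦY⟩ := hblk (inY : Vec m →L[ℝ] Pt n m t) (inZ : Vec t →L[ℝ] Pt n m t)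
  have hAZ : HasFDerivAt (fun q => blk (H q) (inZ : Vec t →L[ℝ] Pt n m t) inZ) (ΦZ ∘L T) p := by
    exact (ΦZ.hasFDerivAt.comp p hH).congr_of_eventuallyEq
      (Eventually.of_forall fun q => (hΦZ _).symm)
  have hAY : HasFDerivAt (fun q => blk (H q) (inY : Vec m →L[ℝ] Pt n m t) (inZ : Vec t →L[ℝ] _))
      (ΦY ∘L T) p := by
    exact (ΦY.hasFDerivAt.comp p hH).congr_of_eventuallyEq
      (Eventually.of_forall fun q => (hΦY _).symm)
  have hgZ := hasFDerivAt_comp_inclusion hg (inZ : Vec t →L[ℝ] Pt n m t)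
  have hgY := hasFDerivAt_comp_inclusion hg (inY : Vec m →L[ℝ] Pt n m t)
  have hVd : DifferentiableAt ℝ (fun q => invZZ (H q)) p :=
    (((h.isInvertible_z p).contDiffAt_map_inverse (n := 1)).differentiableAt
      (by norm_num)).comp p hAZ.differentiableAt
  obtain ⟨V', hV'⟩ : ∃ V', HasFDerivAt (fun q => invZZ (H q)) V' p := ⟨_, hVd.hasFDerivAt⟩
  obtain ⟨w', hw'⟩ : ∃ w', HasFDerivAt (fun q => invZZ (H q) (fderiv ℝ F2 q ∘L inZ)) w' p :=
    ⟨_, (hV'.clm_apply hgZ)⟩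
  have hprod := hAZ.clm_apply hw'
  have hw : w' = invZZ (H p) ∘L ((ContinuousLinearMap.compL ℝ (Vec t) (Pt n m t) ℝ).flip inZ ∘L
      fderiv ℝ (fderiv ℝ F2) p
      - (ΦZ ∘L T).flip (invZZ (H p) (fderiv ℝ F2 p ∘L inZ))) := by
    have e := hprod.unique (hgZ.congr_of_eventuallyEq (Eventually.of_forall fun q => by
      exact (h.isInvertible_z q).self_apply_inverse _))
    ext1 v
    rw [ContinuousLinearMap.comp_apply, ← e]
    simp only [add_sub_cancel_right, ContinuousLinearMap.comp_apply, invZZ]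
    exact ((h.isInvertible_z p).inverse_apply_self _).symm
  refine (hgY.sub (hAY.clm_apply hw')).congr_fderiv ?_
  rw [hw]
  ext v y
  set w := invZZ (H p) (fderiv ℝ F2 p ∘L inZ)
  have e1 : ΦZ (T v) w = blk (T.flip (inZ w)) inZ (ContinuousLinearMap.id ℝ (Pt n m t)) v := by
    rw [hΦZ]; rfl
  have e2 : ΦY (T v) w y = T v (inZ w) (inY y) := by
    rw [hΦY]; rfl
  have e3 : fderiv ℝ (fderiv ℝ F2) p v ∘L inZ
      = blk (fderiv ℝ (fderiv ℝ F2) p) (inZ : Vec t →L[ℝ] Pt n m t)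
        (ContinuousLinearMap.id ℝ (Pt n m t)) v := rfl
  simp [fbarHess, blk_apply, ← hΦY]
  rw [e1, e2, e3]
  ring

end Problem

end Lower

/-! ### The middle-level and the upper-level problem -/

section Upper

theorem zJac_comp {n m t : ℕ} {A B : Type} [NormedAddCommGroup A] [NormedSpace ℝ A]
    [NormedAddCommGroup B] [NormedSpace ℝ B] (V : Dual (Vec t) →L[ℝ] Vec t) (H : D2 n m t)
    (a : A →L[ℝ] Pt n m t) (b : B →L[ℝ] A) : zJac V H (a ∘L b) = zJac V H a ∘L b := by
  ext v : 1
  simp only [zJac, neg_apply, ContinuousLinearMap.comp_apply]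
  rfl

theorem fbarHess_id_comp {n m t : ℕ} {A : Type} [NormedAddCommGroup A] [NormedSpace ℝ A]
    (a : A →L[ℝ] Pt n m t) (H : D2 n m t) (T : D3 n m t) (K : D2 n m t)
    (V₁ V₂ : Dual (Vec t) →L[ℝ] Vec t) (g : D1 n m t) (J : A →L[ℝ] Vec t) :
    fbarHess (ContinuousLinearMap.id ℝ (Pt n m t)) H T K V₁ V₂ g 0 ∘L (a + inZ ∘L J)
      = fbarHess a H T K V₁ V₂ g J := by
  simp only [fbarHess, ContinuousLinearMap.comp_zero, add_zero]
  rfl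

theorem fbarHess_comp {n m t : ℕ} {A B : Type} [NormedAddCommGroup A] [NormedSpace ℝ A]
    [NormedAddCommGroup B] [NormedSpace ℝ B]
    (a : A →L[ℝ] Pt n m t) (H : D2 n m t) (T : D3 n m t) (K : D2 n m t)
    (V₁ V₂ : Dual (Vec t) →L[ℝ] Vec t) (g : D1 n m t) (J : A →L[ℝ] Vec t) (b : B →L[ℝ] A) :
    fbarHess (a ∘L b) H T K V₁ V₂ g (J ∘L b) = fbarHess a H T K V₁ V₂ g J ∘L b := by
  rw [← fbarHess_id_comp, ← fbarHess_id_comp a]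
  rfl

variable {n m t : ℕ} {c : Constants} {F1 F2 F3 : Pt n m t → ℝ}

theorem exHess_comp {A B : Type} [NormedAddCommGroup A] [NormedSpace ℝ A]
    [NormedAddCommGroup B] [NormedSpace ℝ B] (a : A →L[ℝ] Pt n m t) (b : B →L[ℝ] A)
    (p : Pt n m t) : exHess F2 F3 (a ∘L b) p = exHess F2 F3 a p ∘L b := by
  simp only [exHess, zJac_comp, fbarHess_comp]

/-- The point `(x, y(x), z(x))`. -/
def ulPt (F2 F3 : Pt n m t → ℝ) (x : Vec n) : Pt n m t := llPt F3 x (ySol F2 F3 x)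

/-- The derivative of the middle-level solution, as a formula at an arbitrary point. -/
def yJac (F2 F3 : Pt n m t → ℝ) (p : Pt n m t) : Vec n →L[ℝ] Vec m :=
  -((exHess F2 F3 inY p).inverse ∘L exHess F2 F3 inX p)

theorem inXY_comp_inr : (inXY : Vec n × Vec m →L[ℝ] Pt n m t) ∘L ContinuousLinearMap.inr ℝ _ _
    = inY := by
  ext1 v; simp [inXY]

theorem inXY_comp_inl : (inXY : Vec n × Vec m →L[ℝ] Pt n m t) ∘L ContinuousLinearMap.inl ℝ _ _
    = inX := by
  ext1 v; simp [inXY]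

theorem near_invZZ (c : Constants) {n m t : ℕ} {F1 F2 F3 : Pt n m t → ℝ}
    (h : Problem c F1 F2 F3) {p p' : Pt n m t} {δ : ℝ} (hδ : ‖p - p'‖ ≤ δ) :
    Near c.R δ (invZZ (fderiv ℝ (fderiv ℝ F3) p)) (invZZ (fderiv ℝ (fderiv ℝ F3) p')) := by
  have hδ0 := (norm_nonneg _).trans hδ
  have h2 := Near.inverse (R := c.L) (h.isInvertible_z p) (h.isInvertible_z p') hδ0
    (h.norm_invZZ_le p) (h.norm_invZZ_le p') ?_
  · refine h2.mono hδ0 ?_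
    have := c.one_le_L
    unfold Constants.R
    linarith
  · have h3 := h.smooth.near_ddf3' hδ
    have h4 := c.one_le_L
    have hb : ∀ H : D2 n m t, ‖blk H (inZ : Vec t →L[ℝ] Pt n m t) inZ‖ ≤ ‖H‖ := fun H => by
      refine (norm_blk_le H _ _).trans ?_
      have := norm_inZ_le (n := n) (m := m) (t := t)
      have h0 : ‖(inZ : Vec t →L[ℝ] Pt n m t)‖ * ‖(inZ : Vec t →L[ℝ] Pt n m t)‖ ≤ 1 :=
        mul_le_one₀ this (norm_nonneg _) this
      rw [mul_assoc]
      exact mul_le_of_le_one_right (norm_nonneg _) h0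
    refine ⟨(hb _).trans h3.1, (hb _).trans h3.2.1, ?_⟩
    rw [← blk_sub]
    exact (hb _).trans h3.2.2

/-- `∇²_{ya} f̄` is bounded and Lipschitz continuous, uniformly over all problems with the given
constants. -/
theorem exists_near_exHess (c : Constants) : ∃ C, ∀ {n m t : ℕ} {A : Type} [NormedAddCommGroup A]
    [NormedSpace ℝ A] {F1 F2 F3 : Pt n m t → ℝ} {p p' : Pt n m t} {δ : ℝ} {a : A →L[ℝ] Pt n m t},
    Problem c F1 F2 F3 → ‖p - p'‖ ≤ δ → ‖a‖ ≤ 1 →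
    Near C δ (exHess F2 F3 a p) (exHess F2 F3 a p') := by
  obtain ⟨C₁, h₁⟩ := exists_near_zJac c.R
  obtain ⟨C₂, h₂⟩ := exists_near_fbarHess (max c.R C₁)
  refine ⟨C₂, fun {n m t A _ _ F1 F2 F3 p p' δ a} h hδ ha => ?_⟩
  have hδ0 := (norm_nonneg _).trans hδ
  have hV := near_invZZ c h hδ
  have hJ := h₁ hδ0 ha hV (h.smooth.near_ddf3 hδ)
  have hl := le_max_left c.R C₁
  exact h₂ hδ0 ha ((h.smooth.near_ddf2 hδ).mono hδ0 hl) ((h.smooth.near_dddf3 hδ).mono hδ0 hl)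
    ((h.smooth.near_ddf3 hδ).mono hδ0 hl) (hV.mono hδ0 hl) (hV.mono hδ0 hl)
    ((h.smooth.near_dzf2 hδ).mono hδ0 hl) (hJ.mono hδ0 (le_max_right _ _))

/-- A bound and Lipschitz constant of `∇²_{ya} f̄`. -/
def Constants.Ch (c : Constants) : ℝ := max c.R (exists_near_exHess c).choose

theorem Constants.R_le_Ch (c : Constants) : c.R ≤ c.Ch := le_max_left _ _

namespace Problem

variable (h : Problem c F1 F2 F3)
include h

theorem near_exHess {A : Type} [NormedAddCommGroup A] [NormedSpace ℝ A] {p p' : Pt n m t} {δ : ℝ}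
    {a : A →L[ℝ] Pt n m t} (hδ : ‖p - p'‖ ≤ δ) (ha : ‖a‖ ≤ 1) :
    Near c.Ch δ (exHess F2 F3 a p) (exHess F2 F3 a p') :=
  ((exists_near_exHess c).choose_spec h hδ ha).mono ((norm_nonneg _).trans hδ) (le_max_right _ _)

theorem norm_exHess_le {A : Type} [NormedAddCommGroup A] [NormedSpace ℝ A] (p : Pt n m t)
    {a : A →L[ℝ] Pt n m t} (ha : ‖a‖ ≤ 1) : ‖exHess F2 F3 a p‖ ≤ c.Ch :=
  (h.near_exHess (p := p) (p' := p) (δ := 0) (by simp) ha).1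

/-- The direct formula for a directional derivative agrees with its adjoint form. -/
theorem comp_zJac_eq {A : Type} [NormedAddCommGroup A] [NormedSpace ℝ A] (g : D1 n m t)
    (a : A →L[ℝ] Pt n m t) (p : Pt n m t) :
    g ∘L (a + inZ ∘L zJac (invZZ (fderiv ℝ (fderiv ℝ F3) p)) (fderiv ℝ (fderiv ℝ F3) p) a)
      = g ∘L a - blk (fderiv ℝ (fderiv ℝ F3) p) a inZ
        (invZZ (fderiv ℝ (fderiv ℝ F3) p) (g ∘L inZ)) := by
  ext v
  have h1 := h.invZZ_symm p (g ∘L inZ) (blk (fderiv ℝ (fderiv ℝ F3) p) inZ a v)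
  simp only [ContinuousLinearMap.comp_apply] at h1
  simp only [zJac, ContinuousLinearMap.comp_apply, add_apply, sub_apply, neg_apply, map_add,
    map_neg, h1, blk_apply]
  rw [h.smooth.symm3 p (a v)]
  ring

theorem hasFDerivAt_fbar (x : Vec n) (y : Vec m) :
    HasFDerivAt (fbar F2 F3 x) (exGrad F2 F3 (llPt F3 x y)) y := by
  have h1 := (h.smooth.hasFDerivAt2 (llPt F3 x y)).comp (x, y) (h.hasFDerivAt_llPt (x, y))
  have h2 := h1.comp y (hasFDerivAt_prodMk_right x y)
  refine h2.congr_fderiv ?_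
  rw [exGrad, mlForm, ← h.comp_zJac_eq, ContinuousLinearMap.comp_assoc,
    ContinuousLinearMap.add_comp, ContinuousLinearMap.comp_assoc, ← zJac_comp, inXY_comp_inr]

theorem hasFDerivAt_exGrad_llPt (u : Vec n × Vec m) :
    HasFDerivAt (fun u : Vec n × Vec m => exGrad F2 F3 (llPt F3 u.1 u.2))
      (exHess F2 F3 inXY (llPt F3 u.1 u.2)) u := by
  have h1 := (h.hasFDerivAt_exGrad (llPt F3 u.1 u.2)).comp u (h.hasFDerivAt_llPt u)
  rw [fbarHess_id_comp] at h1
  exact h1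

theorem hasFDerivAt_exGrad_y (x : Vec n) (y : Vec m) :
    HasFDerivAt (fun y => exGrad F2 F3 (llPt F3 x y)) (exHess F2 F3 inY (llPt F3 x y)) y := by
  have h2 := (h.hasFDerivAt_exGrad_llPt (x, y)).comp y (hasFDerivAt_prodMk_right x y)
  rw [← exHess_comp, inXY_comp_inr] at h2
  exact h2

theorem hasFDerivAt_exGrad_x (x : Vec n) (y : Vec m) :
    HasFDerivAt (fun x => exGrad F2 F3 (llPt F3 x y)) (exHess F2 F3 inX (llPt F3 x y)) x := by
  have h2 := HasFDerivAt.comp (f := fun x : Vec n => (x, y)) x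
    (h.hasFDerivAt_exGrad_llPt (x, y)) (hasFDerivAt_prodMk_left x y)
  rw [← exHess_comp, inXY_comp_inl] at h2
  exact h2

theorem fderiv_fbar (x : Vec n) (y : Vec m) :
    fderiv ℝ (fbar F2 F3 x) y = exGrad F2 F3 (llPt F3 x y) := (h.hasFDerivAt_fbar x y).fderiv

theorem monotone_y (x : Vec n) (a b : Vec m) : c.μy * ‖a - b‖ ^ 2 ≤
    (exGrad F2 F3 (llPt F3 x a) - exGrad F2 F3 (llPt F3 x b)) (a - b) := by
  have h1 := (h.convY x).monotone a b
  rwa [h.fderiv_fbar, h.fderiv_fbar] at h1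

theorem coercive_y (x : Vec n) (y : Vec m) (w : Vec m) :
    c.μy * ‖w‖ ^ 2 ≤ exHess F2 F3 inY (llPt F3 x y) w w :=
  coercive_of_monotone (h.monotone_y x) (h.hasFDerivAt_exGrad_y x y) w

theorem isInvertible_y (x : Vec n) (y : Vec m) :
    (exHess F2 F3 inY (llPt F3 x y)).IsInvertible :=
  isInvertible_of_coercive c.μy_pos (h.coercive_y x y)

theorem norm_inverse_y_le (x : Vec n) (y : Vec m) :
    ‖(exHess F2 F3 inY (llPt F3 x y)).inverse‖ ≤ c.μy⁻¹ :=
  norm_inverse_le_of_coercive c.μy_pos (h.coercive_y x y)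

theorem symm_y (x : Vec n) (y v w : Vec m) :
    exHess F2 F3 inY (llPt F3 x y) v w = exHess F2 F3 inY (llPt F3 x y) w v :=
  second_derivative_symmetric (h.hasFDerivAt_fbar x) (h.hasFDerivAt_exGrad_y x y) v w

theorem ySol_spec (x : Vec n) (y' : Vec m) :
    fbar F2 F3 x (ySol F2 F3 x) ≤ fbar F2 F3 x y' := by
  have h1 : ∃ y, ∀ y', fbar F2 F3 x y ≤ fbar F2 F3 x y' :=
    (h.convY x).exists_isMinOn c.μy_pos fun y => (h.hasFDerivAt_fbar x y).differentiableAt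
  exact Classical.epsilon_spec h1 y'

theorem exGrad_ulPt (x : Vec n) : exGrad F2 F3 (ulPt F2 F3 x) = 0 := by
  have h1 : IsLocalMin (fbar F2 F3 x) (ySol F2 F3 x) :=
    Eventually.of_forall fun y' => h.ySol_spec x y'
  have h2 := h1.fderiv_eq_zero
  rwa [h.fderiv_fbar] at h2

theorem norm_ySol_sub_le (x x' : Vec n) :
    ‖ySol F2 F3 x - ySol F2 F3 x'‖ ≤ c.Ch * c.R * ‖x - x'‖ := by
  have h1 := norm_sub_le_of_zero (ε := c.Ch * ‖x - x'‖)
    (g' := fun y => exGrad F2 F3 (llPt F3 x' y)) c.μy_pos (h.monotone_y x)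
    (h.exGrad_ulPt x) (h.exGrad_ulPt x') ?_
  · refine h1.trans ?_
    have h2 : c.μy⁻¹ ≤ c.R := c.le_L.2.2.2.2.2.2.2.2.2.2.2.2.2.1.trans c.L_le_R
    have hR := c.one_le_R
    have hCh : 0 ≤ c.Ch := by linarith [c.R_le_Ch]
    calc c.Ch * ‖x - x'‖ * c.μy⁻¹ ≤ c.Ch * ‖x - x'‖ * c.R := by gcongr
      _ = _ := by ring
  · exact norm_image_sub_le_of_deriv (fun x => h.hasFDerivAt_exGrad_x x (ySol F2 F3 x'))
      (fun x => h.norm_exHess_le _ norm_inX_le) x x'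

theorem norm_exGrad_sub_le (x : Vec n) (y y' : Vec m) :
    ‖exGrad F2 F3 (llPt F3 x y) - exGrad F2 F3 (llPt F3 x y')‖ ≤ c.Ch * ‖y - y'‖ :=
  norm_image_sub_le_of_deriv (h.hasFDerivAt_exGrad_y x)
    (fun _ => h.norm_exHess_le _ norm_inY_le) y y'

theorem hasFDerivAt_ySol (x : Vec n) :
    HasFDerivAt (ySol F2 F3) (yJac F2 F3 (ulPt F2 F3 x)) x := by
  have h1 := hasFDerivAt_of_zero (v := ySol F2 F3) (u := x) (L := c.Ch * c.R)
    (h.hasFDerivAt_exGrad_llPt (x, ySol F2 F3 x)) (fun x' => h.exGrad_ulPt x')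
    (fun x' => h.norm_ySol_sub_le x' x) (by
      rw [← exHess_comp, inXY_comp_inr]
      exact h.isInvertible_y _ _)
  rw [← exHess_comp, ← exHess_comp, inXY_comp_inr, inXY_comp_inl] at h1
  exact h1

/-- The upper-level objective is differentiable, and its gradient is given by the adjoint
formula. -/
theorem hasFDerivAt_upper (x : Vec n) :
    HasFDerivAt (upper F1 F2 F3) (exUpper F1 F2 F3 (ulPt F2 F3 x)) x := by
  have h1 : HasFDerivAt (fun x => (x, ySol F2 F3 x))
      ((ContinuousLinearMap.id ℝ (Vec n)).prod (yJac F2 F3 (ulPt F2 F3 x))) x :=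
    (hasFDerivAt_id x).prodMk (h.hasFDerivAt_ySol x)
  have h3 : HasFDerivAt (ulPt F2 F3) _ x :=
    HasFDerivAt.comp (f := fun x => (x, ySol F2 F3 x)) x (h.hasFDerivAt_llPt (x, ySol F2 F3 x)) h1
  have h2 := HasFDerivAt.comp (f := ulPt F2 F3) x (h.smooth.hasFDerivAt1 (ulPt F2 F3 x)) h3
  refine h2.congr_fderiv ?_
  set p := ulPt F2 F3 x with hp
  have e : (ContinuousLinearMap.id ℝ (Vec n)).prod (yJac F2 F3 p)
      = ContinuousLinearMap.inl ℝ (Vec n) (Vec m)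
        + ContinuousLinearMap.inr ℝ (Vec n) (Vec m) ∘L yJac F2 F3 p := by
    ext v <;> simp
  have e2 : llPt F3 x (ySol F2 F3 x) = p := rfl
  simp only [e2]
  have e3 := h.comp_zJac_eq (fderiv ℝ F1 p) (inX : Vec n →L[ℝ] Pt n m t) p
  have e4 := h.comp_zJac_eq (fderiv ℝ F1 p) (inY : Vec m →L[ℝ] Pt n m t) p
  rw [e, ContinuousLinearMap.comp_add, ← ContinuousLinearMap.comp_assoc,
    ContinuousLinearMap.add_comp, ContinuousLinearMap.add_comp, ContinuousLinearMap.comp_assoc,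
    ContinuousLinearMap.comp_assoc, ← zJac_comp, ← zJac_comp, inXY_comp_inr, inXY_comp_inl,
    ContinuousLinearMap.comp_add, e3, ← ContinuousLinearMap.comp_assoc, e4, exUpper, ulForm,
    sub_eq_add_neg _ ((exHess F2 F3 inX p).flip _)]
  congr 1
  ext v
  have e5 := inverse_symm (h.isInvertible_y x (ySol F2 F3 x)) (h.symm_y x (ySol F2 F3 x))
    (fderiv ℝ F1 p ∘L inY - blk (fderiv ℝ (fderiv ℝ F3) p) inY inZ
        (invZZ (fderiv ℝ (fderiv ℝ F3) p) (fderiv ℝ F1 p ∘L inZ))) (exHess F2 F3 inX p v)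
  rw [e2] at e5
  rw [neg_apply, ContinuousLinearMap.flip_apply, ← e5, ContinuousLinearMap.comp_apply, yJac,
    neg_apply, map_neg, ContinuousLinearMap.comp_apply]

theorem norm_ulPt_sub_le (x x' : Vec n) :
    ‖ulPt F2 F3 x - ulPt F2 F3 x'‖ ≤ (1 + c.R ^ 2) * (1 + c.Ch * c.R) * ‖x - x'‖ := by
  refine (h.norm_llPt_sub_le _ _ _ _).trans ?_
  have h1 := h.norm_ySol_sub_le x x'
  rw [mul_assoc]
  refine mul_le_mul_of_nonneg_left ?_ (by positivity)
  linarith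

end Problem

end Upper

/-! ### Stability of the directions -/

section Stability

theorem Near.of_norm_sub_le {E : Type*} [NormedAddCommGroup E] {R δ θ δ' : ℝ} {a a' b : E}
    (h : Near R δ a b) (ha : ‖a'‖ ≤ R) (h' : ‖a' - a‖ ≤ R * θ) (hδ : δ + θ ≤ δ') :
    Near R δ' a' b := by
  refine ⟨ha, h.2.1, ?_⟩
  calc ‖a' - b‖ = ‖(a' - a) + (a - b)‖ := by congr 1; abel
    _ ≤ R * θ + R * δ := norm_add_le_of_le h' h.2.2
    _ ≤ R * δ' := by rw [← mul_add, add_comm]; exact mul_le_mul_of_nonneg_left hδ h.nonneg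

/-- The mean of the upper-level direction, in terms of the means `V` and `W` of the inverses. -/
def ulMean {n m t : ℕ} (F1 F2 F3 : Pt n m t → ℝ) (p : Pt n m t)
    (V : Dual (Vec t) →L[ℝ] Vec t) (W : Dual (Vec m) →L[ℝ] Vec m) : Dual (Vec n) :=
  ulForm (fderiv ℝ F1 p) (fderiv ℝ (fderiv ℝ F3) p) V
    (fbarHess inX (fderiv ℝ (fderiv ℝ F2) p) (fderiv ℝ (fderiv ℝ (fderiv ℝ F3)) p)
      (fderiv ℝ (fderiv ℝ F3) p) V V (fderiv ℝ F2 p) (zJac V (fderiv ℝ (fderiv ℝ F3) p) inX)) W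

/-- The upper-level direction at `p`, with perturbed inverses, is close to the exact gradient of
the upper-level objective. -/
theorem exists_near_ulMean (c : Constants) : ∃ C, ∀ {n m t : ℕ} {F1 F2 F3 : Pt n m t → ℝ}
    (x : Vec n) (p : Pt n m t) (V : Dual (Vec t) →L[ℝ] Vec t) (W : Dual (Vec m) →L[ℝ] Vec m)
    (θ : ℝ), Problem c F1 F2 F3 → 0 ≤ θ → θ ≤ 1 →
    ‖V‖ ≤ c.R → ‖V - invZZ (fderiv ℝ (fderiv ℝ F3) p)‖ ≤ c.R * θ → ‖W‖ ≤ c.R →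
    (exHess F2 F3 inY p).IsInvertible → ‖W - (exHess F2 F3 inY p).inverse‖ ≤ c.R * θ →
    Near C (‖p - ulPt F2 F3 x‖ + θ) (ulMean F1 F2 F3 p V W)
      (exUpper F1 F2 F3 (ulPt F2 F3 x)) := by
  obtain ⟨C₁, h₁⟩ := exists_near_zJac c.R
  obtain ⟨C₂, h₂⟩ := exists_near_fbarHess (max c.R C₁)
  let S := 2 * c.R + 2 * c.R * c.Ch * (2 * c.R)
  obtain ⟨C₃, h₃⟩ := exists_near_ulForm (max (max c.R C₂) S)
  refine ⟨C₃, ?_⟩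
  intro n m t F1 F2 F3 x p V W θ h hθ hθ1 hV hV' hW hi hW'
  set q := ulPt F2 F3 x with hq
  set δ := ‖p - q‖ + θ with hδ
  have hR := c.one_le_R
  have hpq : ‖p - q‖ ≤ δ := by linarith
  have hδ0 : 0 ≤ δ := (norm_nonneg _).trans hpq
  have nV : Near c.R δ V (invZZ (fderiv ℝ (fderiv ℝ F3) q)) :=
    (near_invZZ c h le_rfl).of_norm_sub_le hV hV' le_rfl
  have nH3 := h.smooth.near_ddf3 hpq
  have nJ := h₁ hδ0 norm_inX_le nV nH3
  have hl := le_max_left c.R C₁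
  have nB := h₂ hδ0 norm_inX_le ((h.smooth.near_ddf2 hpq).mono hδ0 hl)
    ((h.smooth.near_dddf3 hpq).mono hδ0 hl)
    (nH3.mono hδ0 hl) (nV.mono hδ0 hl) (nV.mono hδ0 hl)
    ((h.smooth.near_dzf2 hpq).mono hδ0 hl) (nJ.mono hδ0 (le_max_right _ _))
  have hμy : c.μy⁻¹ ≤ c.R := c.le_L.2.2.2.2.2.2.2.2.2.2.2.2.2.1.trans c.L_le_R
  have hp : ‖(exHess F2 F3 inY p).inverse‖ ≤ 2 * c.R := by
    have e : (exHess F2 F3 inY p).inverse = W - (W - (exHess F2 F3 inY p).inverse) := by abel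
    rw [e]
    refine (norm_sub_le_of_le hW hW').trans ?_
    nlinarith
  have nI : Near S ‖p - q‖ (exHess F2 F3 inY p).inverse (exHess F2 F3 inY q).inverse :=
    Near.inverse hi (h.isInvertible_y x _) (norm_nonneg _) hp
      ((h.norm_inverse_y_le x _).trans (by linarith)) (h.near_exHess le_rfl norm_inY_le)
  have hS : c.R ≤ S := by
    have h1 := c.R_le_Ch
    have h2 : 0 ≤ c.R * c.Ch * c.R := by
      have : 0 ≤ c.Ch := by linarith
      positivity
    simp only [S]
    nlinarith
  have nW : Near S δ W (exHess F2 F3 inY q).inverse :=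
    nI.of_norm_sub_le (hW.trans hS) (hW'.trans (mul_le_mul_of_nonneg_right hS hθ)) le_rfl
  have hl1 : c.R ≤ max (max c.R C₂) S := (le_max_left _ _).trans (le_max_left _ _)
  exact h₃ hδ0 ((h.smooth.near_df1 hpq).mono hδ0 hl1) (nH3.mono hδ0 hl1) (nV.mono hδ0 hl1)
    (nB.mono hδ0 ((le_max_right _ _).trans (le_max_left _ _))) (nW.mono hδ0 (le_max_right _ _))

/-- The middle-level direction at `(x, y, z)`, with a perturbed inverse, is close to `∇_y f̄`. -/
theorem exists_norm_mlForm_sub_le (c : Constants) : ∃ C, ∀ {n m t : ℕ} {F1 F2 F3 : Pt n m t → ℝ}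
    (p q : Pt n m t) (V : Dual (Vec t) →L[ℝ] Vec t) (θ : ℝ), Problem c F1 F2 F3 → 0 ≤ θ →
    ‖V‖ ≤ c.R → ‖V - invZZ (fderiv ℝ (fderiv ℝ F3) p)‖ ≤ c.R * θ →
    ‖mlForm (fderiv ℝ F2 p) (fderiv ℝ (fderiv ℝ F3) p) V - exGrad F2 F3 q‖
      ≤ C * (‖p - q‖ + θ) := by
  apply Exists.intro
  intro n m t F1 F2 F3 p q V θ h hθ hV hV'
  set δ := ‖p - q‖ + θ with hδ
  have hR := c.one_le_R
  have hpq : ‖p - q‖ ≤ δ := by linarith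
  have hδ0 : 0 ≤ δ := (norm_nonneg _).trans hpq
  have nV : Near c.R δ V (invZZ (fderiv ℝ (fderiv ℝ F3) q)) :=
    (near_invZZ c h le_rfl).of_norm_sub_le hV hV' le_rfl
  have hY := Near.refl (R := 1) (δ := δ) (a := (inY : Vec m →L[ℝ] Pt n m t)) hδ0 norm_inY_le
  have hZ := Near.refl (R := 1) (δ := δ) (a := (inZ : Vec t →L[ℝ] Pt n m t)) hδ0 norm_inZ_le
  have n1 := ((h.smooth.near_ddf3 hpq).blk hY hZ).clm_apply
    (nV.clm_apply (h.smooth.near_dzf2 hpq))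
  have n2 : ‖fderiv ℝ F2 p ∘L (inY : Vec m →L[ℝ] Pt n m t) - fderiv ℝ F2 q ∘L inY‖
      ≤ c.R * δ := by
    rw [← ContinuousLinearMap.sub_comp]
    refine (ContinuousLinearMap.opNorm_comp_le _ _).trans ?_
    refine (mul_le_of_le_one_right (norm_nonneg _) norm_inY_le).trans ?_
    refine (h.smooth.lip_df2.norm_sub_le p q).trans ?_
    exact mul_le_mul (c.le_L.2.2.2.1.trans c.L_le_R) hpq (norm_nonneg _) (by linarith)
  have e := norm_sub_le_of_le n2 n1.2.2
  rw [← add_mul] at e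
  refine le_trans (le_of_eq ?_) e
  rw [exGrad, mlForm, mlForm]
  congr 1
  abel

/-- The derivative of the middle-level solution is bounded and Lipschitz continuous. -/
theorem exists_near_yJac (c : Constants) : ∃ C, ∀ {n m t : ℕ} {F1 F2 F3 : Pt n m t → ℝ}
    (x x' : Vec n), Problem c F1 F2 F3 →
    Near C ‖ulPt F2 F3 x - ulPt F2 F3 x'‖ (yJac F2 F3 (ulPt F2 F3 x))
      (yJac F2 F3 (ulPt F2 F3 x')) := by
  apply Exists.intro
  intro n m t F1 F2 F3 x x' h
  exact ((Near.inverse (h.isInvertible_y x _) (h.isInvertible_y x' _) (norm_nonneg _)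
      (h.norm_inverse_y_le x _) (h.norm_inverse_y_le x' _)
      (h.near_exHess le_rfl norm_inY_le)).clm_comp (h.near_exHess le_rfl norm_inX_le)).neg

/-- Bounds, Lipschitz estimates and Taylor estimates for the solution maps, the upper-level
objective and the perturbed directions, all with the same constant `M`. -/
structure Regular {n m t : ℕ} (c : Constants) (M : ℝ) (F1 F2 F3 : Pt n m t → ℝ) : Prop where
  one_le : 1 ≤ M
  zSol_lip : ∀ x x' y y', ‖zSol F3 x y - zSol F3 x' y'‖ ≤ M * (‖x - x'‖ + ‖y - y'‖)
  ySol_lip : ∀ x x', ‖ySol F2 F3 x - ySol F2 F3 x'‖ ≤ M * ‖x - x'‖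
  yJac_le : ∀ x, ‖yJac F2 F3 (ulPt F2 F3 x)‖ ≤ M
  ySol_taylor : ∀ x x', ‖ySol F2 F3 x' - ySol F2 F3 x - yJac F2 F3 (ulPt F2 F3 x) (x' - x)‖
    ≤ M * ‖x' - x‖ ^ 2
  upper_le : ∀ x, ‖exUpper F1 F2 F3 (ulPt F2 F3 x)‖ ≤ M
  upper_lip : ∀ x x', ‖exUpper F1 F2 F3 (ulPt F2 F3 x) - exUpper F1 F2 F3 (ulPt F2 F3 x')‖
    ≤ M * ‖x - x'‖
  upper_taylor : ∀ x x', ‖upper F1 F2 F3 x' - upper F1 F2 F3 x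
    - exUpper F1 F2 F3 (ulPt F2 F3 x) (x' - x)‖ ≤ M * ‖x' - x‖ ^ 2
  exGrad_lip : ∀ x y y', ‖exGrad F2 F3 (llPt F3 x y) - exGrad F2 F3 (llPt F3 x y')‖
    ≤ M * ‖y - y'‖
  mlForm_sub_le : ∀ (p q : Pt n m t) (V : Dual (Vec t) →L[ℝ] Vec t) (θ : ℝ), 0 ≤ θ →
    ‖V‖ ≤ c.R → ‖V - invZZ (fderiv ℝ (fderiv ℝ F3) p)‖ ≤ c.R * θ →
    ‖mlForm (fderiv ℝ F2 p) (fderiv ℝ (fderiv ℝ F3) p) V - exGrad F2 F3 q‖ ≤ M * (‖p - q‖ + θ)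
  ulMean_sub_le : ∀ (x : Vec n) (p : Pt n m t) (V : Dual (Vec t) →L[ℝ] Vec t)
    (W : Dual (Vec m) →L[ℝ] Vec m) (θ : ℝ), 0 ≤ θ → θ ≤ 1 →
    ‖V‖ ≤ c.R → ‖V - invZZ (fderiv ℝ (fderiv ℝ F3) p)‖ ≤ c.R * θ → ‖W‖ ≤ c.R →
    (exHess F2 F3 inY p).IsInvertible → ‖W - (exHess F2 F3 inY p).inverse‖ ≤ c.R * θ →
    ‖ulMean F1 F2 F3 p V W - exUpper F1 F2 F3 (ulPt F2 F3 x)‖ ≤ M * (‖p - ulPt F2 F3 x‖ + θ)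

/-- The constant `M` depends on the constants of the assumptions only. -/
theorem exists_regular (c : Constants) : ∃ M, ∀ {n m t : ℕ} {F1 F2 F3 : Pt n m t → ℝ},
    Problem c F1 F2 F3 → Regular c M F1 F2 F3 := by
  obtain ⟨C₁, h₁⟩ := exists_near_ulMean c
  obtain ⟨C₂, h₂⟩ := exists_norm_mlForm_sub_le c
  obtain ⟨C₃, h₃⟩ := exists_near_yJac c
  set q := (1 + c.R ^ 2) * (1 + c.Ch * c.R) with hq
  have hR := c.one_le_R
  have hCh : 1 ≤ c.Ch := hR.trans c.R_le_Ch
  have hR2 : 1 ≤ c.R ^ 2 := one_le_pow₀ hR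
  have hCR : 1 ≤ c.Ch * c.R := one_le_mul_of_one_le_of_one_le hCh hR
  have hq1 : 1 ≤ q := one_le_mul_of_one_le_of_one_le (by linarith) (by linarith)
  -- `c.Ch ≤ c.Ch * c.R ≤ q`, so that `q` absorbs the elementary constants
  have hq2 : c.R ^ 2 ≤ q := by
    have : 1 + c.R ^ 2 ≤ q := le_mul_of_one_le_right (by linarith) (by linarith)
    linarith
  have hq3 : c.Ch * c.R ≤ q := by
    have : 1 + c.Ch * c.R ≤ q := le_mul_of_one_le_left (by linarith) (by linarith)
    linarith
  have hq4 : c.Ch ≤ q := (le_mul_of_one_le_right (by linarith) hR).trans hq3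
  have hC : 0 ≤ |C₁| * q + |C₃| * q := by positivity
  refine ⟨q + |C₁| * q + |C₂| + |C₃| * q, ?_⟩
  intro n m t F1 F2 F3 h
  have hC₁ : |C₁| ≤ |C₁| * q := le_mul_of_one_le_right (abs_nonneg _) hq1
  have hC₃ : |C₃| ≤ |C₃| * q := le_mul_of_one_le_right (abs_nonneg _) hq1
  have a1 := abs_nonneg C₁
  have a2 := abs_nonneg C₂
  have a3 := abs_nonneg C₃
  have hup : ∀ x x' : Vec n, Near C₁ (q * ‖x - x'‖) (exUpper F1 F2 F3 (ulPt F2 F3 x))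
      (exUpper F1 F2 F3 (ulPt F2 F3 x')) := fun x x' => by
    have h4 := h₁ x' (ulPt F2 F3 x) (invZZ (fderiv ℝ (fderiv ℝ F3) (ulPt F2 F3 x)))
      (exHess F2 F3 inY (ulPt F2 F3 x)).inverse 0 h le_rfl zero_le_one
      ((h.norm_invZZ_le _).trans (c.le_L.2.2.2.2.2.2.2.2.2.2.2.2.1.trans c.L_le_R)) (by simp)
      ((h.norm_inverse_y_le x _).trans (c.le_L.2.2.2.2.2.2.2.2.2.2.2.2.2.1.trans c.L_le_R))
      (h.isInvertible_y x _) (by simp)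
    rw [add_zero] at h4
    exact h4.mono_right (h.norm_ulPt_sub_le x x')
  have hy : ∀ x x' : Vec n, Near C₃ (q * ‖x - x'‖) (yJac F2 F3 (ulPt F2 F3 x))
      (yJac F2 F3 (ulPt F2 F3 x')) := fun x x' =>
    (h₃ x x' h).mono_right (h.norm_ulPt_sub_le x x')
  have hupL : ∀ x x' : Vec n, ‖exUpper F1 F2 F3 (ulPt F2 F3 x)
      - exUpper F1 F2 F3 (ulPt F2 F3 x')‖ ≤ |C₁| * q * ‖x - x'‖ := fun x x' => by
    refine (hup x x').2.2.trans ?_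
    have hn : 0 ≤ q * ‖x - x'‖ := by positivity
    exact (mul_le_mul_of_nonneg_right (le_abs_self _) hn).trans_eq (mul_assoc _ _ _).symm
  have hyL : ∀ x x' : Vec n, ‖yJac F2 F3 (ulPt F2 F3 x)
      - yJac F2 F3 (ulPt F2 F3 x')‖ ≤ |C₃| * q * ‖x - x'‖ := fun x x' => by
    refine (hy x x').2.2.trans ?_
    have hn : 0 ≤ q * ‖x - x'‖ := by positivity
    exact (mul_le_mul_of_nonneg_right (le_abs_self _) hn).trans_eq (mul_assoc _ _ _).symm
  refine ⟨by linarith, fun x x' y y' => ?_, fun x x' => ?_, fun x => ?_, fun x x' => ?_,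
    fun x => ?_, fun x x' => ?_, fun x x' => ?_, fun x y y' => ?_, fun p p' V θ hθ hV hV' => ?_,
    fun x p V W θ hθ hθ1 hV hV' hW hi hW' => ?_⟩
  · refine (h.norm_zSol_sub_le x x' y y').trans ?_
    exact mul_le_mul_of_nonneg_right (by linarith) (by positivity)
  · refine (h.norm_ySol_sub_le x x').trans ?_
    exact mul_le_mul_of_nonneg_right (by linarith) (by positivity)
  · linarith [(hy x x).1, le_abs_self C₃]
  · refine (norm_taylor_le h.hasFDerivAt_ySol hyL x x').trans ?_
    exact mul_le_mul_of_nonneg_right (by linarith) (by positivity)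
  · linarith [(hup x x).1, le_abs_self C₁]
  · refine (hupL x x').trans ?_
    exact mul_le_mul_of_nonneg_right (by linarith) (by positivity)
  · refine (norm_taylor_le h.hasFDerivAt_upper hupL x x').trans ?_
    exact mul_le_mul_of_nonneg_right (by linarith) (by positivity)
  · refine (h.norm_exGrad_sub_le x y y').trans ?_
    exact mul_le_mul_of_nonneg_right (by linarith) (by positivity)
  · refine (h₂ p p' V θ h hθ hV hV').trans ?_
    exact mul_le_mul_of_nonneg_right (by linarith [le_abs_self C₂]) (by positivity)
  · refine (h₁ x p V W θ h hθ hθ1 hV hV' hW hi hW').2.2.trans ?_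
    exact mul_le_mul_of_nonneg_right (by linarith [le_abs_self C₁]) (by positivity)

end Stability

/-! ### Moments of products of independent estimators -/

section Estimators

variable {Ω S ι : Type*} [mS : MeasurableSpace S] {ξ : ι → Ω → S}

/-- The σ-algebra generated by the samples with labels in `T`. -/
@[reducible] def past (ξ : ι → Ω → S) (T : Set ι) : MeasurableSpace Ω :=
  ⨆ a ∈ T, MeasurableSpace.comap (ξ a) mS

theorem past_mono {T T' : Set ι} (h : T ⊆ T') : past ξ T ≤ past ξ T' :=
  iSup₂_le fun a ha => le_iSup₂_of_le a (h ha) le_rfl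

theorem measurable_past {T : Set ι} {a : ι} (ha : a ∈ T) : Measurable[past ξ T] (ξ a) :=
  measurable_iff_comap_le.2 (le_iSup₂_of_le a ha le_rfl)

theorem past_comp {κ : Type*} (e : κ → ι) (T : Set κ) :
    past (fun k => ξ (e k)) T = past ξ (e '' T) := by
  simp only [past, iSup_image]

variable [mΩ : MeasurableSpace Ω] {μ : Measure Ω}

theorem past_le (hξ : ∀ a, Measurable (ξ a)) (T : Set ι) : past ξ T ≤ mΩ :=
  iSup₂_le fun a _ => (hξ a).comap_le

theorem indep_past (hξ : ∀ a, Measurable (ξ a)) (hi : iIndepFun ξ μ) {T T' : Set ι}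
    (h : Disjoint T T') : Indep (past ξ T) (past ξ T') μ :=
  indep_iSup_of_disjoint (fun a => (hξ a).comap_le) ((iIndepFun_iff_iIndep _ _ μ).1 hi) h

theorem indepFun_of_past [IsProbabilityMeasure μ] (hξ : ∀ a, Measurable (ξ a)) (hi : iIndepFun ξ μ)
    {T T' : Set ι} (h : Disjoint T T') {E F : Type*} [MeasurableSpace E] [MeasurableSpace F]
    {X : Ω → E} {Y : Ω → F} (hX : Measurable[past ξ T] X) (hY : Measurable[past ξ T'] Y) :
    IndepFun X Y μ := by
  rw [IndepFun_iff_Indep]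
  exact indep_of_indep_of_le_left (indep_of_indep_of_le_right (indep_past hξ hi h)
    (measurable_iff_comap_le.1 hY)) (measurable_iff_comap_le.1 hX)

/-- `X` is a function of the samples with labels in `T`, with mean `x` and second moment at
most `M`. -/
structure Est (μ : Measure Ω) (ξ : ι → Ω → S) {E : Type*} [NormedAddCommGroup E] [NormedSpace ℝ E]
    (T : Set ι) (X : Ω → E) (x : E) (M : ℝ) : Prop where
  sm : StronglyMeasurable[past ξ T] X
  memLp : MemLp X 2 μ
  mean : ∫ ω, X ω ∂μ = x
  le : ∫ ω, ‖X ω‖ ^ 2 ∂μ ≤ M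

namespace Est

variable {E F G : Type*} [NormedAddCommGroup E] [NormedSpace ℝ E] [NormedAddCommGroup F]
  [NormedSpace ℝ F] [NormedAddCommGroup G] [NormedSpace ℝ G] {T T' : Set ι} {X : Ω → E}
  {Y : Ω → F} {x : E} {y : F} {M M' : ℝ}

theorem integrable [IsProbabilityMeasure μ] (h : Est μ ξ T X x M) : Integrable X μ :=
  h.memLp.integrable (by norm_num)

theorem integrable_sq (h : Est μ ξ T X x M) : Integrable (fun ω => ‖X ω‖ ^ 2) μ :=
  h.memLp.integrable_norm_pow (by norm_num)

theorem nonneg (h : Est μ ξ T X x M) : 0 ≤ M :=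
  (integral_nonneg fun _ => by positivity).trans h.le

theorem mono (h : Est μ ξ T X x M) (hM : M ≤ M') : Est μ ξ T X x M' :=
  ⟨h.sm, h.memLp, h.mean, h.le.trans hM⟩

theorem congr {X' : Ω → E} (h : Est μ ξ T X x M) (e : ∀ ω, X ω = X' ω) : Est μ ξ T X' x M := by
  rwa [← funext e]

theorem of_comp {κ : Type*} (e : κ → ι) {T : Set κ} (h : Est μ (fun k => ξ (e k)) T X x M) :
    Est μ ξ (e '' T) X x M :=
  ⟨by rw [← past_comp]; exact h.sm, h.memLp, h.mean, h.le⟩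

theorem norm_mean_le [IsProbabilityMeasure μ] (h : Est μ ξ T X x M) : ‖x‖ ≤ (M + 1) / 2 := by
  rw [← h.mean]
  refine (norm_integral_le_integral_norm _).trans ?_
  have h1 : ∫ ω, ‖X ω‖ ∂μ ≤ ∫ ω, (‖X ω‖ ^ 2 + 1) / 2 ∂μ := by
    refine integral_mono h.integrable.norm ((h.integrable_sq.add (integrable_const 1)).div_const 2)
      fun ω => ?_
    have := sq_nonneg (‖X ω‖ - 1)
    simp only
    nlinarith
  refine h1.trans ?_
  rw [integral_div, integral_add h.integrable_sq (integrable_const 1)]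
  have := h.le
  simp
  linarith

theorem neg (h : Est μ ξ T X x M) : Est μ ξ T (fun ω => -X ω) (-x) M :=
  ⟨h.sm.neg, h.memLp.neg, by rw [integral_neg, h.mean], by simpa using h.le⟩

theorem add [IsProbabilityMeasure μ] {Y : Ω → E} {y : E} (h : Est μ ξ T X x M)
    (h' : Est μ ξ T' Y y M') :
    Est μ ξ (T ∪ T') (fun ω => X ω + Y ω) (x + y) (2 * M + 2 * M') := by
  refine ⟨(h.sm.mono (past_mono Set.subset_union_left)).add
    (h'.sm.mono (past_mono Set.subset_union_right)), h.memLp.add h'.memLp, ?_, ?_⟩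
  · rw [integral_add h.integrable h'.integrable, h.mean, h'.mean]
  · have h1 : ∫ ω, ‖X ω + Y ω‖ ^ 2 ∂μ ≤ ∫ ω, (2 * ‖X ω‖ ^ 2 + 2 * ‖Y ω‖ ^ 2) ∂μ := by
      refine integral_mono ((h.memLp.add h'.memLp).integrable_norm_pow (by norm_num))
        ((h.integrable_sq.const_mul 2).add (h'.integrable_sq.const_mul 2)) fun ω => ?_
      have h2 := norm_add_le (X ω) (Y ω)
      have h3 := norm_nonneg (X ω + Y ω)
      have := sq_nonneg (‖X ω‖ - ‖Y ω‖)
      simp only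
      nlinarith
    refine h1.trans ?_
    rw [integral_add (h.integrable_sq.const_mul 2) (h'.integrable_sq.const_mul 2),
      integral_const_mul, integral_const_mul]
    linarith [h.le, h'.le]

theorem sub [IsProbabilityMeasure μ] {Y : Ω → E} {y : E} (h : Est μ ξ T X x M)
    (h' : Est μ ξ T' Y y M') :
    Est μ ξ (T ∪ T') (fun ω => X ω - Y ω) (x - y) (2 * M + 2 * M') := by
  simpa only [sub_eq_add_neg] using h.add h'.neg

theorem const [IsProbabilityMeasure μ] [CompleteSpace E] (e : E) {K : ℝ} (hK : ‖e‖ ≤ K) :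
    Est μ ξ ∅ (fun _ => e) e (K ^ 2) := by
  refine ⟨stronglyMeasurable_const, memLp_const e, ?_, ?_⟩
  · rw [integral_const, probReal_univ, one_smul]
  · rw [integral_const, probReal_univ, one_smul]
    exact pow_le_pow_left₀ (norm_nonneg e) hK 2

theorem map [IsProbabilityMeasure μ] [CompleteSpace E] [CompleteSpace F] (h : Est μ ξ T X x M)
    (Λ : E →L[ℝ] F) (hΛ : ∀ v, ‖Λ v‖ ≤ ‖v‖) : Est μ ξ T (fun ω => Λ (X ω)) (Λ x) M := by
  have hm : MemLp (fun ω => Λ (X ω)) 2 μ := Λ.comp_memLp' h.memLp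
  refine ⟨Λ.continuous.comp_stronglyMeasurable h.sm, hm, ?_, ?_⟩
  · rw [Λ.integral_comp_comm h.integrable, h.mean]
  · refine le_trans (integral_mono (hm.integrable_norm_pow (by norm_num)) h.integrable_sq
      fun ω => ?_) h.le
    exact pow_le_pow_left₀ (norm_nonneg _) (hΛ _) 2

/-- Means and second moments of products of independent estimators factor. -/
theorem bilin [IsProbabilityMeasure μ] [CompleteSpace E] [CompleteSpace F] [CompleteSpace G]
    (hξ : ∀ a, Measurable (ξ a)) (hi : iIndepFun ξ μ)
    (B : E →L[ℝ] F →L[ℝ] G) (hB : ∀ v w, ‖B v w‖ ≤ ‖v‖ * ‖w‖) (h : Est μ ξ T X x M)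
    (h' : Est μ ξ T' Y y M') (hT : Disjoint T T') :
    Est μ ξ (T ∪ T') (fun ω => B (X ω) (Y ω)) (B x y) (M * M') := by
  borelize E F
  have hind : IndepFun X Y μ := indepFun_of_past hξ hi hT h.sm.measurable h'.sm.measurable
  have hsm : StronglyMeasurable[past ξ (T ∪ T')] fun ω => B (X ω) (Y ω) := by
    have hc : Continuous fun q : E × F => B q.1 q.2 := by fun_prop
    exact hc.comp_stronglyMeasurable ((h.sm.mono (past_mono Set.subset_union_left)).prodMk
      (h'.sm.mono (past_mono Set.subset_union_right)))
  have hind2 : IndepFun (fun ω => ‖X ω‖ ^ 2) (fun ω => ‖Y ω‖ ^ 2) μ :=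
    hind.comp (φ := fun v => ‖v‖ ^ 2) (ψ := fun v => ‖v‖ ^ 2) (by fun_prop) (by fun_prop)
  have hint : Integrable (fun ω => ‖X ω‖ ^ 2 * ‖Y ω‖ ^ 2) μ :=
    hind2.integrable_mul h.integrable_sq h'.integrable_sq
  have hpt : ∀ ω, ‖B (X ω) (Y ω)‖ ^ 2 ≤ ‖X ω‖ ^ 2 * ‖Y ω‖ ^ 2 := fun ω => by
    rw [← mul_pow]
    exact pow_le_pow_left₀ (norm_nonneg _) (hB _ _) 2
  have hae : AEStronglyMeasurable (fun ω => B (X ω) (Y ω)) μ :=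
    (hsm.mono (past_le hξ _)).aestronglyMeasurable
  have hint2 : Integrable (fun ω => ‖B (X ω) (Y ω)‖ ^ 2) μ :=
    hint.mono' (hae.norm.pow 2) (Eventually.of_forall fun ω => by
      simpa using hpt ω)
  refine ⟨hsm, (memLp_two_iff_integrable_sq_norm hae).2 hint2, ?_, ?_⟩
  · rw [hind.integral_bilin h.integrable h'.integrable, h.mean, h'.mean]
  · refine (integral_mono hint2 hint hpt).trans ?_
    rw [hind2.integral_fun_mul_eq_mul_integral h.integrable_sq.aestronglyMeasurable
      h'.integrable_sq.aestronglyMeasurable]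
    exact mul_le_mul h.le h'.le (integral_nonneg fun _ => by positivity) h.nonneg

theorem clm_comp [IsProbabilityMeasure μ] [CompleteSpace F] [CompleteSpace G]
    (hξ : ∀ a, Measurable (ξ a)) (hi : iIndepFun ξ μ)
    {X : Ω → F →L[ℝ] G} {Y : Ω → E →L[ℝ] F} {x : F →L[ℝ] G} {y : E →L[ℝ] F}
    (h : Est μ ξ T X x M) (h' : Est μ ξ T' Y y M') (hT : Disjoint T T') :
    Est μ ξ (T ∪ T') (fun ω => X ω ∘L Y ω) (x ∘L y) (M * M') :=
  bilin hξ hi (ContinuousLinearMap.compL ℝ E F G) (fun v w => v.opNorm_comp_le w) h h' hT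

theorem clm_apply [IsProbabilityMeasure μ] [CompleteSpace E] [CompleteSpace F]
    (hξ : ∀ a, Measurable (ξ a)) (hi : iIndepFun ξ μ)
    {X : Ω → E →L[ℝ] F} {Y : Ω → E} {x : E →L[ℝ] F} {y : E}
    (h : Est μ ξ T X x M) (h' : Est μ ξ T' Y y M') (hT : Disjoint T T') :
    Est μ ξ (T ∪ T') (fun ω => X ω (Y ω)) (x y) (M * M') :=
  bilin hξ hi (ContinuousLinearMap.id ℝ (E →L[ℝ] F)) (fun v w => v.le_opNorm w) h h' hT

theorem clm_flip [IsProbabilityMeasure μ] [CompleteSpace G]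
    {X : Ω → E →L[ℝ] F →L[ℝ] G} {x : E →L[ℝ] F →L[ℝ] G} (h : Est μ ξ T X x M) :
    Est μ ξ T (fun ω => (X ω).flip) x.flip M :=
  map h (ContinuousLinearMap.flipₗᵢ ℝ E F G).toContinuousLinearEquiv.toContinuousLinearMap
    fun v => ((ContinuousLinearMap.flipₗᵢ ℝ E F G).norm_map v).le

end Est

end Estimators

/-! ### Moments of the stochastic directions -/

section Measurability

/-- Inversion of linear maps between finite-dimensional spaces is measurable: it is continuous on
the open set of invertible maps, and zero on the complement. -/
theorem stronglyMeasurable_inverse {E F : Type*} [NormedAddCommGroup E] [NormedSpace ℝ E]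
    [FiniteDimensional ℝ E] [NormedAddCommGroup F] [NormedSpace ℝ F] [FiniteDimensional ℝ F] :
    StronglyMeasurable (ContinuousLinearMap.inverse : (E →L[ℝ] F) → F →L[ℝ] E) := by
  classical
  have : CompleteSpace E := FiniteDimensional.complete ℝ E
  have : ProperSpace (F →L[ℝ] E) := FiniteDimensional.proper ℝ _
  have : SecondCountableTopology (F →L[ℝ] E) := secondCountable_of_proper
  have ho : IsOpen {f : E →L[ℝ] F | f.IsInvertible} := ContinuousLinearEquiv.isOpen
  have hc : ContinuousOn (ContinuousLinearMap.inverse : (E →L[ℝ] F) → F →L[ℝ] E)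
      {f : E →L[ℝ] F | f.IsInvertible} := fun f hf =>
    (hf.contDiffAt_map_inverse (n := 0)).continuousAt.continuousWithinAt
  have hm := hc.measurable_piecewise (g := fun _ => 0) continuousOn_const ho.measurableSet
  have e : (ContinuousLinearMap.inverse : (E →L[ℝ] F) → F →L[ℝ] E)
      = {f : E →L[ℝ] F | f.IsInvertible}.piecewise ContinuousLinearMap.inverse fun _ => 0 := by
    ext1 f
    by_cases hf : f ∈ {f : E →L[ℝ] F | f.IsInvertible}
    · rw [Set.piecewise_eq_of_mem _ _ _ hf]
    · rw [Set.piecewise_eq_of_notMem _ _ _ hf, ContinuousLinearMap.inverse_of_not_isInvertible hf]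
  rw [e]
  exact hm.stronglyMeasurable

variable {α : Type*} [MeasurableSpace α] {n m t : ℕ}

theorem _root_.MeasureTheory.StronglyMeasurable.clm_inverse {E F : Type*} [NormedAddCommGroup E]
    [NormedSpace ℝ E] [FiniteDimensional ℝ E] [NormedAddCommGroup F] [NormedSpace ℝ F]
    [FiniteDimensional ℝ F] {f : α → E →L[ℝ] F} (hf : StronglyMeasurable f) :
    StronglyMeasurable fun a => (f a).inverse := by
  exact stronglyMeasurable_inverse.comp_measurable hf.measurable

theorem _root_.MeasureTheory.StronglyMeasurable.clm_comp' {E F G : Type*} [NormedAddCommGroup E]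
    [NormedSpace ℝ E] [NormedAddCommGroup F] [NormedSpace ℝ F] [NormedAddCommGroup G]
    [NormedSpace ℝ G] {f : α → F →L[ℝ] G} {g : α → E →L[ℝ] F} (hf : StronglyMeasurable f)
    (hg : StronglyMeasurable g) : StronglyMeasurable fun a => f a ∘L g a := by
  have hc : Continuous fun q : (F →L[ℝ] G) × (E →L[ℝ] F) => q.1 ∘L q.2 := by fun_prop
  exact hc.comp_stronglyMeasurable (hf.prodMk hg)

theorem _root_.MeasureTheory.StronglyMeasurable.clm_apply' {E F : Type*} [NormedAddCommGroup E]
    [NormedSpace ℝ E] [NormedAddCommGroup F] [NormedSpace ℝ F]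
    {f : α → E →L[ℝ] F} {g : α → E} (hf : StronglyMeasurable f)
    (hg : StronglyMeasurable g) : StronglyMeasurable fun a => f a (g a) := by
  have hc : Continuous fun q : (E →L[ℝ] F) × E => q.1 q.2 := by fun_prop
  exact hc.comp_stronglyMeasurable (hf.prodMk hg)

theorem _root_.MeasureTheory.StronglyMeasurable.clm_flip' {E F G : Type*} [NormedAddCommGroup E]
    [NormedSpace ℝ E] [NormedAddCommGroup F] [NormedSpace ℝ F] [NormedAddCommGroup G]
    [NormedSpace ℝ G] {f : α → E →L[ℝ] F →L[ℝ] G} (hf : StronglyMeasurable f) :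
    StronglyMeasurable fun a => (f a).flip :=
  (ContinuousLinearMap.flipₗᵢ ℝ E F G).continuous.comp_stronglyMeasurable hf

variable {A B : Type} [NormedAddCommGroup A] [NormedSpace ℝ A] [NormedAddCommGroup B]
  [NormedSpace ℝ B]

theorem _root_.MeasureTheory.StronglyMeasurable.blk {H : α → D2 n m t} {a : A →L[ℝ] Pt n m t}
    {b : α → B →L[ℝ] Pt n m t} (hH : StronglyMeasurable H) (hb : StronglyMeasurable b) :
    StronglyMeasurable fun q => blk (H q) a (b q) :=
  stronglyMeasurable_const.clm_comp' (hH.clm_comp' hb)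

theorem _root_.MeasureTheory.StronglyMeasurable.invZZ {H : α → D2 n m t}
    (hH : StronglyMeasurable H) : StronglyMeasurable fun q => invZZ (H q) :=
  (hH.blk stronglyMeasurable_const).clm_inverse

theorem _root_.MeasureTheory.StronglyMeasurable.zJac {H : α → D2 n m t}
    {V : α → Dual (Vec t) →L[ℝ] Vec t} {a : A →L[ℝ] Pt n m t} (hV : StronglyMeasurable V)
    (hH : StronglyMeasurable H) : StronglyMeasurable fun q => zJac (V q) (H q) a :=
  (hV.clm_comp' (hH.blk stronglyMeasurable_const)).neg

theorem _root_.MeasureTheory.StronglyMeasurable.fbarHess {H K : α → D2 n m t} {T : α → D3 n m t}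
    {V₁ V₂ : α → Dual (Vec t) →L[ℝ] Vec t} {g : α → D1 n m t} {J : α → A →L[ℝ] Vec t}
    {a : A →L[ℝ] Pt n m t} (hH : StronglyMeasurable H) (hT : StronglyMeasurable T)
    (hK : StronglyMeasurable K) (hV₁ : StronglyMeasurable V₁) (hV₂ : StronglyMeasurable V₂)
    (hg : StronglyMeasurable g) (hJ : StronglyMeasurable J) :
    StronglyMeasurable fun q => fbarHess a (H q) (T q) (K q) (V₁ q) (V₂ q) (g q) (J q) := by
  have hτ : StronglyMeasurable fun q => a + inZ ∘L J q :=
    stronglyMeasurable_const.add (stronglyMeasurable_const.clm_comp' hJ)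
  have hw : StronglyMeasurable fun q => V₂ q (g q ∘L inZ) :=
    hV₂.clm_apply' (hg.clm_comp' stronglyMeasurable_const)
  have hTw : StronglyMeasurable fun q => (T q).flip (inZ (V₂ q (g q ∘L inZ))) :=
    hT.clm_flip'.clm_apply' ((inZ : Vec t →L[ℝ] Pt n m t).continuous.comp_stronglyMeasurable hw)
  exact (((hH.blk hτ).sub (hTw.blk hτ)).add
    ((hK.blk stronglyMeasurable_const).clm_comp' (hV₁.clm_comp' (hTw.blk hτ)))).sub
    ((hK.blk stronglyMeasurable_const).clm_comp' (hV₁.clm_comp' (hH.blk hτ)))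

end Measurability

section Sampling

variable {Ω S ι : Type*} [mS : MeasurableSpace S] {ξ : ι → Ω → S} [mΩ : MeasurableSpace Ω]
  {μ : Measure Ω}

/-- The samples `ξ a` are independent with law `P`. -/
structure Sampling (μ : Measure Ω) (P : Measure S) (ξ : ι → Ω → S) : Prop where
  measurable : ∀ a, Measurable (ξ a)
  indep : iIndepFun ξ μ
  law : ∀ a, μ.map (ξ a) = P

theorem Sampling.comp {P : Measure S} (h : Sampling μ P ξ) {κ : Type*} {e : κ → ι}
    (he : Function.Injective e) : Sampling μ P fun k => ξ (e k) :=
  ⟨fun k => h.measurable (e k), h.indep.precomp he, fun k => h.law (e k)⟩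

theorem Sampling.measurePreserving {P : Measure S} (h : Sampling μ P ξ) (a : ι) :
    MeasurePreserving (ξ a) μ P := ⟨h.measurable a, h.law a⟩

theorem Sampling.measurePreserving_pi [IsProbabilityMeasure μ] {P : Measure S} [Fintype ι]
    (h : Sampling μ P ξ) :
    MeasurePreserving (fun ω a => ξ a ω) μ (Measure.pi fun _ : ι => P) := by
  refine ⟨measurable_pi_lambda _ h.measurable, ?_⟩
  have h1 := (iIndepFun_iff_map_fun_eq_pi_map fun a => (h.measurable a).aemeasurable).1 h.indep
  simpa only [h.law] using h1

variable {E F : Type*} [NormedAddCommGroup E] [NormedSpace ℝ E] [NormedAddCommGroup F]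
  [NormedSpace ℝ F]

/-- Almost surely bounded functions of a group of samples. -/
theorem Est.of_bound [IsProbabilityMeasure μ] {S' : Type*} [MeasurableSpace S'] {P' : Measure S'}
    {T : Set ι} {B : Ω → S'} (hξ : ∀ a, Measurable (ξ a)) (hB : Measurable[past ξ T] B)
    (hP : MeasurePreserving B μ P') {X : S' → E} (hX : StronglyMeasurable X) {K : ℝ}
    (hK : ∀ᵐ s ∂P', ‖X s‖ ≤ K) :
    Est μ ξ T (fun ω => X (B ω)) (∫ s, X s ∂P') (K ^ 2) := by
  have hK' : ∀ᵐ ω ∂μ, ‖X (B ω)‖ ≤ K := hP.quasiMeasurePreserving.ae hK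
  have hsm : StronglyMeasurable[past ξ T] fun ω => X (B ω) := hX.comp_measurable hB
  have hae : AEStronglyMeasurable (fun ω => X (B ω)) μ :=
    (hsm.mono (past_le hξ T)).aestronglyMeasurable
  have hm : MemLp (fun ω => X (B ω)) 2 μ := MemLp.of_bound hae K hK'
  refine ⟨hsm, hm, ?_, ?_⟩
  · rw [← hP.map_eq, integral_map hP.measurable.aemeasurable]
    exact hX.aestronglyMeasurable
  · have h1 : ∫ ω, ‖X (B ω)‖ ^ 2 ∂μ ≤ ∫ _, K ^ 2 ∂μ := by
      refine integral_mono_ae (hm.integrable_norm_pow (by norm_num)) (integrable_const _) ?_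
      filter_upwards [hK'] with ω hω
      exact pow_le_pow_left₀ (norm_nonneg _) hω 2
    simpa using h1

variable {n m t : ℕ} {E F : Type} [NormedAddCommGroup E] [NormedSpace ℝ E] [NormedAddCommGroup F]
  [NormedSpace ℝ F]

theorem IsUnbiasedEstimator.slice {P : Measure S} {G : Pt n m t → S → E} {g : Pt n m t → E} {σ : ℝ}
    (hG : IsUnbiasedEstimator P G g σ) (p : Pt n m t) : StronglyMeasurable (G p) := by
  obtain ⟨x, y, z, rfl⟩ := exists_eq_pt p
  exact hG.stronglyMeasurable.comp_measurable
    (measurable_prodMk_left (x := ((x, y, z) : Vec n × Vec m × Vec t)))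

variable [CompleteSpace E] [CompleteSpace F]

theorem Est.of_unbiased_centered [IsProbabilityMeasure μ] {P : Measure S} (h : Sampling μ P ξ)
    {G : Pt n m t → S → E} {g : Pt n m t → E} {σ : ℝ} (hG : IsUnbiasedEstimator P G g σ)
    (p : Pt n m t) (a : ι) (Λ : E →L[ℝ] F) (hΛ : ∀ v, ‖Λ v‖ ≤ ‖v‖) :
    Est μ ξ {a} (fun ω => Λ (G p (ξ a ω)) - Λ (g p)) 0 (σ ^ 2) := by
  have hP := h.measurePreserving a
  have h0 : MemLp (fun ω => G p (ξ a ω)) 2 μ := (hG.memLp p).comp_measurePreserving hP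
  have h1 : Est μ ξ {a} (fun ω => G p (ξ a ω) - g p) 0 (σ ^ 2) := by
    have hsm : StronglyMeasurable[past ξ {a}] fun ω => G p (ξ a ω) :=
      (hG.slice p).comp_measurable (measurable_past (Set.mem_singleton a))
    refine ⟨hsm.sub stronglyMeasurable_const, h0.sub (memLp_const _), ?_, ?_⟩
    · rw [integral_sub (h0.integrable (by norm_num)) (integrable_const _)]
      have e : ∫ ω, G p (ξ a ω) ∂μ = g p := by
        rw [← hG.unbiased p, ← hP.map_eq, integral_map hP.measurable.aemeasurable]
        exact (hG.slice p).aestronglyMeasurable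
      simp [e]
    · refine le_trans (le_of_eq ?_) (hG.variance_le p)
      rw [← hP.map_eq, integral_map hP.measurable.aemeasurable]
      exact (((hG.slice p).sub stronglyMeasurable_const).norm.pow 2).aestronglyMeasurable
  simpa only [map_sub, map_zero] using h1.map Λ hΛ

theorem Est.of_unbiased [IsProbabilityMeasure μ] {P : Measure S} (h : Sampling μ P ξ)
    {G : Pt n m t → S → E} {g : Pt n m t → E} {σ : ℝ} (hG : IsUnbiasedEstimator P G g σ)
    (p : Pt n m t) (a : ι) (Λ : E →L[ℝ] F) (hΛ : ∀ v, ‖Λ v‖ ≤ ‖v‖) {K : ℝ} (hK : ‖Λ (g p)‖ ≤ K) :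
    Est μ ξ {a} (fun ω => Λ (G p (ξ a ω))) (Λ (g p)) (2 * σ ^ 2 + 2 * K ^ 2) := by
  simpa using (Est.of_unbiased_centered h hG p a Λ hΛ).add (Est.const (ξ := ξ) (Λ (g p)) hK)

theorem Est.of_unbiased_id [IsProbabilityMeasure μ] {P : Measure S} (h : Sampling μ P ξ)
    {G : Pt n m t → S → E} {g : Pt n m t → E} {σ : ℝ} (hG : IsUnbiasedEstimator P G g σ)
    (p : Pt n m t) (a : ι) {K : ℝ} (hK : ‖g p‖ ≤ K) :
    Est μ ξ {a} (fun ω => G p (ξ a ω)) (g p) (2 * σ ^ 2 + 2 * K ^ 2) :=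
  Est.of_unbiased h hG p a (ContinuousLinearMap.id ℝ E) (fun _ => le_rfl) hK

/-- Restriction of a gradient along an inclusion of norm at most one. -/
theorem norm_restrict_le {A : Type} [NormedAddCommGroup A] [NormedSpace ℝ A]
    {a : A →L[ℝ] Pt n m t} (ha : ‖a‖ ≤ 1) (g : D1 n m t) :
    ‖(ContinuousLinearMap.compL ℝ A (Pt n m t) ℝ).flip a g‖ ≤ ‖g‖ :=
  (g.opNorm_comp_le a).trans (mul_le_of_le_one_right (norm_nonneg _) ha)

theorem Est.restrict [IsProbabilityMeasure μ] {A : Type} [NormedAddCommGroup A] [NormedSpace ℝ A]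
    {P : Measure S} (h : Sampling μ P ξ)
    {G : Pt n m t → S → D1 n m t} {g : Pt n m t → D1 n m t} {σ : ℝ}
    (hG : IsUnbiasedEstimator P G g σ) (p : Pt n m t) (i : ι) {a : A →L[ℝ] Pt n m t}
    (ha : ‖a‖ ≤ 1) {K : ℝ} (hK : ‖g p ∘L a‖ ≤ K) :
    Est μ ξ {i} (fun ω => G p (ξ i ω) ∘L a) (g p ∘L a) (2 * σ ^ 2 + 2 * K ^ 2) :=
  Est.of_unbiased h hG p i ((ContinuousLinearMap.compL ℝ A (Pt n m t) ℝ).flip a)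
    (norm_restrict_le ha) hK

theorem Est.blk [IsProbabilityMeasure μ] {A B : Type} [NormedAddCommGroup A] [NormedSpace ℝ A]
    [NormedAddCommGroup B] [NormedSpace ℝ B] (hξ : ∀ a, Measurable (ξ a)) (hi : iIndepFun ξ μ)
    {T T' : Set ι} {H : Ω → D2 n m t} {H' : D2 n m t} {b : Ω → B →L[ℝ] Pt n m t}
    {b' : B →L[ℝ] Pt n m t} {M M' : ℝ} {a : A →L[ℝ] Pt n m t} (ha : ‖a‖ ≤ 1)
    (hH : Est μ ξ T H H' M) (hb : Est μ ξ T' b b' M') (hT : Disjoint T T') :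
    Est μ ξ (T ∪ T') (fun ω => TSG.blk (H ω) a (b ω)) (TSG.blk H' a b') (M * M') :=
  (hH.clm_comp hξ hi hb hT).map (ContinuousLinearMap.compL ℝ B (D1 n m t) (Dual A)
      ((ContinuousLinearMap.compL ℝ A (Pt n m t) ℝ).flip a)) fun v => by
    refine ContinuousLinearMap.opNorm_le_bound _ (norm_nonneg _) fun w => ?_
    exact (norm_restrict_le ha (v w)).trans (v.le_opNorm w)

theorem Est.blk_const [IsProbabilityMeasure μ] {A B : Type} [NormedAddCommGroup A]
    [NormedSpace ℝ A] [NormedAddCommGroup B] [NormedSpace ℝ B] (hξ : ∀ a, Measurable (ξ a))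
    (hi : iIndepFun ξ μ)
    {T : Set ι} {H : Ω → D2 n m t} {H' : D2 n m t} {b : B →L[ℝ] Pt n m t}
    {M : ℝ} {a : A →L[ℝ] Pt n m t} (ha : ‖a‖ ≤ 1) (hb : ‖b‖ ≤ 1)
    (hH : Est μ ξ T H H' M) :
    Est μ ξ T (fun ω => TSG.blk (H ω) a b) (TSG.blk H' a b) M := by
  simpa using hH.blk hξ hi ha (Est.const (ξ := ξ) b hb) (Set.disjoint_empty _)

end Sampling

section Directions

universe u v

/-- The assumptions on the oracle. -/
structure GoodOracle {n m t : ℕ} {S : Type*} [MeasurableSpace S] (c : Constants) (P : Measure S)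
    (F1 F2 F3 : Pt n m t → ℝ) (O : Oracle n m t S) (θ : ℝ) : Prop where
  est : StochasticEstimates c P F1 F2 F3 O
  bound : InverseBound c P O
  bias : InverseBias c P F2 F3 O θ

/-- The mean of the inverted stochastic `∇²_{zz} f₃`. -/
def meanInvZZ {n m t : ℕ} {S : Type*} [MeasurableSpace S] (P : Measure S) (O : Oracle n m t S)
    (p : Pt n m t) : Dual (Vec t) →L[ℝ] Vec t := ∫ s, invZZ (O.H3 p s) ∂P

/-- The mean of the inverted stochastic `∇²_{yy} f̄`. -/
def meanInvYY {n m t : ℕ} {S : Type*} [MeasurableSpace S] (P : Measure S) (O : Oracle n m t S)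
    (p : Pt n m t) : Dual (Vec m) →L[ℝ] Vec m :=
  ∫ s, (O.fbarHess inY p s).inverse ∂(Measure.pi fun _ : Fin 8 => P)

namespace GoodOracle

variable {Ω S ι : Type*} [mS : MeasurableSpace S] {ξ : ι → Ω → S} [mΩ : MeasurableSpace Ω]
  {μ : Measure Ω} [IsProbabilityMeasure μ] {P : Measure S} {n m t : ℕ} {c : Constants}
  {F1 F2 F3 : Pt n m t → ℝ} {O : Oracle n m t S} {θ : ℝ}

theorem est_invZZ (hO : GoodOracle c P F1 F2 F3 O θ) (h : Sampling μ P ξ) (p : Pt n m t) (a : ι) :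
    Est μ ξ {a} (fun ω => invZZ (O.H3 p (ξ a ω))) (meanInvZZ P O p) (c.bzz ^ 2) :=
  Est.of_bound h.measurable (measurable_past (Set.mem_singleton a)) (h.measurePreserving a)
    (hO.est.ddf3.slice p).invZZ ((hO.bound.zz p).mono fun _ h => h.2)

theorem stronglyMeasurable_fbarHess (hO : GoodOracle c P F1 F2 F3 O θ) {A : Type}
    [NormedAddCommGroup A] [NormedSpace ℝ A] (a : A →L[ℝ] Pt n m t) (p : Pt n m t) :
    StronglyMeasurable (O.fbarHess a p) := by
  have hH3 : ∀ r : Fin 8, StronglyMeasurable fun s : Fin 8 → S => O.H3 p (s r) := fun r =>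
    (hO.est.ddf3.slice p).comp_measurable (measurable_pi_apply r)
  have hH2 : StronglyMeasurable fun s : Fin 8 → S => O.H2 p (s 0) :=
    (hO.est.ddf2.slice p).comp_measurable (measurable_pi_apply _)
  have hT3 : StronglyMeasurable fun s : Fin 8 → S => O.T3 p (s 1) :=
    (hO.est.dddf3.slice p).comp_measurable (measurable_pi_apply _)
  have hG2 : StronglyMeasurable fun s : Fin 8 → S => O.G2 p (s 5) :=
    (hO.est.df2.slice p).comp_measurable (measurable_pi_apply _)
  exact hH2.fbarHess hT3 (hH3 2) (hH3 3).invZZ (hH3 4).invZZ hG2 ((hH3 6).invZZ.zJac (hH3 7))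

theorem est_invYY {κ : Type*} {ξ : κ → Ω → S} (hO : GoodOracle c P F1 F2 F3 O θ)
    (h : Sampling μ P ξ) {e : Fin 8 → κ}
    (he : Function.Injective e) (p : Pt n m t) :
    Est μ ξ (e '' Set.univ) (fun ω => (O.fbarHess inY p fun r => ξ (e r) ω).inverse)
      (meanInvYY P O p) (c.byy ^ 2) := by
  refine Est.of_comp e ?_
  have h' := h.comp he
  refine Est.of_bound (B := fun ω r => ξ (e r) ω)
    (X := fun s => (O.fbarHess inY p s).inverse) h'.measurable ?_ h'.measurePreserving_pi
    (hO.stronglyMeasurable_fbarHess inY p).clm_inverse ((hO.bound.yy p).mono fun _ h => h.2)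
  refine @measurable_pi_lambda _ _ _ (past _ _) _ _ fun r => ?_
  exact measurable_past (ξ := fun k => ξ (e k)) (Set.mem_univ r)

end GoodOracle

/-- The stochastic `∇²_{ya} f̄` has the mean given by the means of its factors, and a bounded second
moment. -/
theorem exists_est_fbarHess (c : Constants) : ∃ M, ∀ {n m t : ℕ} {F1 F2 F3 : Pt n m t → ℝ}
    {S : Type u} [MeasurableSpace S] {P : Measure S} {O : Oracle n m t S} {θ : ℝ}
    {Ω : Type v} [MeasurableSpace Ω] {μ : Measure Ω} [IsProbabilityMeasure μ] {ξ : Fin 8 → Ω → S}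
    {A : Type} [NormedAddCommGroup A] [NormedSpace ℝ A] {a : A →L[ℝ] Pt n m t} (p : Pt n m t),
    Smooth c F1 F2 F3 → GoodOracle c P F1 F2 F3 O θ → Sampling μ P ξ → ‖a‖ ≤ 1 →
    Est μ ξ Set.univ (fun ω => O.fbarHess a p fun r => ξ r ω)
      (fbarHess a (fderiv ℝ (fderiv ℝ F2) p) (fderiv ℝ (fderiv ℝ (fderiv ℝ F3)) p)
        (fderiv ℝ (fderiv ℝ F3) p) (meanInvZZ P O p) (meanInvZZ P O p) (fderiv ℝ F2 p)
        (zJac (meanInvZZ P O p) (fderiv ℝ (fderiv ℝ F3) p) a)) M := by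
  apply Exists.intro
  intro n m t F1 F2 F3 S _ P O θ Ω _ μ _ ξ A _ _ a p hs hO h ha
  have hm := h.measurable
  have hi := h.indep
  have eH2 := Est.of_unbiased_id h hO.est.ddf2 p 0 (hs.norm_ddf2_le p)
  have eT3 := Est.of_unbiased_id h hO.est.dddf3 p 1 (hs.norm_dddf3_le p)
  have eH3 := Est.of_unbiased_id h hO.est.ddf3 p 2 (hs.norm_ddf3_le p)
  have eV1 := hO.est_invZZ h p 3
  have eV2 := hO.est_invZZ h p 4
  have eg2 := Est.restrict h hO.est.df2 p 5 norm_inZ_le (hs.norm_dzf2_le p)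
  have eV3 := hO.est_invZZ h p 6
  have eH3' := Est.of_unbiased_id h hO.est.ddf3 p 7 (hs.norm_ddf3_le p)
  have eJ := (eV3.clm_comp hm hi (eH3'.blk_const hm hi norm_inZ_le ha) (by simp)).neg
  have eτ := (Est.const (ξ := ξ) (μ := μ) a ha).add
    (eJ.map (ContinuousLinearMap.compL ℝ A (Vec t) (Pt n m t) inZ) fun v => by
      exact (ContinuousLinearMap.opNorm_comp_le _ _).trans
        (mul_le_of_le_one_left (norm_nonneg _) norm_inZ_le))
  have ew := (eV2.clm_apply hm hi eg2 (by simp)).map (inZ : Vec t →L[ℝ] Pt n m t)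
    fun v => (norm_inZ_apply v).le
  have eTw := eT3.clm_flip.clm_apply hm hi ew (by simp)
  have e1 := eH2.blk hm hi (a := (inY : Vec m →L[ℝ] Pt n m t)) norm_inY_le eτ (by simp)
  have e2 := eTw.blk hm hi (a := (inY : Vec m →L[ℝ] Pt n m t)) norm_inY_le eτ (by simp)
  have e3 := eTw.blk hm hi (a := (inZ : Vec t →L[ℝ] Pt n m t)) norm_inZ_le eτ (by simp)
  have e4 := eH2.blk hm hi (a := (inZ : Vec t →L[ℝ] Pt n m t)) norm_inZ_le eτ (by simp)
  have eHyz := eH3.blk_const hm hi (a := (inY : Vec m →L[ℝ] Pt n m t))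
    (b := (inZ : Vec t →L[ℝ] Pt n m t)) norm_inY_le norm_inZ_le
  have e5 := eHyz.clm_comp hm hi (eV1.clm_comp hm hi e3 (by simp)) (by simp)
  have e6 := eHyz.clm_comp hm hi (eV1.clm_comp hm hi e4 (by simp)) (by simp)
  have e7 := ((e1.sub e2).add e5).sub e6
  exact ⟨e7.sm.mono (past_mono (Set.subset_univ _)), e7.memLp, e7.mean, e7.le⟩

end Directions

section Moments

universe u v

/-- The deviation of the middle-level direction from its mean has a second moment that is bounded
independently of the point. The mean itself need not be bounded, as `∇_y f₂` need not be, so that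
only the centered direction is an `Est`. -/
theorem exists_est_mlDir (c : Constants) : ∃ M, ∀ {n m t : ℕ} {F1 F2 F3 : Pt n m t → ℝ}
    {S : Type u} [MeasurableSpace S] {P : Measure S} {O : Oracle n m t S} {θ : ℝ}
    {Ω : Type v} [MeasurableSpace Ω] {μ : Measure Ω} [IsProbabilityMeasure μ] {ξ : Fin 3 → Ω → S}
    (p : Pt n m t), Smooth c F1 F2 F3 → GoodOracle c P F1 F2 F3 O θ → Sampling μ P ξ →
    ∃ T, Est μ ξ T (fun ω => O.mlDir p (fun r => ξ r ω)
      - mlForm (fderiv ℝ F2 p) (fderiv ℝ (fderiv ℝ F3) p) (meanInvZZ P O p)) 0 M := by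
  apply Exists.intro
  intro n m t F1 F2 F3 S _ P O θ Ω _ μ _ ξ p hs hO h
  apply Exists.intro
  have hm := h.measurable
  have hi := h.indep
  have eH := Est.of_unbiased_id h hO.est.ddf3 p 1 (hs.norm_ddf3_le p)
  have eV := hO.est_invZZ h p 2
  have eg := Est.restrict h hO.est.df2 p 0 norm_inZ_le (hs.norm_dzf2_le p)
  have eHyz := eH.blk_const hm hi (a := (inY : Vec m →L[ℝ] Pt n m t))
    (b := (inZ : Vec t →L[ℝ] Pt n m t)) norm_inY_le norm_inZ_le
  have eY := eHyz.clm_apply hm hi (eV.clm_apply hm hi eg (by simp)) (by simp)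
  have eYc := eY.sub (Est.const (ξ := ξ) _ eY.norm_mean_le)
  rw [sub_self] at eYc
  have egc := Est.of_unbiased_centered h hO.est.df2 p 0
    ((ContinuousLinearMap.compL ℝ (Vec m) (Pt n m t) ℝ).flip inY) (norm_restrict_le norm_inY_le)
  have ed := egc.sub eYc
  rw [sub_self] at ed
  exact ed.congr fun ω => sub_sub_sub_comm _ _ _ _

/-- The upper-level direction has the mean obtained by taking the mean of every factor, and a
bounded second moment. -/
theorem exists_est_ulDir (c : Constants) : ∃ M, ∀ {n m t : ℕ} {F1 F2 F3 : Pt n m t → ℝ}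
    {S : Type u} [MeasurableSpace S] {P : Measure S} {O : Oracle n m t S} {θ : ℝ}
    {Ω : Type v} [MeasurableSpace Ω] {μ : Measure Ω} [IsProbabilityMeasure μ]
    {ξ : SampleIdx → Ω → S} (p : Pt n m t) (i : ℕ),
    Smooth c F1 F2 F3 → GoodOracle c P F1 F2 F3 O θ → Sampling μ P ξ →
    ∃ T, Est μ ξ T (fun ω => O.ulDir p (fun r => ξ (.ulGrad i r) ω) (fun r => ξ (.ulXY i r) ω)
      (fun r => ξ (.ulYY i r) ω))
      (ulMean F1 F2 F3 p (meanInvZZ P O p) (meanInvYY P O p)) M := by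
  obtain ⟨M₁, h₁⟩ := exists_est_fbarHess.{u, v} c
  apply Exists.intro
  intro n m t F1 F2 F3 S _ P O θ Ω _ μ _ ξ p i hs hO h
  apply Exists.intro
  have hm := h.measurable
  have hi := h.indep
  have hn : ∀ {A : Type} [NormedAddCommGroup A] [NormedSpace ℝ A] {a : A →L[ℝ] Pt n m t},
      ‖a‖ ≤ 1 → ‖fderiv ℝ F1 p ∘L a‖ ≤ c.Lf1 := fun {A _ _ a} ha =>
    (ContinuousLinearMap.opNorm_comp_le _ _).trans
      ((mul_le_of_le_one_right (norm_nonneg _) ha).trans (hs.norm_df1_le p))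
  have eH := Est.of_unbiased_id h hO.est.ddf3 p (.ulGrad i 1) (hs.norm_ddf3_le p)
  have eV := hO.est_invZZ h p (.ulGrad i 2)
  have egX := Est.restrict h hO.est.df1 p (.ulGrad i 0) norm_inX_le (hn norm_inX_le)
  have egY := Est.restrict h hO.est.df1 p (.ulGrad i 0) norm_inY_le (hn norm_inY_le)
  have egZ := Est.restrict h hO.est.df1 p (.ulGrad i 0) norm_inZ_le (hn norm_inZ_le)
  have el := eV.clm_apply hm hi egZ (by simp)
  have eX := egX.sub ((eH.blk_const hm hi (a := (inX : Vec n →L[ℝ] Pt n m t))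
    (b := (inZ : Vec t →L[ℝ] Pt n m t)) norm_inX_le norm_inZ_le).clm_apply hm hi el (by simp))
  have eY := egY.sub ((eH.blk_const hm hi (a := (inY : Vec m →L[ℝ] Pt n m t))
    (b := (inZ : Vec t →L[ℝ] Pt n m t)) norm_inY_le norm_inZ_le).clm_apply hm hi el (by simp))
  have hXY : Function.Injective fun r : Fin 8 => SampleIdx.ulXY i r := fun r r' hr => by
    simpa using hr
  have hYY : Function.Injective fun r : Fin 8 => SampleIdx.ulYY i r := fun r r' hr => by
    simpa using hr
  have eB := (Est.of_comp (fun r : Fin 8 => SampleIdx.ulXY i r)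
    (h₁ p hs hO (h.comp hXY) (norm_inX_le (n := n) (m := m) (t := t)))).clm_flip
  have eW := hO.est_invYY h hYY p
  have e2 := eB.clm_apply hm hi (eW.clm_apply hm hi eY (by simp)) (by
    rw [Set.disjoint_left]
    rintro _ ⟨r, -, rfl⟩
    simp)
  exact eX.sub e2

theorem norm_riesz {d : ℕ} (g : Dual (Vec d)) : ‖riesz g‖ = ‖g‖ :=
  (InnerProductSpace.toDual ℝ (Vec d)).symm.norm_map g

theorem riesz_sub {d : ℕ} (g g' : Dual (Vec d)) : riesz (g - g') = riesz g - riesz g' :=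
  map_sub (InnerProductSpace.toDual ℝ (Vec d)).symm g g'

theorem inner_riesz {d : ℕ} (g : Dual (Vec d)) (v : Vec d) : inner ℝ (riesz g) v = g v := by
  rw [riesz, InnerProductSpace.toDual_symm_apply]

/-- A square integrable random vector with given mean and a bound on its variance. -/
structure HasMean {Ω : Type*} [MeasurableSpace Ω] {d : ℕ} (μ : Measure Ω) (X : Ω → Vec d)
    (x : Vec d) (s : ℝ) : Prop where
  memLp : MemLp X 2 μ
  mean : ∫ ω, X ω ∂μ = x
  var_le : ∫ ω, ‖X ω - x‖ ^ 2 ∂μ ≤ s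

theorem Est.riesz {Ω S ι : Type*} [MeasurableSpace Ω] [MeasurableSpace S] {μ : Measure Ω}
    [IsProbabilityMeasure μ] {ξ : ι → Ω → S} {T : Set ι} {d : ℕ} {X : Ω → Dual (Vec d)}
    {x : Dual (Vec d)} {M : ℝ} (h : Est μ ξ T X x M) :
    Est μ ξ T (fun ω => TSG.riesz (X ω)) (TSG.riesz x) M :=
  h.map (InnerProductSpace.toDual ℝ (Vec d)).symm.toContinuousLinearEquiv.toContinuousLinearMap
    fun v => (norm_riesz v).le

theorem Est.hasMean {Ω S ι : Type*} [MeasurableSpace Ω] [MeasurableSpace S] {μ : Measure Ω}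
    [IsProbabilityMeasure μ] {ξ : ι → Ω → S} {T : Set ι} {d : ℕ} {X : Ω → Dual (Vec d)}
    {x : Dual (Vec d)} {M : ℝ} (h : Est μ ξ T (fun ω => X ω - x) 0 M) :
    HasMean μ (fun ω => TSG.riesz (X ω)) (TSG.riesz x) M := by
  have h' := h.riesz
  simp only [riesz_sub] at h'
  have hm : MemLp (fun ω => TSG.riesz (X ω)) 2 μ := by
    have e : (fun ω => TSG.riesz (X ω))
        = (fun ω => TSG.riesz (X ω) - TSG.riesz x) + fun _ => TSG.riesz x := by
      ext1 ω; simp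
    rw [e]
    exact h'.memLp.add (memLp_const (TSG.riesz x))
  refine ⟨hm, ?_, h'.le⟩
  have h1 := h'.mean
  rw [integral_sub (hm.integrable (by norm_num)) (integrable_const _), integral_const,
    probReal_univ, one_smul, sub_eq_iff_eq_add] at h1
  rw [h1]
  simp [TSG.riesz]

theorem Regular.mono {n m t : ℕ} {F1 F2 F3 : Pt n m t → ℝ} {c : Constants} {M M' : ℝ}
    (h : Regular c M F1 F2 F3) (hM : M ≤ M') : Regular c M' F1 F2 F3 where
  one_le := h.one_le.trans hM
  zSol_lip x x' y y' := (h.zSol_lip x x' y y').trans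
    (mul_le_mul_of_nonneg_right hM (by positivity))
  ySol_lip x x' := (h.ySol_lip x x').trans (mul_le_mul_of_nonneg_right hM (by positivity))
  yJac_le x := (h.yJac_le x).trans hM
  ySol_taylor x x' := (h.ySol_taylor x x').trans (mul_le_mul_of_nonneg_right hM (by positivity))
  upper_le x := (h.upper_le x).trans hM
  upper_lip x x' := (h.upper_lip x x').trans (mul_le_mul_of_nonneg_right hM (by positivity))
  upper_taylor x x' := (h.upper_taylor x x').trans (mul_le_mul_of_nonneg_right hM (by positivity))
  exGrad_lip x y y' := (h.exGrad_lip x y y').trans (mul_le_mul_of_nonneg_right hM (by positivity))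
  mlForm_sub_le p q V θ h1 h2 h3 := (h.mlForm_sub_le p q V θ h1 h2 h3).trans
    (mul_le_mul_of_nonneg_right hM (by positivity))
  ulMean_sub_le x p V W θ h1 h2 h3 h4 h5 h6 h7 := (h.ulMean_sub_le x p V W θ h1 h2 h3 h4 h5 h6
    h7).trans (mul_le_mul_of_nonneg_right hM (by positivity))

/-- The moments of the directions at fixed points: variances are bounded by `M`, and the biases by
`M` times the distances to the lower-level and middle-level solutions plus `θ`. -/
structure Directions {n m t : ℕ} {Ω S : Type*} [MeasurableSpace Ω] [MeasurableSpace S]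
    (c : Constants) (M θ : ℝ) (F1 F2 F3 : Pt n m t → ℝ) (O : Oracle n m t S) (μ : Measure Ω)
    (ξ : SampleIdx → Ω → S) : Prop where
  regular : Regular c M F1 F2 F3
  ll : ∀ (p : Pt n m t) i j k, HasMean μ (fun ω => riesz (O.llDir p (ξ (.ll i j k) ω)))
    (riesz (fderiv ℝ F3 p ∘L inZ)) M
  ml : ∀ x y z i j, ∃ d, HasMean μ (fun ω => riesz (O.mlDir (pt x y z) fun r => ξ (.ml i j r) ω))
    d M ∧ ‖d - riesz (exGrad F2 F3 (llPt F3 x y))‖ ≤ M * (‖z - zSol F3 x y‖ + θ)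
  ul : ∀ x y z i, ∃ d, MemLp (fun ω => riesz (O.ulDir (pt x y z) (fun r => ξ (.ulGrad i r) ω)
      (fun r => ξ (.ulXY i r) ω) (fun r => ξ (.ulYY i r) ω))) 2 μ ∧
    ∫ ω, riesz (O.ulDir (pt x y z) (fun r => ξ (.ulGrad i r) ω)
      (fun r => ξ (.ulXY i r) ω) (fun r => ξ (.ulYY i r) ω)) ∂μ = d ∧
    ∫ ω, ‖riesz (O.ulDir (pt x y z) (fun r => ξ (.ulGrad i r) ω)
      (fun r => ξ (.ulXY i r) ω) (fun r => ξ (.ulYY i r) ω))‖ ^ 2 ∂μ ≤ M ∧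
    ‖d - riesz (exUpper F1 F2 F3 (ulPt F2 F3 x))‖
      ≤ M * (‖y - ySol F2 F3 x‖ + ‖z - zSol F3 x y‖ + θ)

/-- The constant `M` depends on the constants of the assumptions only. -/
theorem exists_directions (c : Constants) : ∃ M, 1 ≤ M ∧ ∀ {n m t : ℕ} {F1 F2 F3 : Pt n m t → ℝ}
    {S : Type u} [MeasurableSpace S] {P : Measure S} [IsProbabilityMeasure P] {O : Oracle n m t S}
    {θ : ℝ} {Ω : Type v} [MeasurableSpace Ω] {μ : Measure Ω} [IsProbabilityMeasure μ]
    {ξ : SampleIdx → Ω → S},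
    Problem c F1 F2 F3 → 0 ≤ θ → θ ≤ 1 → GoodOracle c P F1 F2 F3 O θ → Sampling μ P ξ →
    Directions c M θ F1 F2 F3 O μ ξ := by
  obtain ⟨M₁, h₁⟩ := exists_regular c
  obtain ⟨M₂, h₂⟩ := exists_est_mlDir.{u, v} c
  obtain ⟨M₃, h₃⟩ := exists_est_ulDir.{u, v} c
  refine ⟨max 1 (max (|M₁| * (1 + |M₁|)) (max M₂ (max M₃ (c.σdf3 ^ 2)))), le_max_left _ _, ?_⟩
  intro n m t F1 F2 F3 S _ P _ O θ Ω _ μ _ ξ h hθ hθ1 hO hξ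
  have hreg := h₁ h
  have hM₁ : |M₁| = M₁ := abs_of_nonneg (zero_le_one.trans hreg.one_le)
  rw [hM₁]
  set M := max 1 (max (M₁ * (1 + M₁)) (max M₂ (max M₃ (c.σdf3 ^ 2)))) with hM
  have b1 : M₁ * (1 + M₁) ≤ M := (le_max_left _ _).trans (le_max_right _ _)
  have b2 : M₂ ≤ M := (le_max_left _ _).trans ((le_max_right _ _).trans (le_max_right _ _))
  have b3 : M₃ ≤ M := (le_max_left _ _).trans
    ((le_max_right _ _).trans ((le_max_right _ _).trans (le_max_right _ _)))
  have b4 : c.σdf3 ^ 2 ≤ M := (le_max_right _ _).trans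
    ((le_max_right _ _).trans ((le_max_right _ _).trans (le_max_right _ _)))
  have hM₁1 := hreg.one_le
  have b5 : M₁ ≤ M := le_trans (by nlinarith) b1
  have hV : ∀ p, ‖meanInvZZ P O p‖ ≤ c.R := fun p => by
    have h4 := norm_integral_le_of_norm_le_const ((hO.bound.zz p).mono fun _ h => h.2)
    rw [probReal_univ, mul_one] at h4
    exact h4.trans ((le_abs_self _).trans (c.le_L.2.2.2.2.2.2.2.2.1.trans c.L_le_R))
  have hV' : ∀ p, ‖meanInvZZ P O p - invZZ (fderiv ℝ (fderiv ℝ F3) p)‖ ≤ c.R * θ := fun p => by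
    rw [norm_sub_rev]
    refine (hO.bias.zz p).trans (mul_le_mul_of_nonneg_right ?_ hθ)
    exact (le_abs_self _).trans (c.le_L.2.2.2.2.2.2.2.2.2.2.1.trans c.L_le_R)
  have hW : ∀ p, ‖meanInvYY P O p‖ ≤ c.R := fun p => by
    have h4 := norm_integral_le_of_norm_le_const ((hO.bound.yy p).mono fun _ h => h.2)
    rw [probReal_univ, mul_one] at h4
    have h5 := c.le_L.2.2.2.2.2.2.2.2.2.1
    have h6 := abs_nonneg c.Wyy
    have h7 := c.μy_inv_nonneg
    have h8 := c.L_le_R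
    have h9 := le_abs_self c.byy
    refine h4.trans ?_
    linarith
  have hW' : ∀ p, ‖meanInvYY P O p - (exHess F2 F3 inY p).inverse‖ ≤ c.R * θ := fun p => by
    rw [norm_sub_rev]
    refine (hO.bias.yy p).trans (mul_le_mul_of_nonneg_right ?_ hθ)
    exact (le_abs_self _).trans (c.le_L.2.2.2.2.2.2.2.2.2.2.2.1.trans c.L_le_R)
  refine ⟨hreg.mono b5, fun p i j k => ?_, fun x y z i j => ?_, fun x y z i => ?_⟩
  · have e := (Est.of_unbiased_centered hξ hO.est.df3 p (.ll i j k)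
      ((ContinuousLinearMap.compL ℝ (Vec t) (Pt n m t) ℝ).flip inZ)
      (norm_restrict_le norm_inZ_le)).mono b4
    exact e.hasMean
  · have hinj : Function.Injective fun r : Fin 3 => SampleIdx.ml i j r := fun r r' hr => by
      simpa using hr
    obtain ⟨T, e⟩ := h₂ (pt x y z) h.smooth hO (hξ.comp hinj)
    refine ⟨_, (e.mono b2).hasMean, ?_⟩
    rw [← riesz_sub, norm_riesz]
    refine (hreg.mlForm_sub_le _ _ _ θ hθ (hV _) (hV' _)).trans ?_
    refine mul_le_mul b5 ?_ (by positivity) (by linarith)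
    have := norm_pt_sub_le x x y y z (zSol F3 x y)
    simp only [sub_self, norm_zero, zero_add] at this
    exact add_le_add_left this θ
  · obtain ⟨T, e⟩ := h₃ (pt x y z) i h.smooth hO hξ
    have er := e.riesz
    refine ⟨_, er.memLp, er.mean, er.le.trans b3, ?_⟩
    rw [← riesz_sub, norm_riesz]
    refine (hreg.ulMean_sub_le x _ _ _ θ hθ hθ1 (hV _) (hV' _) (hW _) (hO.bias.yy_invertible _)
      (hW' _)).trans ?_
    have h4 := norm_pt_sub_le x x y (ySol F2 F3 x) z (zSol F3 x (ySol F2 F3 x))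
    simp only [sub_self, norm_zero, zero_add] at h4
    have h5 := hreg.zSol_lip x x y (ySol F2 F3 x)
    simp only [sub_self, norm_zero, zero_add] at h5
    have h6 := norm_sub_le_norm_sub_add_norm_sub z (zSol F3 x y) (zSol F3 x (ySol F2 F3 x))
    have h7 : ‖pt x y z - ulPt F2 F3 x‖ ≤ (1 + M₁) * (‖y - ySol F2 F3 x‖ + ‖z - zSol F3 x y‖) := by
      have h8 : ‖pt x y z - ulPt F2 F3 x‖
        ≤ ‖y - ySol F2 F3 x‖ + ‖z - zSol F3 x (ySol F2 F3 x)‖ := h4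
      have h9 := norm_nonneg (z - zSol F3 x y)
      nlinarith
    calc M₁ * (‖pt x y z - ulPt F2 F3 x‖ + θ)
        ≤ M₁ * ((1 + M₁) * (‖y - ySol F2 F3 x‖ + ‖z - zSol F3 x y‖ + θ)) := by
          refine mul_le_mul_of_nonneg_left ?_ (by linarith)
          nlinarith
      _ = M₁ * (1 + M₁) * (‖y - ySol F2 F3 x‖ + ‖z - zSol F3 x y‖ + θ) := by ring
      _ ≤ _ := mul_le_mul_of_nonneg_right b1 (by positivity)

end Moments

/-! ### One step of the method, from a fixed state -/

section Steps

variable {Ω : Type*} [MeasurableSpace Ω] {μ : Measure Ω} [IsProbabilityMeasure μ]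

theorem integral_inner_of_memLp {d : ℕ} {X : Ω → Vec d} (hX : MemLp X 2 μ) (v : Vec d) :
    ∫ ω, inner ℝ v (X ω) ∂μ = inner ℝ v (∫ ω, X ω ∂μ) :=
  integral_inner (hX.integrable (by norm_num)) v

theorem HasMean.integrable_sq {d : ℕ} {X : Ω → Vec d} {x : Vec d} {s : ℝ} (h : HasMean μ X x s)
    (v : Vec d) (γ : ℝ) : Integrable (fun ω => ‖v - γ • X ω‖ ^ 2) μ :=
  ((memLp_const v).sub (h.memLp.const_smul γ)).integrable_norm_pow (by norm_num)

theorem HasMean.integral_sq_le {d : ℕ} {X : Ω → Vec d} {x : Vec d} {s : ℝ} (h : HasMean μ X x s)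
    (v : Vec d) (γ : ℝ) : ∫ ω, ‖v - γ • X ω‖ ^ 2 ∂μ ≤ ‖v - γ • x‖ ^ 2 + γ ^ 2 * s := by
  have hc : MemLp (fun ω => X ω - x) 2 μ := h.memLp.sub (memLp_const x)
  have e : ∀ ω, ‖v - γ • X ω‖ ^ 2 = ‖v - γ • x‖ ^ 2
      - 2 * γ * inner ℝ (v - γ • x) (X ω - x) + γ ^ 2 * ‖X ω - x‖ ^ 2 := fun ω => by
    have e1 : v - γ • X ω = (v - γ • x) - γ • (X ω - x) := by rw [smul_sub]; abel
    rw [e1, norm_sub_sq_real, inner_smul_right, norm_smul, mul_pow, Real.norm_eq_abs, sq_abs]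
    ring
  have hi1 : Integrable (fun ω => inner ℝ (v - γ • x) (X ω - x)) μ :=
    (hc.integrable (by norm_num)).const_inner _
  have hi2 : Integrable (fun ω => ‖X ω - x‖ ^ 2) μ := hc.integrable_norm_pow (by norm_num)
  have h0 : ∫ ω, (X ω - x) ∂μ = 0 := by
    rw [integral_sub (h.memLp.integrable (by norm_num)) (integrable_const _), h.mean]
    simp
  have hi3 : Integrable (fun ω => ‖v - γ • x‖ ^ 2 - 2 * γ * inner ℝ (v - γ • x) (X ω - x)) μ :=
    (integrable_const _).sub (hi1.const_mul _)
  simp only [e]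
  rw [integral_add hi3 (hi2.const_mul _), integral_sub (integrable_const _) (hi1.const_mul _),
    integral_const_mul, integral_const_mul, integral_inner_of_memLp hc, h0]
  have := mul_le_mul_of_nonneg_left h.var_le (sq_nonneg γ)
  simpa using this

theorem HasMean.integral_norm_sq_le {d : ℕ} {X : Ω → Vec d} {x : Vec d} {s : ℝ}
    (h : HasMean μ X x s) : ∫ ω, ‖X ω‖ ^ 2 ∂μ ≤ ‖x‖ ^ 2 + s := by
  simpa using h.integral_sq_le 0 1

/-- A gradient step on a strongly monotone Lipschitz field contracts. -/
theorem norm_sub_smul_sq_le {d : ℕ} {v g : Vec d} {m' L γ : ℝ} (h1 : m' * ‖v‖ ^ 2 ≤ inner ℝ g v)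
    (h2 : ‖g‖ ≤ L * ‖v‖) (hγ : 0 ≤ γ) (hγL : γ * L ^ 2 ≤ m') :
    ‖v - γ • g‖ ^ 2 ≤ (1 - m' * γ) * ‖v‖ ^ 2 := by
  rw [norm_sub_sq_real, inner_smul_right, norm_smul, mul_pow, Real.norm_eq_abs, sq_abs,
    real_inner_comm]
  have h3 : ‖g‖ ^ 2 ≤ L ^ 2 * ‖v‖ ^ 2 := by
    rw [← mul_pow]; exact pow_le_pow_left₀ (norm_nonneg _) h2 2
  have h4 : γ ^ 2 * ‖g‖ ^ 2 ≤ γ ^ 2 * (L ^ 2 * ‖v‖ ^ 2) :=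
    mul_le_mul_of_nonneg_left h3 (sq_nonneg γ)
  have h5 : γ * (γ * L ^ 2) * ‖v‖ ^ 2 ≤ γ * m' * ‖v‖ ^ 2 := by gcongr
  have h6 := mul_le_mul_of_nonneg_left h1 hγ
  nlinarith

theorem sq_norm_add_le {E : Type*} [NormedAddCommGroup E] (a b : E) :
    ‖a + b‖ ^ 2 ≤ 2 * ‖a‖ ^ 2 + 2 * ‖b‖ ^ 2 := by
  have h1 := norm_add_le a b
  have h2 := norm_nonneg (a + b)
  have h3 := sq_nonneg (‖a‖ - ‖b‖)
  nlinarith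

omit [IsProbabilityMeasure μ] in
theorem integrable_of_le {f g : Ω → ℝ} (hg : Integrable g μ) (hf : AEStronglyMeasurable f μ)
    (h0 : ∀ ω, 0 ≤ f ω) (h : ∀ ω, f ω ≤ g ω) : Integrable f μ :=
  hg.mono' hf (Eventually.of_forall fun ω => by
    rw [Real.norm_of_nonneg (h0 ω)]; exact h ω)

variable {S : Type*} [MeasurableSpace S] {n m t : ℕ} {c : Constants} {M θ : ℝ}
  {F1 F2 F3 : Pt n m t → ℝ} {O : Oracle n m t S} {ξ : SampleIdx → Ω → S}

theorem Regular.continuous_ySol (h : Regular c M F1 F2 F3) : Continuous (ySol F2 F3) :=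
  (LipschitzWith.of_dist_le_mul (K := ⟨M, zero_le_one.trans h.one_le⟩) fun x x' => by
    rw [dist_eq_norm, dist_eq_norm]; exact h.ySol_lip x x').continuous

theorem Regular.continuous_zSol (h : Regular c M F1 F2 F3) :
    Continuous fun u : Vec n × Vec m => zSol F3 u.1 u.2 :=
  (LipschitzWith.of_dist_le_mul (K := ⟨M * 2, by have := h.one_le; linarith⟩) fun u u' => by
    rw [dist_eq_norm, dist_eq_norm]
    refine (h.zSol_lip u.1 u'.1 u.2 u'.2).trans ?_
    have h1 : ‖u.1 - u'.1‖ ≤ ‖u - u'‖ := norm_fst_le (u - u')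
    have h2 : ‖u.2 - u'.2‖ ≤ ‖u - u'‖ := norm_snd_le (u - u')
    have h3 := h.one_le
    change _ ≤ M * 2 * ‖u - u'‖
    rw [mul_assoc]
    exact mul_le_mul_of_nonneg_left (by linarith) (by linarith)).continuous

/-- One lower-level step. -/
theorem Directions.ll_step (h : Problem c F1 F2 F3) (hD : Directions c M θ F1 F2 F3 O μ ξ)
    {γ : ℝ} (hγ : 0 ≤ γ) (hγR : γ * c.R ^ 2 ≤ c.μz) (x : Vec n) (y : Vec m) (z : Vec t)
    (i j k : ℕ) :
    Integrable (fun ω => ‖z - γ • riesz (O.llDir (pt x y z) (ξ (.ll i j k) ω))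
      - zSol F3 x y‖ ^ 2) μ ∧
    ∫ ω, ‖z - γ • riesz (O.llDir (pt x y z) (ξ (.ll i j k) ω)) - zSol F3 x y‖ ^ 2 ∂μ
      ≤ (1 - c.μz * γ) * ‖z - zSol F3 x y‖ ^ 2 + γ ^ 2 * M := by
  have hm := hD.ll (pt x y z) i j k
  simp only [sub_right_comm]
  refine ⟨hm.integrable_sq _ _, (hm.integral_sq_le _ _).trans ?_⟩
  gcongr
  have h0 := h.fderiv_zSol x y
  have e : riesz (fderiv ℝ F3 (pt x y z) ∘L (inZ : Vec t →L[ℝ] Pt n m t))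
      = riesz (fderiv ℝ F3 (pt x y z) ∘L (inZ : Vec t →L[ℝ] Pt n m t)
        - fderiv ℝ F3 (llPt F3 x y) ∘L (inZ : Vec t →L[ℝ] Pt n m t)) := by
    rw [h0, sub_zero]
  refine norm_sub_smul_sq_le (L := c.R) ?_ ?_ hγ hγR
  · rw [e, inner_riesz]
    exact h.monotone_z x y z (zSol F3 x y)
  · rw [e, norm_riesz, ← ContinuousLinearMap.sub_comp]
    refine (ContinuousLinearMap.opNorm_comp_le _ _).trans ?_
    refine (mul_le_of_le_one_right (norm_nonneg _) norm_inZ_le).trans ?_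
    refine (h.smooth.lip_df3.norm_sub_le _ _).trans ?_
    have h1 := norm_pt_sub_le x x y y z (zSol F3 x y)
    simp only [sub_self, norm_zero, zero_add] at h1
    have hR := c.one_le_R
    exact mul_le_mul (c.le_L.2.2.2.2.2.1.trans c.L_le_R) h1 (norm_nonneg _) (by linarith)

/-- The constant of a middle-level step. -/
def mlConst (c : Constants) (M : ℝ) : ℝ :=
  2 + M + 2 * M ^ 3 + 2 * M ^ 2 * (2 / c.μy + 1 + 4 * M ^ 2)

/-- Collecting the error terms of a middle-level step. Here `A` is the error of the step in mean,
`e`, `ez`, `b`, `d` are the squares of the middle-level error, of the lower-level error, of the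
bias and of the mean direction. -/
theorem ml_step_aux {M β θ e ez b d A m' : ℝ} (hM : 1 ≤ M) (hm : 0 < m') (hθ : 0 ≤ θ)
    (hθβ : θ ≤ β) (hβ1 : β ≤ 1) (hβM : 16 * M ^ 4 * β ≤ m') (he : 0 ≤ e) (hez : 0 ≤ ez)
    (hb0 : 0 ≤ b) (hb : b ≤ 2 * M ^ 2 * (ez + θ ^ 2)) (hd : d ≤ 2 * M ^ 2 * e + 2 * b)
    (hA : A ≤ (1 - m' / 2 * β) * e + (2 / m' + 1) * β * b) :
    A + β ^ 2 * M + (2 * ez + 2 * M ^ 2 * β ^ 2 * (d + M)) ≤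
      (1 - m' / 4 * β) * e + (2 + M + 2 * M ^ 3 + 2 * M ^ 2 * (2 / m' + 1 + 4 * M ^ 2)) * ez
      + (2 + M + 2 * M ^ 3 + 2 * M ^ 2 * (2 / m' + 1 + 4 * M ^ 2)) * β ^ 2 := by
  have hβ : 0 ≤ β := hθ.trans hθβ
  set q := 2 / m' with hq
  have hq0 : 0 ≤ q := by positivity
  have s1 : 2 * M ^ 2 * β ^ 2 * d ≤ m' / 4 * β * e + 4 * M ^ 2 * β * b := by
    have t1 := mul_le_mul_of_nonneg_left hd (by positivity : 0 ≤ 2 * M ^ 2 * β ^ 2)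
    have t2 : 16 * M ^ 4 * β * (β * e) ≤ m' * (β * e) :=
      mul_le_mul_of_nonneg_right hβM (by positivity)
    have t3 : β * (4 * M ^ 2 * β * b) ≤ 1 * (4 * M ^ 2 * β * b) :=
      mul_le_mul_of_nonneg_right hβ1 (by positivity)
    linarith
  have t0 : β * (ez + θ ^ 2) ≤ ez + β ^ 2 := by
    have t1 : θ ^ 2 ≤ β ^ 2 := pow_le_pow_left₀ hθ hθβ 2
    have t2 : β * ez ≤ 1 * ez := mul_le_mul_of_nonneg_right hβ1 hez
    have t3 : β * θ ^ 2 ≤ 1 * θ ^ 2 := mul_le_mul_of_nonneg_right hβ1 (sq_nonneg _)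
    linarith
  have s2 : (q + 1 + 4 * M ^ 2) * β * b ≤ 2 * M ^ 2 * (q + 1 + 4 * M ^ 2) * (ez + β ^ 2) := by
    have t2 := mul_le_mul_of_nonneg_left hb (by positivity : 0 ≤ (q + 1 + 4 * M ^ 2) * β)
    have t3 := mul_le_mul_of_nonneg_left t0
      (by positivity : 0 ≤ 2 * M ^ 2 * (q + 1 + 4 * M ^ 2))
    linarith
  have s3 : 0 ≤ (M + 2 * M ^ 3) * ez := by positivity
  have s4 : 0 ≤ 2 * β ^ 2 := by positivity
  linarith

/-- One middle-level step. -/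
theorem Directions.ml_step (h : Problem c F1 F2 F3) (hD : Directions c M θ F1 F2 F3 O μ ξ)
    {β : ℝ} (hθ : 0 ≤ θ) (hθβ : θ ≤ β) (hβ1 : β ≤ 1) (hβM : 16 * M ^ 4 * β ≤ c.μy)
    (x : Vec n) (y : Vec m) (z : Vec t) (i j : ℕ) :
    Integrable (fun ω =>
      ‖y - β • riesz (O.mlDir (pt x y z) fun r => ξ (.ml i j r) ω) - ySol F2 F3 x‖ ^ 2
      + ‖z - zSol F3 x (y - β • riesz (O.mlDir (pt x y z) fun r => ξ (.ml i j r) ω))‖ ^ 2) μ ∧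
    ∫ ω, (‖y - β • riesz (O.mlDir (pt x y z) fun r => ξ (.ml i j r) ω) - ySol F2 F3 x‖ ^ 2
      + ‖z - zSol F3 x (y - β • riesz (O.mlDir (pt x y z) fun r => ξ (.ml i j r) ω))‖ ^ 2) ∂μ
      ≤ (1 - c.μy / 4 * β) * ‖y - ySol F2 F3 x‖ ^ 2 + mlConst c M * ‖z - zSol F3 x y‖ ^ 2
        + mlConst c M * β ^ 2 := by
  obtain ⟨d, hm, hd⟩ := hD.ml x y z i j
  set X := fun ω => riesz (O.mlDir (pt x y z) fun r => ξ (.ml i j r) ω) with hX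
  have hM := hD.regular.one_le
  have hβ : 0 ≤ β := hθ.trans hθβ
  have hμ := c.μy_pos
  set g := riesz (exGrad F2 F3 (llPt F3 x y)) with hg
  set v := y - ySol F2 F3 x with hv
  set e := ‖v‖ with he
  set ez := ‖z - zSol F3 x y‖ with hez
  set b := d - g with hb
  have hb2 : ‖b‖ ^ 2 ≤ 2 * M ^ 2 * (ez ^ 2 + θ ^ 2) := by
    have h1 := pow_le_pow_left₀ (norm_nonneg _) hd 2
    rw [mul_pow] at h1
    nlinarith [sq_nonneg (ez - θ), sq_nonneg M]
  -- the exact gradient step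
  have hgv : g = riesz (exGrad F2 F3 (llPt F3 x y) - exGrad F2 F3 (ulPt F2 F3 x)) := by
    rw [h.exGrad_ulPt, sub_zero]
  have hg1 : c.μy * ‖v‖ ^ 2 ≤ inner ℝ g v := by
    rw [hgv, inner_riesz]
    exact h.monotone_y x y (ySol F2 F3 x)
  have hg2 : ‖g‖ ≤ M * ‖v‖ := by
    rw [hgv, norm_riesz]
    exact hD.regular.exGrad_lip x y (ySol F2 F3 x)
  have hβM2 : β * M ^ 2 ≤ c.μy := by
    have h1 : M ^ 2 ≤ M ^ 4 := pow_le_pow_right₀ hM (by norm_num)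
    have h2 : β * M ^ 2 ≤ β * M ^ 4 := mul_le_mul_of_nonneg_left h1 hβ
    have h3 : 0 ≤ β * M ^ 4 := by positivity
    linarith
  have hstep := norm_sub_smul_sq_le hg1 hg2 hβ hβM2
  -- the inexact gradient step
  have hstep2 : ‖v - β • d‖ ^ 2 ≤ (1 - c.μy / 2 * β) * e ^ 2 + (2 / c.μy + 1) * β * ‖b‖ ^ 2 := by
    have e1 : v - β • d = (v - β • g) - β • b := by rw [hb, smul_sub]; abel
    have hle : ‖v - β • g‖ ^ 2 ≤ e ^ 2 := by
      refine hstep.trans (mul_le_of_le_one_left (sq_nonneg _) ?_)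
      nlinarith
    have hle' : ‖v - β • g‖ ≤ e := by
      exact (sq_le_sq₀ (norm_nonneg _) (norm_nonneg _)).1 hle
    have h1 : ‖v - β • d‖ ≤ ‖v - β • g‖ + β * ‖b‖ := by
      rw [e1]
      refine (norm_sub_le _ _).trans (le_of_eq ?_)
      rw [norm_smul, Real.norm_of_nonneg hβ]
    have h2 : ‖v - β • d‖ ^ 2 ≤ ‖v - β • g‖ ^ 2 + 2 * β * (e * ‖b‖) + β ^ 2 * ‖b‖ ^ 2 := by
      have h3 := pow_le_pow_left₀ (norm_nonneg _) h1 2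
      have h4 : ‖v - β • g‖ * ‖b‖ ≤ e * ‖b‖ := mul_le_mul_of_nonneg_right hle' (norm_nonneg _)
      nlinarith
    have h5 : 2 * (e * ‖b‖) ≤ c.μy / 2 * e ^ 2 + 2 / c.μy * ‖b‖ ^ 2 := by
      have h6 : 0 ≤ (c.μy * e - 2 * ‖b‖) ^ 2 / (2 * c.μy) := by positivity
      have h7 : (c.μy * e - 2 * ‖b‖) ^ 2 / (2 * c.μy)
          = c.μy / 2 * e ^ 2 + 2 / c.μy * ‖b‖ ^ 2 - 2 * (e * ‖b‖) := by
        field_simp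
        ring
      linarith
    have h8 : β ^ 2 * ‖b‖ ^ 2 ≤ β * ‖b‖ ^ 2 := by
      apply mul_le_mul_of_nonneg_right _ (sq_nonneg _)
      nlinarith
    have h9 := mul_le_mul_of_nonneg_left h5 hβ
    nlinarith
  have hd2 : ‖d‖ ^ 2 ≤ 2 * M ^ 2 * e ^ 2 + 2 * ‖b‖ ^ 2 := by
    have e1 : d = g + b := by rw [hb]; abel
    rw [e1]
    have h1 := pow_le_pow_left₀ (norm_nonneg _) hg2 2
    rw [mul_pow] at h1
    linarith [sq_norm_add_le g b]
  have hX2 := hm.integral_norm_sq_le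
  have hXi : Integrable (fun ω => ‖X ω‖ ^ 2) μ := hm.memLp.integrable_norm_pow (by norm_num)
  have hzpt : ∀ ω, ‖z - zSol F3 x (y - β • X ω)‖ ^ 2
      ≤ 2 * ez ^ 2 + 2 * M ^ 2 * β ^ 2 * ‖X ω‖ ^ 2 := fun ω => by
    have e1 : z - zSol F3 x (y - β • X ω)
        = (z - zSol F3 x y) + (zSol F3 x y - zSol F3 x (y - β • X ω)) := by abel
    have h1 := hD.regular.zSol_lip x x y (y - β • X ω)
    rw [sub_self, norm_zero, zero_add, sub_sub_cancel, norm_smul, Real.norm_of_nonneg hβ] at h1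
    have h2 := pow_le_pow_left₀ (norm_nonneg _) h1 2
    have h3 := sq_norm_add_le (z - zSol F3 x y) (zSol F3 x y - zSol F3 x (y - β • X ω))
    rw [e1]
    calc _ ≤ _ := h3
      _ ≤ 2 * ez ^ 2 + 2 * (M * (β * ‖X ω‖)) ^ 2 := by gcongr
      _ = _ := by ring
  have hi1 : Integrable (fun ω => ‖y - β • X ω - ySol F2 F3 x‖ ^ 2) μ := by
    simp only [sub_right_comm]; exact hm.integrable_sq _ _
  have hib := (integrable_const (μ := μ) (2 * ez ^ 2)).add (hXi.const_mul (2 * M ^ 2 * β ^ 2))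
  have hi2 : Integrable (fun ω => ‖z - zSol F3 x (y - β • X ω)‖ ^ 2) μ := by
    refine integrable_of_le hib ?_ (fun _ => sq_nonneg _) hzpt
    have hc : Continuous fun w : Vec m => ‖z - zSol F3 x (y - β • w)‖ ^ 2 := by
      have := hD.regular.continuous_zSol.comp
        (continuous_const.prodMk (continuous_const.sub (continuous_const_smul β)) :
          Continuous fun w : Vec m => ((x, y - β • w) : Vec n × Vec m))
      exact (continuous_const.sub this).norm.pow 2
    exact hc.comp_aestronglyMeasurable hm.memLp.1
  refine ⟨hi1.add hi2, ?_⟩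
  rw [integral_add hi1 hi2]
  have k1 : ∫ ω, ‖y - β • X ω - ySol F2 F3 x‖ ^ 2 ∂μ ≤ ‖v - β • d‖ ^ 2 + β ^ 2 * M := by
    simp only [sub_right_comm]; exact hm.integral_sq_le _ _
  have k2 : ∫ ω, ‖z - zSol F3 x (y - β • X ω)‖ ^ 2 ∂μ
      ≤ 2 * ez ^ 2 + 2 * M ^ 2 * β ^ 2 * (‖d‖ ^ 2 + M) := by
    refine (integral_mono hi2 hib hzpt).trans ?_
    have e1 : ∫ ω, (2 * ez ^ 2 + 2 * M ^ 2 * β ^ 2 * ‖X ω‖ ^ 2) ∂μ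
        = 2 * ez ^ 2 + 2 * M ^ 2 * β ^ 2 * ∫ ω, ‖X ω‖ ^ 2 ∂μ := by
      rw [integral_add (integrable_const _) (hXi.const_mul _),
        integral_const_mul (2 * M ^ 2 * β ^ 2)]
      simp
    exact e1.le.trans (by gcongr)
  refine (add_le_add k1 k2).trans ?_
  rw [mlConst]
  exact ml_step_aux hM hμ hθ hθβ hβ1 hβM (sq_nonneg _) (sq_nonneg _) (sq_nonneg _) hb2 hd2 hstep2

end Steps

/-! ### One upper-level step, from a fixed state -/

section UpperStep

variable {Ω : Type*} [MeasurableSpace Ω] {μ : Measure Ω} [IsProbabilityMeasure μ]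
variable {S : Type*} [MeasurableSpace S] {n m t : ℕ} {c : Constants} {M θ : ℝ}
  {F1 F2 F3 : Pt n m t → ℝ} {O : Oracle n m t S} {ξ : SampleIdx → Ω → S}

/-- The constant of an upper-level step. -/
def ulConst (M : ℝ) : ℝ := 12 * M ^ 2 + 3 * M ^ 3

/-- Collecting the error terms of an upper-level step. Here `e`, `ez` are the middle-level and the
lower-level error, `g` and `b` are the norms of the gradient and of the bias, `l` is the mean of the
linear term. -/
theorem ul_step_aux {M α θ e ez b g l : ℝ} (hM : 1 ≤ M) (hθ : 0 ≤ θ) (hθα : θ ≤ α) (hα1 : α ≤ 1)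
    (hb0 : 0 ≤ b) (hb : b ≤ M * (e + ez + θ))
    (hl : l ≤ 2 * (e * (M * (g + b))) - g ^ 2 + g * b) :
    e ^ 2 + 2 * ez ^ 2 + α * l + α ^ 2 * (M + M * (e ^ 2 + 1) + 3 * M ^ 2) * M ≤
      -(α / 2) * g ^ 2 + (1 + ulConst M * α) * e ^ 2 + (2 + ulConst M) * ez ^ 2
        + ulConst M * α ^ 2 := by
  have hα : 0 ≤ α := hθ.trans hθα
  have h1 : l ≤ -(1 / 2) * g ^ 2 + 5 * M ^ 2 * e ^ 2 + 2 * b ^ 2 := by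
    nlinarith [sq_nonneg (g - 4 * (M * e)), sq_nonneg (M * e - b), sq_nonneg (g - 2 * b)]
  have h2 : b ^ 2 ≤ 3 * M ^ 2 * (e ^ 2 + ez ^ 2 + θ ^ 2) := by
    have h3 := pow_le_pow_left₀ hb0 hb 2
    have h4 : (e + ez + θ) ^ 2 ≤ 3 * (e ^ 2 + ez ^ 2 + θ ^ 2) := by
      nlinarith [sq_nonneg (e - ez), sq_nonneg (e - θ), sq_nonneg (ez - θ)]
    have h5 := mul_le_mul_of_nonneg_left h4 (sq_nonneg M)
    rw [mul_pow] at h3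
    linarith
  have h3 : l ≤ -(1 / 2) * g ^ 2 + 11 * M ^ 2 * e ^ 2 + 6 * M ^ 2 * ez ^ 2 + 6 * M ^ 2 * θ ^ 2 := by
    linarith
  have h4 := mul_le_mul_of_nonneg_left h3 hα
  have hαα : α ^ 2 ≤ α := by nlinarith
  have h5 : α * (6 * M ^ 2 * ez ^ 2) ≤ 1 * (6 * M ^ 2 * ez ^ 2) :=
    mul_le_mul_of_nonneg_right hα1 (by positivity)
  have h6 : 6 * M ^ 2 * (α * θ ^ 2) ≤ 6 * M ^ 2 * α ^ 2 := by
    have h7 : θ ^ 2 ≤ α ^ 2 := pow_le_pow_left₀ hθ hθα 2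
    have h8 : α * θ ^ 2 ≤ 1 * α ^ 2 := mul_le_mul hα1 h7 (sq_nonneg _) zero_le_one
    exact mul_le_mul_of_nonneg_left (by linarith) (by positivity)
  have h7 : M ^ 2 * e ^ 2 * α ^ 2 ≤ M ^ 2 * e ^ 2 * α :=
    mul_le_mul_of_nonneg_left hαα (by positivity)
  have p1 : 0 ≤ M ^ 3 * e ^ 2 * α := by positivity
  have p2 : 0 ≤ M ^ 3 * ez ^ 2 := by positivity
  have p3 : 0 ≤ M ^ 2 * ez ^ 2 := by positivity
  have p4 : 0 ≤ M ^ 2 * α ^ 2 := by positivity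
  rw [ulConst]
  linarith

/-- One upper-level step decreases the Lyapunov function `f - f_min + ‖y - y(x)‖² + ‖z - z(x, y)‖²`
by a multiple of `‖∇f‖²`, up to errors. -/
theorem Directions.ul_step (hD : Directions c M θ F1 F2 F3 O μ ξ) {fmin : ℝ}
    (hmin : ∀ x, fmin ≤ upper F1 F2 F3 x) (hcont : Continuous (upper F1 F2 F3))
    {α : ℝ} (hθ : 0 ≤ θ) (hθα : θ ≤ α) (hα1 : α ≤ 1)
    (x : Vec n) (y : Vec m) (z : Vec t) (i : ℕ) {X : Ω → Vec n}
    (hX : ∀ ω, X ω = x - α • riesz (O.ulDir (pt x y z) (fun r => ξ (.ulGrad i r) ω)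
      (fun r => ξ (.ulXY i r) ω) (fun r => ξ (.ulYY i r) ω))) :
    Integrable (fun ω => upper F1 F2 F3 (X ω) - fmin + ‖y - ySol F2 F3 (X ω)‖ ^ 2
      + ‖z - zSol F3 (X ω) y‖ ^ 2) μ ∧
    ∫ ω, (upper F1 F2 F3 (X ω) - fmin + ‖y - ySol F2 F3 (X ω)‖ ^ 2
      + ‖z - zSol F3 (X ω) y‖ ^ 2) ∂μ
      ≤ upper F1 F2 F3 x - fmin - α / 2 * ‖exUpper F1 F2 F3 (ulPt F2 F3 x)‖ ^ 2
        + (1 + ulConst M * α) * ‖y - ySol F2 F3 x‖ ^ 2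
        + (2 + ulConst M) * ‖z - zSol F3 x y‖ ^ 2 + ulConst M * α ^ 2 := by
  obtain ⟨d, hm, hd, hd2, hb⟩ := hD.ul x y z i
  set Y := fun ω => riesz (O.ulDir (pt x y z) (fun r => ξ (.ulGrad i r) ω)
      (fun r => ξ (.ulXY i r) ω) (fun r => ξ (.ulYY i r) ω)) with hY
  obtain rfl : X = fun ω => x - α • Y ω := funext hX
  have hM := hD.regular.one_le
  have hM0 : 0 ≤ M := zero_le_one.trans hM
  have hα : 0 ≤ α := hθ.trans hθα
  set D := exUpper F1 F2 F3 (ulPt F2 F3 x) with hDdef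
  set J := yJac F2 F3 (ulPt F2 F3 x) with hJ
  set v := y - ySol F2 F3 x with hv
  set e := ‖v‖ with he
  set ez := ‖z - zSol F3 x y‖ with hez
  set A := M + M * (e ^ 2 + 1) + 3 * M ^ 2 with hA
  -- the linear part of the change of the Lyapunov function
  set l : Dual (Vec n) := (2 : ℝ) • (innerSL ℝ v ∘L J) - D with hl
  have hlap : ∀ w, l w = 2 * inner ℝ v (J w) - D w := fun w => by
    simp [hl]
  have key : ∀ w : Vec n, upper F1 F2 F3 (x - α • w) - fmin + ‖y - ySol F2 F3 (x - α • w)‖ ^ 2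
      + ‖z - zSol F3 (x - α • w) y‖ ^ 2 ≤ (upper F1 F2 F3 x - fmin + e ^ 2 + 2 * ez ^ 2)
        + α * l w + α ^ 2 * A * ‖w‖ ^ 2 := fun w => by
    have hw : x - α • w - x = -(α • w) := by abel
    have hwn : ‖x - α • w - x‖ = α * ‖w‖ := by
      rw [hw, norm_neg, norm_smul, Real.norm_of_nonneg hα]
    have k1 := hD.regular.upper_taylor x (x - α • w)
    rw [hwn, hw, map_neg, map_smul, smul_eq_mul, ← hDdef] at k1
    have k1' := (Real.le_norm_self _).trans k1
    have k2 := hD.regular.ySol_taylor x (x - α • w)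
    rw [hwn, hw, map_neg, map_smul, ← hJ] at k2
    have k3 := hD.regular.ySol_lip (x - α • w) x
    rw [hwn] at k3
    set r := ySol F2 F3 (x - α • w) - ySol F2 F3 x with hr
    have k4 : y - ySol F2 F3 (x - α • w) = v - r := by rw [hv, hr]; abel
    have k5 : inner ℝ v r ≥ -(α * inner ℝ v (J w)) - e * (M * (α * ‖w‖) ^ 2) := by
      have h1 : r = (r - -(α • J w)) - α • J w := by abel
      have h2 : inner ℝ v r = inner ℝ v (r - -(α • J w)) - α * inner ℝ v (J w) := by
        conv_lhs => rw [h1]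
        rw [inner_sub_right, inner_smul_right]
      have h3 := (abs_le.1 (abs_real_inner_le_norm v (r - -(α • J w)))).1
      have h4 := mul_le_mul_of_nonneg_left k2 (norm_nonneg v)
      linarith
    have k6 : ‖r‖ ^ 2 ≤ (M * (α * ‖w‖)) ^ 2 := pow_le_pow_left₀ (norm_nonneg _) k3 2
    have k7 : ‖z - zSol F3 (x - α • w) y‖ ^ 2 ≤ 2 * ez ^ 2 + 2 * (M * (α * ‖w‖)) ^ 2 := by
      have e1 : z - zSol F3 (x - α • w) y
          = (z - zSol F3 x y) + (zSol F3 x y - zSol F3 (x - α • w) y) := by abel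
      have h1 := hD.regular.zSol_lip x (x - α • w) y y
      rw [sub_self, norm_zero, add_zero, norm_sub_rev x, hwn] at h1
      have h2 := pow_le_pow_left₀ (norm_nonneg _) h1 2
      have h3 := sq_norm_add_le (z - zSol F3 x y) (zSol F3 x y - zSol F3 (x - α • w) y)
      rw [e1]
      linarith
    have k8 : 2 * e * (M * (α * ‖w‖) ^ 2) ≤ (e ^ 2 + 1) * (M * (α * ‖w‖) ^ 2) :=
      mul_le_mul_of_nonneg_right (by nlinarith [sq_nonneg (e - 1)]) (by positivity)
    rw [k4, norm_sub_sq_real, hlap, ← he, hA]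
    linarith
  have hYi : Integrable (fun ω => ‖Y ω‖ ^ 2) μ := hm.integrable_norm_pow (by norm_num)
  have hYl : Integrable (fun ω => l (Y ω)) μ :=
    l.integrable_comp (hm.integrable (by norm_num))
  have hi1 : Integrable (fun ω => (upper F1 F2 F3 x - fmin + e ^ 2 + 2 * ez ^ 2)
      + α * l (Y ω)) μ := (integrable_const _).add (hYl.const_mul α)
  have hi2 := hi1.add (hYi.const_mul (α ^ 2 * A))
  have hi : Integrable (fun ω => upper F1 F2 F3 (x - α • Y ω) - fmin
      + ‖y - ySol F2 F3 (x - α • Y ω)‖ ^ 2 + ‖z - zSol F3 (x - α • Y ω) y‖ ^ 2) μ := by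
    refine integrable_of_le hi2 ?_ (fun ω => ?_) fun ω => key (Y ω)
    · have hx : Continuous fun w : Vec n => x - α • w :=
        continuous_const.sub (continuous_const_smul α)
      have hz := hD.regular.continuous_zSol.comp (hx.prodMk (continuous_const (y := y)))
      have hc : Continuous fun w : Vec n => upper F1 F2 F3 (x - α • w) - fmin
          + ‖y - ySol F2 F3 (x - α • w)‖ ^ 2 + ‖z - zSol F3 (x - α • w) y‖ ^ 2 :=
        (((hcont.comp hx).sub continuous_const).add
          ((continuous_const.sub (hD.regular.continuous_ySol.comp hx)).norm.pow 2)).add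
          ((continuous_const.sub hz).norm.pow 2)
      exact hc.comp_aestronglyMeasurable hm.1
    · have := hmin (x - α • Y ω)
      have : 0 ≤ upper F1 F2 F3 (x - α • Y ω) - fmin := by linarith
      positivity
  refine ⟨hi, (integral_mono hi hi2 fun ω => key (Y ω)).trans ?_⟩
  have e1 : ∫ ω, ((upper F1 F2 F3 x - fmin + e ^ 2 + 2 * ez ^ 2) + α * l (Y ω)
      + α ^ 2 * A * ‖Y ω‖ ^ 2) ∂μ = (upper F1 F2 F3 x - fmin + e ^ 2 + 2 * ez ^ 2) + α * l d
      + α ^ 2 * A * ∫ ω, ‖Y ω‖ ^ 2 ∂μ := by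
    rw [integral_add hi1 (hYi.const_mul _), integral_add (integrable_const _) (hYl.const_mul α),
      integral_const_mul, integral_const_mul (α ^ 2 * A),
      l.integral_comp_comm (hm.integrable (by norm_num)), hd]
    simp
  refine e1.le.trans ?_
  have hl1 : l d ≤ 2 * (e * (M * (‖D‖ + ‖d - riesz D‖))) - ‖D‖ ^ 2 + ‖D‖ * ‖d - riesz D‖ := by
    have h1 : d = riesz D + (d - riesz D) := by abel
    have h2 : ‖d‖ ≤ ‖D‖ + ‖d - riesz D‖ := by
      conv_lhs => rw [h1]
      exact (norm_add_le _ _).trans (by rw [norm_riesz])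
    have h3 : inner ℝ v (J d) ≤ e * (M * (‖D‖ + ‖d - riesz D‖)) := by
      refine (real_inner_le_norm _ _).trans (mul_le_mul_of_nonneg_left ?_ (norm_nonneg _))
      exact (J.le_opNorm d).trans (mul_le_mul (hD.regular.yJac_le x) h2 (norm_nonneg _) hM0)
    have h4 : D d = ‖D‖ ^ 2 + D (d - riesz D) := by
      conv_lhs => rw [h1]
      rw [map_add, ← inner_riesz D (riesz D), real_inner_self_eq_norm_sq, norm_riesz]
    have h5 := (abs_le.1 (D.le_opNorm (d - riesz D))).1
    rw [hlap]
    linarith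
  have hA0 : 0 ≤ α ^ 2 * A := by positivity
  have h6 := mul_le_mul_of_nonneg_left hd2 hA0
  have h7 := ul_step_aux hM hθ hθα hα1 (norm_nonneg (d - riesz D)) hb hl1
  linarith

end UpperStep

/-! ### From fixed states to random states -/

section Transfer

variable {Ω : Type*} [MeasurableSpace Ω] {μ : Measure Ω} [IsProbabilityMeasure μ]

/-- A bound on the mean of `Φ a B` for every fixed `a` passes to random `A` independent of `B`. -/
theorem integral_le_of_indepFun {E F : Type*} [MeasurableSpace E] [MeasurableSpace F] {A : Ω → E}
    {B : Ω → F} (hA : Measurable A) (hB : Measurable B) (hi : IndepFun A B μ) {Φ : E × F → ℝ}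
    (hΦ : Measurable Φ) (h0 : ∀ q, 0 ≤ Φ q) {Ψ : E → ℝ} (hΨ : Measurable Ψ)
    (hΨi : Integrable (fun ω => Ψ (A ω)) μ)
    (h : ∀ a, Integrable (fun ω => Φ (a, B ω)) μ ∧ ∫ ω, Φ (a, B ω) ∂μ ≤ Ψ a) :
    Integrable (fun ω => Φ (A ω, B ω)) μ ∧ ∫ ω, Φ (A ω, B ω) ∂μ ≤ ∫ ω, Ψ (A ω) ∂μ := by
  have hAp := Measure.isProbabilityMeasure_map (μ := μ) hA.aemeasurable
  have hBp := Measure.isProbabilityMeasure_map (μ := μ) hB.aemeasurable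
  have hmap : μ.map (fun ω => (A ω, B ω)) = (μ.map A).prod (μ.map B) :=
    (indepFun_iff_map_prod_eq_prod_map_map hA.aemeasurable hB.aemeasurable).1 hi
  have hs : ∀ a, Measurable fun b => Φ (a, b) := fun a => hΦ.comp measurable_prodMk_left
  have hsi : ∀ a, Integrable (fun b => Φ (a, b)) (μ.map B) := fun a =>
    (integrable_map_measure (hs a).aestronglyMeasurable hB.aemeasurable).2 (h a).1
  have hsle : ∀ a, ∫ b, Φ (a, b) ∂(μ.map B) ≤ Ψ a := fun a => by
    rw [integral_map hB.aemeasurable (hs a).aestronglyMeasurable]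
    exact (h a).2
  have hΨm : Integrable Ψ (μ.map A) :=
    (integrable_map_measure hΨ.aestronglyMeasurable hA.aemeasurable).2 hΨi
  have hin : Integrable (fun a => ∫ b, Φ (a, b) ∂(μ.map B)) (μ.map A) :=
    integrable_of_le hΨm hΦ.stronglyMeasurable.integral_prod_right'.aestronglyMeasurable
      (fun a => integral_nonneg fun _ => h0 _) hsle
  have hprod : Integrable Φ ((μ.map A).prod (μ.map B)) := by
    rw [integrable_prod_iff hΦ.aestronglyMeasurable]
    refine ⟨Eventually.of_forall hsi, ?_⟩
    simpa only [Real.norm_of_nonneg (h0 _)] using hin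
  have hAB : Measurable fun ω => (A ω, B ω) := hA.prodMk hB
  refine ⟨(integrable_map_measure hΦ.aestronglyMeasurable hAB.aemeasurable).1 (hmap ▸ hprod), ?_⟩
  rw [← integral_map (f := Φ) hAB.aemeasurable hΦ.aestronglyMeasurable, hmap,
    integral_prod _ hprod, ← integral_map (f := Ψ) hA.aemeasurable hΨ.aestronglyMeasurable]
  exact integral_mono hin hΨm hsle

end Transfer

/-! ### Measurability of the iterates with respect to the past -/

section Iterates

variable {n m t : ℕ} {S : Type*} [MeasurableSpace S] {P : Measure S} {c : Constants} {θ : ℝ}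
  {F1 F2 F3 : Pt n m t → ℝ} {O : Oracle n m t S}

theorem measurable_riesz {α : Type*} [MeasurableSpace α] {d : ℕ} {g : α → Dual (Vec d)}
    (hg : StronglyMeasurable g) : Measurable fun a => riesz (g a) :=
  ((InnerProductSpace.toDual ℝ (Vec d)).symm.continuous.comp_stronglyMeasurable hg).measurable

namespace GoodOracle

variable {σ : Type*} {mσ : MeasurableSpace σ}

theorem measurable_llDir (hO : GoodOracle c P F1 F2 F3 O θ) :
    Measurable fun q : (Vec n × Vec m × Vec t) × S =>
      riesz (O.llDir (pt q.1.1 q.1.2.1 q.1.2.2) q.2) :=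
  measurable_riesz (hO.est.df3.stronglyMeasurable.clm_comp' stronglyMeasurable_const)

theorem measurable_mlDir (hO : GoodOracle c P F1 F2 F3 O θ) :
    Measurable fun q : (Vec n × Vec m × Vec t) × (Fin 3 → S) =>
      riesz (O.mlDir (pt q.1.1 q.1.2.1 q.1.2.2) q.2) := by
  have hr : ∀ r : Fin 3, Measurable fun q : (Vec n × Vec m × Vec t) × (Fin 3 → S) =>
      (q.1, q.2 r) := fun r => measurable_fst.prodMk ((measurable_pi_apply r).comp measurable_snd)
  have hG := hO.est.df2.stronglyMeasurable.comp_measurable (hr 0)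
  have hH := fun r => hO.est.ddf3.stronglyMeasurable.comp_measurable (hr r)
  exact measurable_riesz ((hG.clm_comp' stronglyMeasurable_const).sub
    (((hH 1).blk stronglyMeasurable_const).clm_apply'
      ((hH 2).invZZ.clm_apply' (hG.clm_comp' stronglyMeasurable_const))))

theorem stronglyMeasurable_fbarHess_joint (hO : GoodOracle c P F1 F2 F3 O θ) {A : Type}
    [NormedAddCommGroup A] [NormedSpace ℝ A] (a : A →L[ℝ] Pt n m t)
    {p : σ → Vec n × Vec m × Vec t} (hp : Measurable p) {s : σ → Fin 8 → S} (hs : Measurable s) :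
    StronglyMeasurable fun q => O.fbarHess a (pt (p q).1 (p q).2.1 (p q).2.2) (s q) := by
  have hr : ∀ r : Fin 8, Measurable fun q => (p q, s q r) := fun r =>
    hp.prodMk ((measurable_pi_apply r).comp hs)
  have hH := fun r => hO.est.ddf3.stronglyMeasurable.comp_measurable (hr r)
  exact (hO.est.ddf2.stronglyMeasurable.comp_measurable (hr 0)).fbarHess
    (hO.est.dddf3.stronglyMeasurable.comp_measurable (hr 1)) (hH 2) (hH 3).invZZ (hH 4).invZZ
    (hO.est.df2.stronglyMeasurable.comp_measurable (hr 5)) ((hH 6).invZZ.zJac (hH 7))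

theorem measurable_ulDir (hO : GoodOracle c P F1 F2 F3 O θ) :
    Measurable fun q : (Vec n × Vec m × Vec t) × (Fin 3 → S) × (Fin 8 → S) × (Fin 8 → S) =>
      riesz (O.ulDir (pt q.1.1 q.1.2.1 q.1.2.2) q.2.1 q.2.2.1 q.2.2.2) := by
  have hr : ∀ r : Fin 3, Measurable
      fun q : (Vec n × Vec m × Vec t) × (Fin 3 → S) × (Fin 8 → S) × (Fin 8 → S) =>
      (q.1, q.2.1 r) := fun r =>
    measurable_fst.prodMk ((measurable_pi_apply r).comp (measurable_fst.comp measurable_snd))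
  have hG := hO.est.df1.stronglyMeasurable.comp_measurable (hr 0)
  have hH := fun r => hO.est.ddf3.stronglyMeasurable.comp_measurable (hr r)
  have hl := (hH 2).invZZ.clm_apply' (hG.clm_comp' (stronglyMeasurable_const (b := inZ)))
  have hXY := hO.stronglyMeasurable_fbarHess_joint inX
    (p := fun q : (Vec n × Vec m × Vec t) × (Fin 3 → S) × (Fin 8 → S) × (Fin 8 → S) => q.1)
    measurable_fst (s := fun q => q.2.2.1) (by fun_prop)
  have hYY := hO.stronglyMeasurable_fbarHess_joint inY
    (p := fun q : (Vec n × Vec m × Vec t) × (Fin 3 → S) × (Fin 8 → S) × (Fin 8 → S) => q.1)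
    measurable_fst (s := fun q => q.2.2.2) (by fun_prop)
  exact measurable_riesz (((hG.clm_comp' stronglyMeasurable_const).sub
    (((hH 1).blk stronglyMeasurable_const).clm_apply' hl)).sub
    (hXY.clm_flip'.clm_apply' (hYY.clm_inverse.clm_apply'
      ((hG.clm_comp' stronglyMeasurable_const).sub
        (((hH 1).blk stronglyMeasurable_const).clm_apply' hl)))))

theorem measurable_llIter (hO : GoodOracle c P F1 F2 F3 O θ) {γ : ℝ} {x : σ → Vec n} {y : σ → Vec m}
    {z : σ → Vec t} {s : ℕ → σ → S} (hx : Measurable x) (hy : Measurable y) (hz : Measurable z)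
    (k : ℕ) (hs : ∀ k' < k, Measurable (s k')) :
    Measurable fun ω => llIter O γ (x ω) (y ω) (fun k => s k ω) (z ω) k := by
  induction k with
  | zero => exact hz
  | succ k ih =>
    have h := ih fun k' hk' => hs k' (by omega)
    exact h.sub ((hO.measurable_llDir.comp
      ((hx.prodMk (hy.prodMk h)).prodMk (hs k (by omega)))).const_smul γ)

theorem measurable_mlIter (hO : GoodOracle c P F1 F2 F3 O θ) {β γ : ℝ} {K : ℕ} {x : σ → Vec n}
    {y : σ → Vec m} {z : σ → Vec t} {s : ℕ → ℕ → σ → S} {s' : ℕ → Fin 3 → σ → S}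
    (hx : Measurable x) (hy : Measurable y) (hz : Measurable z) (j : ℕ)
    (hs : ∀ j' < j, ∀ k, Measurable (s j' k)) (hs' : ∀ j' < j, ∀ r, Measurable (s' j' r)) :
    Measurable fun ω => mlIter O β γ K (x ω) (fun j k => s j k ω) (fun j r => s' j r ω)
      (y ω) (z ω) j := by
  induction j with
  | zero => exact hy.prodMk hz
  | succ j ih =>
    have h := ih (fun j' hj' => hs j' (by omega)) (fun j' hj' => hs' j' (by omega))
    have hz' := hO.measurable_llIter (γ := γ) hx h.fst h.snd K fun k _ => hs j (by omega) k
    exact (h.fst.sub ((hO.measurable_mlDir.comp ((hx.prodMk (h.fst.prodMk hz')).prodMk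
      (measurable_pi_lambda _ fun r => hs' j (by omega) r))).const_smul β)).prodMk hz'

theorem measurable_tsgIter (hO : GoodOracle c P F1 F2 F3 O θ) {α β γ : ℝ} {J K : ℕ} {x₀ : Vec n}
    {y₀ : Vec m} {z₀ : Vec t} {ξ : SampleIdx → σ → S} (i : ℕ)
    (h₁ : ∀ i' < i, ∀ j k, Measurable (ξ (.ll i' j k)))
    (h₂ : ∀ i' < i, ∀ j r, Measurable (ξ (.ml i' j r)))
    (h₃ : ∀ i' < i, ∀ r, Measurable (ξ (.ulGrad i' r)))
    (h₄ : ∀ i' < i, ∀ r, Measurable (ξ (.ulXY i' r)))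
    (h₅ : ∀ i' < i, ∀ r, Measurable (ξ (.ulYY i' r))) :
    Measurable fun ω => tsgIter O α β γ J K x₀ y₀ z₀ (fun a => ξ a ω) i := by
  induction i with
  | zero => exact measurable_const
  | succ i ih =>
    have h := ih (fun i' hi => h₁ i' (by omega)) (fun i' hi => h₂ i' (by omega))
      (fun i' hi => h₃ i' (by omega)) (fun i' hi => h₄ i' (by omega))
      (fun i' hi => h₅ i' (by omega))
    have hw := hO.measurable_mlIter (β := β) (γ := γ) (K := K) h.fst h.snd.fst h.snd.snd J
      (fun j _ k => h₁ i (by omega) j k) (fun j _ r => h₂ i (by omega) j r)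
    have hz' := hO.measurable_llIter (γ := γ) h.fst hw.fst hw.snd K
      fun k _ => h₁ i (by omega) J k
    exact (h.fst.sub ((hO.measurable_ulDir.comp ((h.fst.prodMk (hw.fst.prodMk hz')).prodMk
      ((measurable_pi_lambda _ fun r => h₃ i (by omega) r).prodMk
        ((measurable_pi_lambda _ fun r => h₄ i (by omega) r).prodMk
          (measurable_pi_lambda _ fun r => h₅ i (by omega) r))))).const_smul α)).prodMk
      (hw.fst.prodMk hz')

end GoodOracle

/-- The labels of the samples drawn before the lower-level step `k` of the middle-level step `j` of
iteration `i`; the concluding lower-level steps of iteration `i` count as `j = J`. -/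
def before (i j k : ℕ) : Set SampleIdx
  | .ll i' j' k' => i' < i ∨ i' = i ∧ (j' < j ∨ j' = j ∧ k' < k)
  | .ml i' j' _ => i' < i ∨ i' = i ∧ j' < j
  | .ulGrad i' _ => i' < i
  | .ulXY i' _ => i' < i
  | .ulYY i' _ => i' < i

theorem mem_before_ll {i j k i' j' k' : ℕ} : SampleIdx.ll i' j' k' ∈ before i j k ↔
    i' < i ∨ i' = i ∧ (j' < j ∨ j' = j ∧ k' < k) := Iff.rfl

theorem mem_before_ml {i j k i' j' : ℕ} {r : Fin 3} : SampleIdx.ml i' j' r ∈ before i j k ↔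
    i' < i ∨ i' = i ∧ j' < j := Iff.rfl

theorem mem_before_ulGrad {i j k i' : ℕ} {r : Fin 3} :
    SampleIdx.ulGrad i' r ∈ before i j k ↔ i' < i := Iff.rfl

theorem mem_before_ulXY {i j k i' : ℕ} {r : Fin 8} :
    SampleIdx.ulXY i' r ∈ before i j k ↔ i' < i := Iff.rfl

theorem mem_before_ulYY {i j k i' : ℕ} {r : Fin 8} :
    SampleIdx.ulYY i' r ∈ before i j k ↔ i' < i := Iff.rfl

theorem before_subset {i j k j' k' : ℕ} (h : j < j' ∨ j = j' ∧ k ≤ k') :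
    before i j k ⊆ before i j' k' := by
  rintro (⟨a, b, d⟩ | ⟨a, b, r⟩ | ⟨a, r⟩ | ⟨a, r⟩ | ⟨a, r⟩) <;>
    simp only [mem_before_ll, mem_before_ml, mem_before_ulGrad, mem_before_ulXY,
      mem_before_ulYY] <;> omega

theorem before_zero_zero_subset {i j k : ℕ} : before i 0 0 ⊆ before i j k :=
  before_subset (by omega)

end Iterates

/-! ### The lower-level and the middle-level loop -/

section Errors

variable {n m t : ℕ} {c : Constants} {M : ℝ} {F1 F2 F3 : Pt n m t → ℝ}

/-- The squared lower-level error `‖z - z(x, y)‖²` of a state `(x, y, z)`. -/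
def llErr (F3 : Pt n m t → ℝ) (q : Vec n × Vec m × Vec t) : ℝ := ‖q.2.2 - zSol F3 q.1 q.2.1‖ ^ 2

/-- The squared middle-level error `‖y - y(x)‖²` of a state `(x, y, z)`. -/
def mlErr (F2 F3 : Pt n m t → ℝ) (q : Vec n × Vec m × Vec t) : ℝ := ‖q.2.1 - ySol F2 F3 q.1‖ ^ 2

theorem llErr_nonneg (q : Vec n × Vec m × Vec t) : 0 ≤ llErr F3 q := sq_nonneg _

theorem mlErr_nonneg (q : Vec n × Vec m × Vec t) : 0 ≤ mlErr F2 F3 q := sq_nonneg _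

theorem Regular.measurable_llErr (h : Regular c M F1 F2 F3) : Measurable (llErr F3) := by
  have h1 := h.continuous_zSol.comp (continuous_fst.prodMk (continuous_fst.comp continuous_snd) :
    Continuous fun q : Vec n × Vec m × Vec t => (q.1, q.2.1))
  exact (((continuous_snd.comp continuous_snd).sub h1).norm.pow 2).measurable

theorem Regular.measurable_mlErr (h : Regular c M F1 F2 F3) : Measurable (mlErr F2 F3) :=
  (((continuous_fst.comp continuous_snd).sub
    (h.continuous_ySol.comp continuous_fst)).norm.pow 2).measurable

end Errors

section Loops

variable {Ω : Type*} [MeasurableSpace Ω] {μ : Measure Ω} [IsProbabilityMeasure μ]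
variable {S : Type*} [MeasurableSpace S] {P : Measure S} {n m t : ℕ} {c : Constants} {M θ : ℝ}
  {F1 F2 F3 : Pt n m t → ℝ} {O : Oracle n m t S} {ξ : SampleIdx → Ω → S}

theorem integral_affine {f g : Ω → ℝ} (hf : Integrable f μ) (hg : Integrable g μ) (a b e : ℝ) :
    ∫ ω, (a * f ω + b * g ω + e) ∂μ = a * ∫ ω, f ω ∂μ + b * ∫ ω, g ω ∂μ + e := by
  have h : Integrable (fun ω => a * f ω + b * g ω) μ := (hf.const_mul a).add (hg.const_mul b)
  rw [integral_add h (integrable_const e),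
    integral_add (hf.const_mul a) (hg.const_mul b), integral_const_mul, integral_const_mul]
  simp

/-- A loop of lower-level steps contracts the lower-level error, up to noise. -/
theorem Directions.ll_loop (h : Problem c F1 F2 F3) (hD : Directions c M θ F1 F2 F3 O μ ξ)
    (hO : GoodOracle c P F1 F2 F3 O θ) (hξ : Sampling μ P ξ) {γ : ℝ} (hγ : 0 ≤ γ)
    (hγR : γ * c.R ^ 2 ≤ c.μz) (hγ1 : c.μz * γ ≤ 1) {i j : ℕ} {x : Ω → Vec n} {y : Ω → Vec m}
    {z : Ω → Vec t} (hx : Measurable[past ξ (before i j 0)] x)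
    (hy : Measurable[past ξ (before i j 0)] y) (hz : Measurable[past ξ (before i j 0)] z)
    (hi : Integrable (fun ω => llErr F3 (x ω, y ω, z ω)) μ) (k : ℕ) :
    Integrable (fun ω => llErr F3 (x ω, y ω,
      llIter O γ (x ω) (y ω) (fun k => ξ (.ll i j k) ω) (z ω) k)) μ ∧
    ∫ ω, llErr F3 (x ω, y ω, llIter O γ (x ω) (y ω) (fun k => ξ (.ll i j k) ω) (z ω) k) ∂μ
      ≤ (1 - c.μz * γ) ^ k * ∫ ω, llErr F3 (x ω, y ω, z ω) ∂μ + γ * (M / c.μz) := by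
  have hμ := c.μz_pos
  have hM := hD.regular.one_le
  induction k with
  | zero =>
    refine ⟨hi, ?_⟩
    have : 0 ≤ γ * (M / c.μz) := by positivity
    simpa [llIter] using this
  | succ k ih =>
    obtain ⟨ih1, ih2⟩ := ih
    have hs : before i j 0 ⊆ before i j k := before_subset (by omega)
    have hx' : Measurable[past ξ (before i j k)] x := hx.mono (past_mono hs) le_rfl
    have hy' : Measurable[past ξ (before i j k)] y := hy.mono (past_mono hs) le_rfl
    have hz' : Measurable[past ξ (before i j k)] z := hz.mono (past_mono hs) le_rfl
    have hZ : Measurable[past ξ (before i j k)] fun ω =>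
        llIter O γ (x ω) (y ω) (fun k => ξ (.ll i j k) ω) (z ω) k :=
      hO.measurable_llIter hx' hy' hz' k fun k' hk' =>
        measurable_past (mem_before_ll.2 (by omega))
    have hA := hx'.prodMk (hy'.prodMk hZ)
    have hB : Measurable[past ξ {SampleIdx.ll i j k}] (ξ (.ll i j k)) :=
      measurable_past (Set.mem_singleton _)
    have hd : Disjoint (before i j k) {SampleIdx.ll i j k} := by
      rw [Set.disjoint_singleton_right, mem_before_ll]; omega
    have hzz : Measurable fun q : (Vec n × Vec m × Vec t) × S => (q.1.1, q.1.2.1,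
        q.1.2.2 - γ • riesz (O.llDir (pt q.1.1 q.1.2.1 q.1.2.2) q.2)) :=
      measurable_fst.fst.prodMk (measurable_fst.snd.fst.prodMk
        (measurable_fst.snd.snd.sub (hO.measurable_llDir.const_smul γ)))
    obtain ⟨h1, h2⟩ := integral_le_of_indepFun (μ := μ)
      (hA.mono (past_le hξ.measurable _) le_rfl)
      (hξ.measurable _) (indepFun_of_past hξ.measurable hξ.indep hd hA hB)
      (Φ := fun q => llErr F3 (q.1.1, q.1.2.1,
        q.1.2.2 - γ • riesz (O.llDir (pt q.1.1 q.1.2.1 q.1.2.2) q.2)))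
      (hD.regular.measurable_llErr.comp hzz) (fun _ => llErr_nonneg _)
      (Ψ := fun q => (1 - c.μz * γ) * llErr F3 q + γ ^ 2 * M)
      ((hD.regular.measurable_llErr.const_mul _).add_const _)
      ((ih1.const_mul _).add (integrable_const _))
      fun q => hD.ll_step h hγ hγR q.1 q.2.1 q.2.2 i j k
    refine ⟨h1, h2.trans ?_⟩
    rw [integral_add (ih1.const_mul _) (integrable_const _), integral_const_mul]
    have h3 := mul_le_mul_of_nonneg_left ih2 (by linarith : 0 ≤ 1 - c.μz * γ)
    have h4 : (1 - c.μz * γ) * (γ * (M / c.μz)) + γ ^ 2 * M = γ * (M / c.μz) := by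
      field_simp
      ring
    simp only [integral_const, probReal_univ, one_smul]
    rw [pow_succ' (1 - c.μz * γ)]
    linarith

/-- The conditions on the step sizes and on the numbers of inner steps under which one iteration
decreases the Lyapunov function. -/
structure Tuned (c : Constants) (M θ α β γ : ℝ) (J K : ℕ) : Prop where
  θ_nonneg : 0 ≤ θ
  θ_le_β : θ ≤ β
  θ_le_α : θ ≤ α
  α_le_one : α ≤ 1
  β_le_one : β ≤ 1
  γ_nonneg : 0 ≤ γ
  γ_small : γ * c.R ^ 2 ≤ c.μz
  γ_small' : c.μz * γ ≤ 1
  β_small : 16 * M ^ 4 * β ≤ c.μy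
  β_small' : c.μy / 4 * β ≤ 1
  γ_le : γ ≤ β ^ 2
  γ_le' : γ ≤ α ^ 2
  β_sq : J * β ^ 2 ≤ α ^ 2
  /-- The lower-level loop contracts more than the middle-level steps expand. -/
  ml_contract : mlConst c M * (1 - c.μz * γ) ^ K ≤ 1 - c.μy / 4 * β
  /-- The lower-level loop contracts more than the upper-level step expands. -/
  ul_contract : (2 + ulConst M) * (1 - c.μz * γ) ^ K ≤ 1
  /-- The middle-level loop contracts more than the upper-level step expands. -/
  decay : (1 + ulConst M * α) * (1 - c.μy / 4 * β) ^ J ≤ 1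

theorem mlConst_nonneg (hM : 1 ≤ M) : 0 ≤ mlConst c M := by
  have := c.μy_pos
  rw [mlConst]
  positivity

theorem ulConst_nonneg (hM : 1 ≤ M) : 0 ≤ ulConst M := by
  rw [ulConst]
  positivity

/-- The noise constant of the middle-level loop. -/
def loopConst (c : Constants) (M : ℝ) : ℝ := mlConst c M * (M / c.μz + 1)

theorem loopConst_nonneg (hM : 1 ≤ M) : 0 ≤ loopConst c M := by
  have := mlConst_nonneg (c := c) hM
  have := c.μz_pos
  rw [loopConst]
  positivity

/-- The middle-level loop contracts the sum of the middle-level and the lower-level error, up to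
noise. -/
theorem Directions.ml_loop (h : Problem c F1 F2 F3) (hD : Directions c M θ F1 F2 F3 O μ ξ)
    (hO : GoodOracle c P F1 F2 F3 O θ) (hξ : Sampling μ P ξ) {α β γ : ℝ} {J K : ℕ}
    (hT : Tuned c M θ α β γ J K) {i : ℕ} {x : Ω → Vec n} {y : Ω → Vec m}
    {z : Ω → Vec t} (hx : Measurable[past ξ (before i 0 0)] x)
    (hy : Measurable[past ξ (before i 0 0)] y) (hz : Measurable[past ξ (before i 0 0)] z)
    (hiy : Integrable (fun ω => mlErr F2 F3 (x ω, y ω, z ω)) μ)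
    (hiz : Integrable (fun ω => llErr F3 (x ω, y ω, z ω)) μ) {w : ℕ → Ω → Vec m × Vec t}
    (hw : ∀ j ω, w j ω = mlIter O β γ K (x ω) (fun j k => ξ (.ll i j k) ω)
      (fun j r => ξ (.ml i j r) ω) (y ω) (z ω) j) (j : ℕ) :
    Integrable (fun ω => mlErr F2 F3 (x ω, w j ω)) μ ∧
    Integrable (fun ω => llErr F3 (x ω, w j ω)) μ ∧
    ∫ ω, mlErr F2 F3 (x ω, w j ω) ∂μ + ∫ ω, llErr F3 (x ω, w j ω) ∂μ
      ≤ (1 - c.μy / 4 * β) ^ j * (∫ ω, mlErr F2 F3 (x ω, y ω, z ω) ∂μ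
        + ∫ ω, llErr F3 (x ω, y ω, z ω) ∂μ) + loopConst c M * j * β ^ 2 := by
  have hμ := c.μz_pos
  have hμy := c.μy_pos
  have hM := hD.regular.one_le
  have hCm := mlConst_nonneg (c := c) hM
  have hβ : 0 ≤ β := hT.θ_nonneg.trans hT.θ_le_β
  obtain rfl : w = fun j ω => mlIter O β γ K (x ω) (fun j k => ξ (.ll i j k) ω)
      (fun j r => ξ (.ml i j r) ω) (y ω) (z ω) j := funext fun j => funext fun ω => hw j ω
  clear hw
  induction j with
  | zero =>
    refine ⟨hiy, hiz, ?_⟩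
    simp [mlIter]
  | succ j ih =>
    obtain ⟨ih1, ih2, ih3⟩ := ih
    set w := fun ω => mlIter O β γ K (x ω) (fun j k => ξ (.ll i j k) ω)
      (fun j r => ξ (.ml i j r) ω) (y ω) (z ω) j with hw
    have hs : before i 0 0 ⊆ before i j 0 := before_zero_zero_subset
    have hx' : Measurable[past ξ (before i j 0)] x := hx.mono (past_mono hs) le_rfl
    have hy' : Measurable[past ξ (before i j 0)] y := hy.mono (past_mono hs) le_rfl
    have hz' : Measurable[past ξ (before i j 0)] z := hz.mono (past_mono hs) le_rfl
    have hwm : Measurable[past ξ (before i j 0)] w :=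
      hO.measurable_mlIter hx' hy' hz' j
        (fun j' hj' k => measurable_past (mem_before_ll.2 (by omega)))
        (fun j' hj' r => measurable_past (mem_before_ml.2 (by omega)))
    obtain ⟨l1, l2⟩ := hD.ll_loop h hO hξ hT.γ_nonneg hT.γ_small hT.γ_small' hx' hwm.fst hwm.snd
      ih2 K
    have hs' : before i j 0 ⊆ before i j K := before_subset (by omega)
    have hx'' : Measurable[past ξ (before i j K)] x := hx'.mono (past_mono hs') le_rfl
    have hwm' : Measurable[past ξ (before i j K)] w := hwm.mono (past_mono hs') le_rfl
    set Z := fun ω => llIter O γ (x ω) (w ω).1 (fun k => ξ (.ll i j k) ω) (w ω).2 K with hZdef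
    have hZ : Measurable[past ξ (before i j K)] Z :=
      hO.measurable_llIter hx'' hwm'.fst hwm'.snd K fun k hk =>
        measurable_past (mem_before_ll.2 (by omega))
    have hA := hx''.prodMk (hwm'.fst.prodMk hZ)
    set T : Set SampleIdx := Set.range fun r => SampleIdx.ml i j r
    have hB : Measurable[past ξ T] fun ω r => ξ (.ml i j r) ω :=
      @measurable_pi_lambda _ _ _ (past ξ T) _ _ fun r => measurable_past ⟨r, rfl⟩
    have hd : Disjoint (before i j K) T := by
      rw [Set.disjoint_right]
      rintro _ ⟨r, rfl⟩
      rw [mem_before_ml]; omega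
    have hyy : Measurable fun q : (Vec n × Vec m × Vec t) × (Fin 3 → S) => (q.1.1,
        q.1.2.1 - β • riesz (O.mlDir (pt q.1.1 q.1.2.1 q.1.2.2) q.2), q.1.2.2) :=
      measurable_fst.fst.prodMk ((measurable_fst.snd.fst.sub
        (hO.measurable_mlDir.const_smul β)).prodMk measurable_fst.snd.snd)
    obtain ⟨h1, h2⟩ := integral_le_of_indepFun (μ := μ)
      (hA.mono (past_le hξ.measurable _) le_rfl)
      (hB.mono (past_le hξ.measurable _) le_rfl)
      (indepFun_of_past hξ.measurable hξ.indep hd hA hB)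
      (Φ := fun q => mlErr F2 F3 (q.1.1,
        q.1.2.1 - β • riesz (O.mlDir (pt q.1.1 q.1.2.1 q.1.2.2) q.2), q.1.2.2)
        + llErr F3 (q.1.1,
        q.1.2.1 - β • riesz (O.mlDir (pt q.1.1 q.1.2.1 q.1.2.2) q.2), q.1.2.2))
      ((hD.regular.measurable_mlErr.comp hyy).add (hD.regular.measurable_llErr.comp hyy))
      (fun _ => add_nonneg (mlErr_nonneg _) (llErr_nonneg _))
      (Ψ := fun q => (1 - c.μy / 4 * β) * mlErr F2 F3 q + mlConst c M * llErr F3 q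
        + mlConst c M * β ^ 2)
      (((hD.regular.measurable_mlErr.const_mul _).add
        (hD.regular.measurable_llErr.const_mul _)).add_const _)
      (((ih1.const_mul _).add (l1.const_mul _)).add (integrable_const _))
      fun q => hD.ml_step h hT.θ_nonneg hT.θ_le_β hT.β_le_one hT.β_small q.1 q.2.1 q.2.2 i j
    have hm := hyy.comp ((hA.mono (past_le hξ.measurable _) le_rfl).prodMk
      (hB.mono (past_le hξ.measurable _) le_rfl))
    have k1 := integrable_of_le h1
      (hD.regular.measurable_mlErr.comp hm).aestronglyMeasurable (fun _ => mlErr_nonneg _)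
      (fun _ => le_add_of_nonneg_right (llErr_nonneg _))
    have k2 := integrable_of_le h1
      (hD.regular.measurable_llErr.comp hm).aestronglyMeasurable (fun _ => llErr_nonneg _)
      (fun _ => le_add_of_nonneg_left (mlErr_nonneg _))
    refine ⟨k1, k2, ?_⟩
    refine (integral_add k1 k2).symm.le.trans (h2.trans ?_)
    refine (integral_affine ih1 l1 _ _ _).le.trans ?_
    replace ih3 : ∫ ω, mlErr F2 F3 (x ω, w ω) ∂μ + ∫ ω, llErr F3 (x ω, w ω) ∂μ
      ≤ (1 - c.μy / 4 * β) ^ j * (∫ ω, mlErr F2 F3 (x ω, y ω, z ω) ∂μ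
        + ∫ ω, llErr F3 (x ω, y ω, z ω) ∂μ) + loopConst c M * j * β ^ 2 := ih3
    replace l2 : ∫ ω, llErr F3 (x ω, (w ω).1, Z ω) ∂μ
      ≤ (1 - c.μz * γ) ^ K * ∫ ω, llErr F3 (x ω, w ω) ∂μ + γ * (M / c.μz) := l2
    change (1 - c.μy / 4 * β) * ∫ ω, mlErr F2 F3 (x ω, w ω) ∂μ
      + mlConst c M * ∫ ω, llErr F3 (x ω, (w ω).1, Z ω) ∂μ + mlConst c M * β ^ 2 ≤ _
    have e1 : 0 ≤ ∫ ω, llErr F3 (x ω, w ω) ∂μ := integral_nonneg fun _ => llErr_nonneg _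
    have e2 := mul_le_mul_of_nonneg_left l2 hCm
    have e3 := mul_le_mul_of_nonneg_right hT.ml_contract e1
    have e4 : γ * (M / c.μz) ≤ β ^ 2 * (M / c.μz) :=
      mul_le_mul_of_nonneg_right hT.γ_le (by positivity)
    have e5 := mul_le_mul_of_nonneg_left e4 hCm
    have hq : 0 ≤ 1 - c.μy / 4 * β := by linarith [hT.β_small']
    have hq1 : 1 - c.μy / 4 * β ≤ 1 := by
      have : 0 ≤ c.μy / 4 * β := by positivity
      linarith
    have e6 := mul_le_mul_of_nonneg_left ih3 hq
    have e7 : 0 ≤ loopConst c M * j * β ^ 2 := by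
      have := loopConst_nonneg (c := c) hM
      positivity
    have e8 := mul_le_mul_of_nonneg_right hq1 e7
    have e9 : loopConst c M * β ^ 2
        = mlConst c M * (β ^ 2 * (M / c.μz)) + mlConst c M * β ^ 2 := by
      rw [loopConst]; ring
    push_cast
    rw [pow_succ' (1 - c.μy / 4 * β)]
    linarith

end Loops

/-! ### The Lyapunov function along the iterates -/

section Outer

variable {Ω : Type*} [MeasurableSpace Ω] {μ : Measure Ω} [IsProbabilityMeasure μ]
variable {S : Type*} [MeasurableSpace S] {P : Measure S} {n m t : ℕ} {c : Constants} {M θ : ℝ}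
  {F1 F2 F3 : Pt n m t → ℝ} {O : Oracle n m t S} {ξ : SampleIdx → Ω → S}

/-- The Lyapunov function `f(x) - f_min + ‖y - y(x)‖² + ‖z - z(x, y)‖²` of a state `(x, y, z)`. -/
def lyapunov (F1 F2 F3 : Pt n m t → ℝ) (fmin : ℝ) (q : Vec n × Vec m × Vec t) : ℝ :=
  upper F1 F2 F3 q.1 - fmin + mlErr F2 F3 q + llErr F3 q

/-- `‖∇f(x)‖²` for the exact gradient of `f`. -/
def gradSq (F1 F2 F3 : Pt n m t → ℝ) (x : Vec n) : ℝ :=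
  ‖exUpper F1 F2 F3 (ulPt F2 F3 x)‖ ^ 2

theorem Regular.continuous_exUpper (h : Regular c M F1 F2 F3) :
    Continuous fun x => exUpper F1 F2 F3 (ulPt F2 F3 x) :=
  (LipschitzWith.of_dist_le_mul (K := ⟨M, zero_le_one.trans h.one_le⟩) fun x x' => by
    rw [dist_eq_norm, dist_eq_norm]; exact h.upper_lip x x').continuous

theorem Problem.continuous_upper (h : Problem c F1 F2 F3) : Continuous (upper F1 F2 F3) :=
  continuous_iff_continuousAt.2 fun x => (h.hasFDerivAt_upper x).continuousAt

theorem integrable_gradSq (hR : Regular c M F1 F2 F3) {X : Ω → Vec n} (hX : Measurable X) :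
    Integrable (fun ω => gradSq F1 F2 F3 (X ω)) μ :=
  integrable_of_le (integrable_const (M ^ 2))
    ((hR.continuous_exUpper.norm.pow 2).measurable.comp hX).aestronglyMeasurable
    (fun _ => sq_nonneg _) fun _ => pow_le_pow_left₀ (norm_nonneg _) (hR.upper_le _) 2

/-- The noise constant of one iteration. -/
def iterConst (c : Constants) (M : ℝ) : ℝ :=
  (1 + ulConst M) * loopConst c M + (2 + ulConst M) * (M / c.μz) + ulConst M

theorem iterConst_nonneg (hM : 1 ≤ M) : 0 ≤ iterConst c M := by
  have := loopConst_nonneg (c := c) hM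
  have := ulConst_nonneg hM
  have := c.μz_pos
  rw [iterConst]
  positivity

/-- The bounds of the inner loops and of the upper-level step combine to a decrease of the Lyapunov
function: `V` is the sum of the errors before the iteration, `a`, `b` are the errors after the
middle-level loop, `b'` is the lower-level error after the concluding lower-level loop. -/
theorem Tuned.combine {α β γ : ℝ} {J K : ℕ} (hT : Tuned c M θ α β γ J K) (hM : 1 ≤ M)
    {V a b b' : ℝ} (hV : 0 ≤ V) (hb0 : 0 ≤ b)
    (hab : a + b ≤ (1 - c.μy / 4 * β) ^ J * V + loopConst c M * J * β ^ 2)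
    (hb' : b' ≤ (1 - c.μz * γ) ^ K * b + γ * (M / c.μz)) :
    (1 + ulConst M * α) * a + (2 + ulConst M) * b' + ulConst M * α ^ 2
      ≤ V + iterConst c M * α ^ 2 := by
  have hC := ulConst_nonneg hM
  have hL := loopConst_nonneg (c := c) hM
  have hμ := c.μz_pos
  have hα : 0 ≤ α := hT.θ_nonneg.trans hT.θ_le_α
  have hCα : 0 ≤ ulConst M * α := mul_nonneg hC hα
  have hCα1 : ulConst M * α ≤ ulConst M := mul_le_of_le_one_right hC hT.α_le_one
  have h1 := mul_le_mul_of_nonneg_left hb' (by linarith : 0 ≤ 2 + ulConst M)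
  have h2 := mul_le_mul_of_nonneg_right hT.ul_contract hb0
  have h3 := mul_le_mul_of_nonneg_right hT.γ_le' (by positivity : 0 ≤ M / c.μz)
  have h4 := mul_le_mul_of_nonneg_left h3 (by linarith : 0 ≤ 2 + ulConst M)
  have h5 := mul_le_mul_of_nonneg_left hab (by linarith : 0 ≤ 1 + ulConst M * α)
  have h6 := mul_le_mul_of_nonneg_right hT.decay hV
  have h7 : loopConst c M * J * β ^ 2 ≤ loopConst c M * α ^ 2 := by
    have := mul_le_mul_of_nonneg_left hT.β_sq hL
    linarith
  have h8 : (1 + ulConst M * α) * (loopConst c M * J * β ^ 2)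
      ≤ (1 + ulConst M) * (loopConst c M * α ^ 2) :=
    mul_le_mul (by linarith) h7 (by positivity) (by linarith)
  have h9 : b ≤ (1 + ulConst M * α) * b := le_mul_of_one_le_left hb0 (by linarith)
  rw [iterConst]
  linarith

/-- One iteration decreases the mean of the Lyapunov function by a multiple of `E ‖∇f‖²`, up to
`O(α²)`. -/
theorem Directions.iterate (h : Problem c F1 F2 F3) (hD : Directions c M θ F1 F2 F3 O μ ξ)
    (hO : GoodOracle c P F1 F2 F3 O θ) (hξ : Sampling μ P ξ) {fmin : ℝ}
    (hmin : ∀ x, fmin ≤ upper F1 F2 F3 x) {α β γ : ℝ} {J K : ℕ}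
    (hT : Tuned c M θ α β γ J K) {x₀ : Vec n} {y₀ : Vec m} {z₀ : Vec t}
    {s : ℕ → Ω → Vec n × Vec m × Vec t}
    (hs : ∀ i ω, s i ω = tsgIter O α β γ J K x₀ y₀ z₀ (fun a => ξ a ω) i) {i : ℕ}
    (hi : Integrable (fun ω => lyapunov F1 F2 F3 fmin (s i ω)) μ) :
    Integrable (fun ω => lyapunov F1 F2 F3 fmin (s (i + 1) ω)) μ ∧
    ∫ ω, lyapunov F1 F2 F3 fmin (s (i + 1) ω) ∂μ + α / 2 * ∫ ω, gradSq F1 F2 F3 (s i ω).1 ∂μ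
      ≤ ∫ ω, lyapunov F1 F2 F3 fmin (s i ω) ∂μ + iterConst c M * α ^ 2 := by
  have hR := hD.regular
  have hM := hR.one_le
  have hup := h.continuous_upper
  have hsm : Measurable[past ξ (before i 0 0)] (s i) := by
    rw [show s i = fun ω => tsgIter O α β γ J K x₀ y₀ z₀ (fun a => ξ a ω) i from
      funext fun ω => hs i ω]
    refine hO.measurable_tsgIter i ?_ ?_ ?_ ?_ ?_ <;> intros <;> refine measurable_past ?_
    · exact mem_before_ll.2 (by omega)
    · exact mem_before_ml.2 (by omega)
    · exact mem_before_ulGrad.2 (by omega)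
    · exact mem_before_ulXY.2 (by omega)
    · exact mem_before_ulYY.2 (by omega)
  have hsm' : Measurable (s i) := hsm.mono (past_le hξ.measurable _) le_rfl
  -- the three nonnegative parts of the Lyapunov function are integrable
  have hF0 : ∀ x, 0 ≤ upper F1 F2 F3 x - fmin := fun x => by linarith [hmin x]
  have hiF : Integrable (fun ω => upper F1 F2 F3 (s i ω).1 - fmin) μ := by
    refine integrable_of_le hi ((hup.measurable.comp hsm'.fst).sub_const _).aestronglyMeasurable
      (fun _ => hF0 _) fun ω => ?_
    have h1 := mlErr_nonneg (F2 := F2) (F3 := F3) (s i ω)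
    have h2 := llErr_nonneg (F3 := F3) (s i ω)
    rw [lyapunov]; linarith
  have hiy : Integrable (fun ω => mlErr F2 F3 (s i ω)) μ := by
    refine integrable_of_le hi (hR.measurable_mlErr.comp hsm').aestronglyMeasurable
      (fun _ => mlErr_nonneg _) fun ω => ?_
    have h1 := hF0 (s i ω).1
    have h2 := llErr_nonneg (F3 := F3) (s i ω)
    rw [lyapunov]; linarith
  have hiz : Integrable (fun ω => llErr F3 (s i ω)) μ := by
    refine integrable_of_le hi (hR.measurable_llErr.comp hsm').aestronglyMeasurable
      (fun _ => llErr_nonneg _) fun ω => ?_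
    have h1 := hF0 (s i ω).1
    have h2 := mlErr_nonneg (F2 := F2) (F3 := F3) (s i ω)
    rw [lyapunov]; linarith
  have hsum : ∫ ω, lyapunov F1 F2 F3 fmin (s i ω) ∂μ = ∫ ω, (upper F1 F2 F3 (s i ω).1 - fmin) ∂μ
      + (∫ ω, mlErr F2 F3 (s i ω) ∂μ + ∫ ω, llErr F3 (s i ω) ∂μ) := by
    have e1 : Integrable (fun ω => upper F1 F2 F3 (s i ω).1 - fmin + mlErr F2 F3 (s i ω)) μ :=
      hiF.add hiy
    simp only [lyapunov]
    rw [integral_add e1 hiz, integral_add hiF hiy, add_assoc]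
  -- the middle-level loop
  set w := fun ω => mlIter O β γ K (s i ω).1 (fun j k => ξ (.ll i j k) ω)
    (fun j r => ξ (.ml i j r) ω) (s i ω).2.1 (s i ω).2.2 J with hw
  obtain ⟨m1, m2, m3⟩ := hD.ml_loop h hO hξ hT hsm.fst hsm.snd.fst hsm.snd.snd hiy hiz
    (fun _ _ => rfl) J
  replace m3 : ∫ ω, mlErr F2 F3 ((s i ω).1, w ω) ∂μ + ∫ ω, llErr F3 ((s i ω).1, w ω) ∂μ
      ≤ (1 - c.μy / 4 * β) ^ J * (∫ ω, mlErr F2 F3 (s i ω) ∂μ + ∫ ω, llErr F3 (s i ω) ∂μ)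
        + loopConst c M * J * β ^ 2 := m3
  have hsJ : Measurable[past ξ (before i J 0)] (s i) :=
    hsm.mono (past_mono before_zero_zero_subset) le_rfl
  have hwm : Measurable[past ξ (before i J 0)] w :=
    hO.measurable_mlIter hsJ.fst hsJ.snd.fst hsJ.snd.snd J
      (fun j' hj' k => measurable_past (mem_before_ll.2 (by omega)))
      (fun j' hj' r => measurable_past (mem_before_ml.2 (by omega)))
  -- the concluding lower-level loop
  obtain ⟨l1, l2⟩ := hD.ll_loop h hO hξ hT.γ_nonneg hT.γ_small hT.γ_small' hsJ.fst hwm.fst hwm.snd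
    m2 K
  have hs' : before i J 0 ⊆ before i J K := before_subset (by omega)
  have hsK : Measurable[past ξ (before i J K)] (s i) := hsJ.mono (past_mono hs') le_rfl
  have hwm' : Measurable[past ξ (before i J K)] w := hwm.mono (past_mono hs') le_rfl
  set Z := fun ω => llIter O γ (s i ω).1 (w ω).1 (fun k => ξ (.ll i J k) ω) (w ω).2 K with hZdef
  have hZ : Measurable[past ξ (before i J K)] Z :=
    hO.measurable_llIter hsK.fst hwm'.fst hwm'.snd K fun k hk =>
      measurable_past (mem_before_ll.2 (by omega))
  replace l2 : ∫ ω, llErr F3 ((s i ω).1, (w ω).1, Z ω) ∂μ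
      ≤ (1 - c.μz * γ) ^ K * ∫ ω, llErr F3 ((s i ω).1, w ω) ∂μ + γ * (M / c.μz) := l2
  replace l1 : Integrable (fun ω => llErr F3 ((s i ω).1, (w ω).1, Z ω)) μ := l1
  replace m1 : Integrable (fun ω => mlErr F2 F3 ((s i ω).1, (w ω).1, Z ω)) μ := m1
  -- the upper-level step
  have hA := hsK.fst.prodMk (hwm'.fst.prodMk hZ)
  set T : Set SampleIdx := Set.range (SampleIdx.ulGrad i) ∪ Set.range (SampleIdx.ulXY i)
    ∪ Set.range (SampleIdx.ulYY i) with hTdef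
  have hB : Measurable[past ξ T] fun ω => ((fun r => ξ (.ulGrad i r) ω),
      (fun r => ξ (.ulXY i r) ω), (fun r => ξ (.ulYY i r) ω)) :=
    Measurable.prodMk
      (@measurable_pi_lambda _ _ _ (past ξ T) _ _ fun r => measurable_past (by simp [hTdef]))
      (Measurable.prodMk
        (@measurable_pi_lambda _ _ _ (past ξ T) _ _ fun r => measurable_past (by simp [hTdef]))
        (@measurable_pi_lambda _ _ _ (past ξ T) _ _ fun r => measurable_past (by simp [hTdef])))
  have hd : Disjoint (before i J K) T := by
    rw [Set.disjoint_right]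
    rintro _ ((⟨r, rfl⟩ | ⟨r, rfl⟩) | ⟨r, rfl⟩) <;>
      simp [mem_before_ulGrad, mem_before_ulXY, mem_before_ulYY]
  have hxx : Measurable fun q : (Vec n × Vec m × Vec t) × (Fin 3 → S) × (Fin 8 → S) × (Fin 8 → S) =>
      (q.1.1 - α • riesz (O.ulDir (pt q.1.1 q.1.2.1 q.1.2.2) q.2.1 q.2.2.1 q.2.2.2),
        q.1.2.1, q.1.2.2) :=
    (measurable_fst.fst.sub (hO.measurable_ulDir.const_smul α)).prodMk
      (measurable_fst.snd.fst.prodMk measurable_fst.snd.snd)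
  have hly : Measurable (lyapunov F1 F2 F3 fmin) :=
    (((hup.measurable.comp measurable_fst).sub_const fmin).add hR.measurable_mlErr).add
      hR.measurable_llErr
  have hgm : Measurable fun q : Vec n × Vec m × Vec t => gradSq F1 F2 F3 q.1 :=
    (hR.continuous_exUpper.norm.pow 2).measurable.comp measurable_fst
  have hig : Integrable (fun ω => gradSq F1 F2 F3 (s i ω).1) μ := integrable_gradSq hR hsm'.fst
  have hFg : Integrable (fun ω => upper F1 F2 F3 (s i ω).1 - fmin
      - α / 2 * gradSq F1 F2 F3 (s i ω).1) μ := hiF.sub (hig.const_mul _)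
  have hFgm : Integrable (fun ω => upper F1 F2 F3 (s i ω).1 - fmin
      - α / 2 * gradSq F1 F2 F3 (s i ω).1
      + (1 + ulConst M * α) * mlErr F2 F3 ((s i ω).1, (w ω).1, Z ω)) μ :=
    hFg.add (m1.const_mul (1 + ulConst M * α))
  have hFgl : Integrable (fun ω => upper F1 F2 F3 (s i ω).1 - fmin
      - α / 2 * gradSq F1 F2 F3 (s i ω).1
      + (1 + ulConst M * α) * mlErr F2 F3 ((s i ω).1, (w ω).1, Z ω)
      + (2 + ulConst M) * llErr F3 ((s i ω).1, (w ω).1, Z ω)) μ := hFgm.add (l1.const_mul _)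
  obtain ⟨h1, h2⟩ := integral_le_of_indepFun (μ := μ)
    (hA.mono (past_le hξ.measurable _) le_rfl)
    (hB.mono (past_le hξ.measurable _) le_rfl)
    (indepFun_of_past hξ.measurable hξ.indep hd hA hB)
    (Φ := fun q => lyapunov F1 F2 F3 fmin
      (q.1.1 - α • riesz (O.ulDir (pt q.1.1 q.1.2.1 q.1.2.2) q.2.1 q.2.2.1 q.2.2.2),
        q.1.2.1, q.1.2.2))
    (hly.comp hxx)
    (fun _ => add_nonneg (add_nonneg (hF0 _) (mlErr_nonneg _)) (llErr_nonneg _))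
    (Ψ := fun q => upper F1 F2 F3 q.1 - fmin - α / 2 * gradSq F1 F2 F3 q.1
      + (1 + ulConst M * α) * mlErr F2 F3 q + (2 + ulConst M) * llErr F3 q + ulConst M * α ^ 2)
    ((((((hup.measurable.comp measurable_fst).sub_const fmin).sub (hgm.const_mul _)).add
      (hR.measurable_mlErr.const_mul _)).add (hR.measurable_llErr.const_mul _)).add_const _)
    (hFgl.add (integrable_const _))
    fun q => hD.ul_step hmin hup hT.θ_nonneg hT.θ_le_α hT.α_le_one q.1 q.2.1 q.2.2 i fun _ => rfl
  have hnext : ∀ ω, s (i + 1) ω = ((s i ω).1 - α • riesz (O.ulDir (pt (s i ω).1 (w ω).1 (Z ω))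
      (fun r => ξ (.ulGrad i r) ω) (fun r => ξ (.ulXY i r) ω) (fun r => ξ (.ulYY i r) ω)),
      (w ω).1, Z ω) := fun ω => by
    simp only [hw, hZdef, hs]
    rfl
  simp only [hnext]
  refine ⟨h1, ?_⟩
  have h3 : ∫ ω, (upper F1 F2 F3 (s i ω).1 - fmin - α / 2 * gradSq F1 F2 F3 (s i ω).1
      + (1 + ulConst M * α) * mlErr F2 F3 ((s i ω).1, (w ω).1, Z ω)
      + (2 + ulConst M) * llErr F3 ((s i ω).1, (w ω).1, Z ω) + ulConst M * α ^ 2) ∂μ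
      = ∫ ω, (upper F1 F2 F3 (s i ω).1 - fmin) ∂μ - α / 2 * ∫ ω, gradSq F1 F2 F3 (s i ω).1 ∂μ
        + (1 + ulConst M * α) * ∫ ω, mlErr F2 F3 ((s i ω).1, w ω) ∂μ
        + (2 + ulConst M) * ∫ ω, llErr F3 ((s i ω).1, (w ω).1, Z ω) ∂μ + ulConst M * α ^ 2 := by
    rw [integral_add hFgl (integrable_const _), integral_add hFgm (l1.const_mul _),
      integral_add hFg (m1.const_mul (1 + ulConst M * α)), integral_sub hiF (hig.const_mul _),
      integral_const_mul, integral_const_mul, integral_const_mul]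
    simp only [integral_const, probReal_univ, one_smul]
    rfl
  have h4 := hT.combine hM
    (add_nonneg (integral_nonneg fun ω => mlErr_nonneg (F2 := F2) (F3 := F3) (s i ω))
      (integral_nonneg fun ω => llErr_nonneg (F3 := F3) (s i ω)))
    (integral_nonneg fun ω => llErr_nonneg (F3 := F3) ((s i ω).1, w ω)) m3 l2
  have h5 := h2.trans h3.le
  rw [hsum]
  refine le_trans (add_le_add_left h5 _) ?_
  linarith

/-- Telescoping the decrease of the Lyapunov function bounds the sum of the mean squared
gradients. -/
theorem Directions.sum_gradSq_le (h : Problem c F1 F2 F3) (hD : Directions c M θ F1 F2 F3 O μ ξ)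
    (hO : GoodOracle c P F1 F2 F3 O θ) (hξ : Sampling μ P ξ) {fmin : ℝ}
    (hmin : ∀ x, fmin ≤ upper F1 F2 F3 x) {α β γ : ℝ} {J K : ℕ}
    (hT : Tuned c M θ α β γ J K) {x₀ : Vec n} {y₀ : Vec m} {z₀ : Vec t}
    {s : ℕ → Ω → Vec n × Vec m × Vec t}
    (hs : ∀ i ω, s i ω = tsgIter O α β γ J K x₀ y₀ z₀ (fun a => ξ a ω) i) (I : ℕ) :
    α / 2 * ∑ i ∈ Finset.range I, ∫ ω, gradSq F1 F2 F3 (s i ω).1 ∂μ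
      ≤ lyapunov F1 F2 F3 fmin (x₀, y₀, z₀) + I * (iterConst c M * α ^ 2) := by
  have key : Integrable (fun ω => lyapunov F1 F2 F3 fmin (s I ω)) μ ∧
      ∫ ω, lyapunov F1 F2 F3 fmin (s I ω) ∂μ
        + α / 2 * ∑ i ∈ Finset.range I, ∫ ω, gradSq F1 F2 F3 (s i ω).1 ∂μ
      ≤ lyapunov F1 F2 F3 fmin (x₀, y₀, z₀) + I * (iterConst c M * α ^ 2) := by
    induction I with
    | zero => simp [hs, tsgIter]
    | succ I ih =>
      obtain ⟨h1, h2⟩ := hD.iterate h hO hξ hmin hT hs ih.1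
      refine ⟨h1, ?_⟩
      rw [Finset.sum_range_succ]
      push_cast
      linarith [ih.2]
  have h0 : 0 ≤ ∫ ω, lyapunov F1 F2 F3 fmin (s I ω) ∂μ := integral_nonneg fun ω =>
    add_nonneg (add_nonneg (by linarith [hmin (s I ω).1]) (mlErr_nonneg _)) (llErr_nonneg _)
  linarith [key.2]

end Outer

/-! ### The choice of the step sizes -/

section StepSizes

variable {c : Constants} {M : ℝ}

/-- The number `√(K / (I J))` of lower-level steps, relative to the other loops, that makes the
lower-level loop contract enough. -/
def llRatio (c : Constants) (M : ℝ) : ℝ := (2 * mlConst c M + (2 + ulConst M)) / c.μz + 1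

/-- A lower bound on `√J`. -/
def mlCount (c : Constants) (M : ℝ) : ℝ := 4 * ulConst M / c.μy

/-- A lower bound on `√I`. -/
def ulCount (c : Constants) (M : ℝ) : ℝ :=
  1 + c.R ^ 2 / c.μz + 16 * M ^ 4 / c.μy + c.μy + c.μz

theorem one_le_llRatio (hM : 1 ≤ M) : 1 ≤ llRatio c M := by
  have := mlConst_nonneg (c := c) hM
  have := ulConst_nonneg hM
  have := c.μz_pos
  have : 0 ≤ (2 * mlConst c M + (2 + ulConst M)) / c.μz := by positivity
  rw [llRatio]
  linarith

theorem one_sub_pow_le_exp {q : ℝ} (hq : q ≤ 1) (k : ℕ) : (1 - q) ^ k ≤ Real.exp (-(q * k)) := by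
  have h := pow_le_pow_left₀ (by linarith) (Real.one_sub_le_exp_neg q) k
  rw [← Real.exp_nat_mul] at h
  rwa [show -(q * k) = k * -q by ring]

/-- The step sizes of the method are admissible, where `a = √I`, `b = √J`, `k = √K`. -/
theorem tuned_of_le (hM : 1 ≤ M) {a b k α β γ : ℝ} {J K : ℕ} (hJ : (J : ℝ) = b ^ 2)
    (hK : (K : ℝ) = k ^ 2) (ha : ulCount c M ≤ a) (hb1 : 1 ≤ b) (hb : mlCount c M ≤ b)
    (hk : llRatio c M * (a * b) ≤ k) (hα : α = 1 / a) (hβ : β = 1 / b * α)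
    (hγ : γ = 1 / (b * k) * α) : Tuned c M (α * β * γ) α β γ J K := by
  have hμz := c.μz_pos
  have hμy := c.μy_pos
  have hC := ulConst_nonneg hM
  have hm := mlConst_nonneg (c := c) hM
  have hr := one_le_llRatio (c := c) hM
  have d1 : 0 ≤ c.R ^ 2 / c.μz := by positivity
  have d2 : 0 ≤ 16 * M ^ 4 / c.μy := by positivity
  rw [ulCount] at ha
  have ha1 : 1 ≤ a := by linarith
  have ha0 : 0 < a := by linarith
  have hb0 : 0 < b := by linarith
  have hab : 0 < a * b := mul_pos ha0 hb0
  have hk' : a * b ≤ k := le_trans (le_mul_of_one_le_left hab.le hr) hk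
  have hk0 : 0 < k := hab.trans_le hk'
  have hα0 : 0 < α := by rw [hα]; positivity
  have hβ0 : 0 < β := by rw [hβ]; positivity
  have hγ0 : 0 < γ := by rw [hγ]; positivity
  have haα : a * α = 1 := by rw [hα]; field_simp
  have hα1 : α ≤ 1 := by
    rw [hα]; exact div_le_one_of_le₀ ha1 ha0.le
  have hbβ : b * β = α := by rw [hβ]; field_simp
  have hβα : β ≤ α := by
    rw [← hbβ]; exact le_mul_of_one_le_left hβ0.le hb1
  have hβ1 : β ≤ 1 := hβα.trans hα1
  -- `γ = 1 / (a b k)` and `β² = 1 / (a b)²`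
  have hγβ : γ ≤ β ^ 2 := by
    have e1 : γ = 1 / (a * b * k) := by rw [hγ, hα]; field_simp
    have e2 : β ^ 2 = 1 / (a * b * (a * b)) := by rw [hβ, hα]; field_simp
    rw [e1, e2]
    exact one_div_le_one_div_of_le (by positivity) (mul_le_mul_of_nonneg_left hk' hab.le)
  have hγα : γ ≤ α ^ 2 := hγβ.trans (pow_le_pow_left₀ hβ0.le hβα 2)
  have hγα1 : γ ≤ α := hγα.trans (by nlinarith)
  have hγ1 : γ ≤ 1 := hγα1.trans hα1
  have small : ∀ q, 0 ≤ q → q ≤ a → ∀ s, s ≤ α → q * s ≤ 1 := fun q hq hqa s hs =>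
    (mul_le_mul_of_nonneg_left hs hq).trans
      ((mul_le_mul_of_nonneg_right hqa hα0.le).trans haα.le)
  have hγK : c.μz * llRatio c M ≤ c.μz * γ * K := by
    have e1 : γ * K = k / (a * b) := by rw [hγ, hα, hK]; field_simp
    rw [mul_assoc, e1]
    exact mul_le_mul_of_nonneg_left ((le_div_iff₀ hab).2 hk) hμz.le
  have hγz : c.μz * γ ≤ 1 := small _ hμz.le (by linarith) _ hγα1
  have hβy : c.μy * β ≤ 1 := small _ hμy.le (by linarith) _ hβα
  have hρ : (2 * mlConst c M + (2 + ulConst M)) * (1 - c.μz * γ) ^ K ≤ 1 := by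
    have h1 : (1 - c.μz * γ) ^ K ≤ Real.exp (-(c.μz * llRatio c M)) :=
      (one_sub_pow_le_exp hγz K).trans (Real.exp_le_exp.2 (neg_le_neg hγK))
    have h2 : 2 * mlConst c M + (2 + ulConst M) ≤ Real.exp (c.μz * llRatio c M) := by
      have h3 := Real.add_one_le_exp (c.μz * llRatio c M)
      have h4 : c.μz * llRatio c M = 2 * mlConst c M + (2 + ulConst M) + c.μz := by
        rw [llRatio]; field_simp
      linarith
    calc _ ≤ Real.exp (c.μz * llRatio c M) * Real.exp (-(c.μz * llRatio c M)) := by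
          have : 0 ≤ 1 - c.μz * γ := by linarith
          gcongr
      _ = 1 := by rw [← Real.exp_add]; simp
  have hρ0 : 0 ≤ (1 - c.μz * γ) ^ K := pow_nonneg (by linarith) K
  refine ⟨by positivity, ?_, ?_, hα1, hβ1, hγ0.le, ?_, hγz, ?_, by linarith, hγβ, hγα, ?_, ?_, ?_,
    ?_⟩
  · rw [mul_right_comm]
    exact mul_le_of_le_one_left hβ0.le (mul_le_one₀ hα1 hγ0.le hγ1)
  · rw [mul_assoc]
    exact mul_le_of_le_one_right hα0.le (mul_le_one₀ hβ1 hγ0.le hγ1)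
  · have h1 := small _ d1 (by linarith) _ hγα1
    rw [div_mul_eq_mul_div, div_le_one hμz] at h1
    linarith
  · have h1 := small _ d2 (by linarith) _ hβα
    rwa [div_mul_eq_mul_div, div_le_one hμy] at h1
  · rw [hJ, ← hbβ, mul_pow]
  · have h1 : 0 ≤ (2 + ulConst M) * (1 - c.μz * γ) ^ K := by positivity
    linarith
  · have h1 : 0 ≤ mlConst c M * (1 - c.μz * γ) ^ K := by positivity
    linarith
  · have h1 := one_sub_pow_le_exp (by linarith : c.μy / 4 * β ≤ 1) J
    have h2 : 1 + ulConst M * α ≤ Real.exp (ulConst M * α) := by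
      linarith [Real.add_one_le_exp (ulConst M * α)]
    -- `β J = b α`
    have h3 : ulConst M * α + -(c.μy / 4 * β * J) ≤ 0 := by
      have e1 : c.μy / 4 * β * J = c.μy / 4 * (b * α) := by rw [hJ, ← hbβ]; ring
      rw [e1]
      have h4 : ulConst M ≤ c.μy / 4 * b := by
        rw [mlCount, div_le_iff₀ hμy] at hb
        linarith
      have h5 := mul_le_mul_of_nonneg_right h4 hα0.le
      linarith
    have h6 : 0 ≤ (1 - c.μy / 4 * β) ^ J := pow_nonneg (by linarith) J
    calc _ ≤ Real.exp (ulConst M * α) * Real.exp (-(c.μy / 4 * β * J)) := by gcongr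
      _ ≤ 1 := by rw [← Real.exp_add]; exact Real.exp_le_one_iff.2 h3

/-- The exact direction at `(x, y(x), z(x))` is the true gradient of `f`. -/
theorem norm_gradient_sq {n m t : ℕ} {F1 F2 F3 : Pt n m t → ℝ} (h : Problem c F1 F2 F3)
    (x : Vec n) : ‖gradient (upper F1 F2 F3) x‖ ^ 2 = gradSq F1 F2 F3 x := by
  rw [gradient, LinearIsometryEquiv.norm_map, (h.hasFDerivAt_upper x).fderiv, gradSq]

end StepSizes

end

end TSG

theorem theorem3p1 (c : TSG.Constants) :
    ∃ (varsigma varpi : ℝ) (Xi : ℕ → ℕ → ℝ),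
      0 < varsigma ∧ 0 < varpi ∧ (∀ I J, 1 ≤ I → 1 ≤ J → 0 < Xi I J) ∧
      (∃ κ : ℝ, ∀ I J : ℕ, 1 ≤ I → 1 ≤ J → Xi I J ≤ κ * ((J : ℝ) ^ 3 * I)) ∧
      ∀ D : ℝ, ∃ C : ℝ,
        ∀ (n m t : ℕ) (F1 F2 F3 : TSG.Pt n m t → ℝ),
          TSG.Smooth c F1 F2 F3 →
          (∀ x y, TSG.StronglyConvex c.μz fun z => F3 (TSG.pt x y z)) →
          (∀ x, TSG.StronglyConvex c.μy (TSG.fbar F2 F3 x)) →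
        ∀ fmin : ℝ, (∀ x, fmin ≤ TSG.upper F1 F2 F3 x) →
        ∀ (x₀ : TSG.Vec n) (y₀ : TSG.Vec m) (z₀ : TSG.Vec t),
          TSG.potential F1 F2 F3 x₀ y₀ z₀ - fmin ≤ D →
        ∀ I J K : ℕ, 1 ≤ I → 1 ≤ J → 1 ≤ K →
          varsigma ≤ J → varpi ≤ I → Xi I J ≤ K →
        ∀ α β γ : ℝ, α = 1 / √I → β = 1 / √J * α → γ = 1 / (√J * √K) * α →
        ∀ {S : Type*} [MeasurableSpace S] (P : Measure S) [IsProbabilityMeasure P]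
          (O : TSG.Oracle n m t S),
          TSG.StochasticEstimates c P F1 F2 F3 O →
          TSG.InverseBound c P O →
          TSG.InverseBias c P F2 F3 O (α * β * γ) →
        ∀ {Ω : Type*} [MeasurableSpace Ω] (μ : Measure Ω) [IsProbabilityMeasure μ]
          (ξ : TSG.SampleIdx → Ω → S),
          TSG.IIDSamples μ P ξ →
        ∀ X : ℕ → Ω → TSG.Vec n,
          (∀ i ω, X i ω = (TSG.tsgIter O α β γ J K x₀ y₀ z₀ (fun a => ξ a ω) i).1) →
          Differentiable ℝ (TSG.upper F1 F2 F3) ∧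
          (∀ i < I, Integrable (fun ω => ‖gradient (TSG.upper F1 F2 F3) (X i ω)‖ ^ 2) μ) ∧
          1 / (I : ℝ) * ∑ i ∈ Finset.range I,
              ∫ ω, ‖gradient (TSG.upper F1 F2 F3) (X i ω)‖ ^ 2 ∂μ
            ≤ C * (J / √I) := by
  obtain ⟨M, hM, hdir⟩ := TSG.exists_directions.{u_1, u_2} c
  set r := TSG.llRatio c M with hrdef
  have hr : 1 ≤ r := TSG.one_le_llRatio hM
  refine ⟨TSG.mlCount c M ^ 2 + 1, TSG.ulCount c M ^ 2 + 1, fun I J => r ^ 2 * (I * J),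
    by positivity, by positivity, fun I J hI hJ => ?_, ⟨r ^ 2, fun I J hI hJ => ?_⟩, fun D =>
    ⟨2 * (|D| + TSG.iterConst c M), ?_⟩⟩
  · have : (1 : ℝ) ≤ I := by exact_mod_cast hI
    have : (1 : ℝ) ≤ J := by exact_mod_cast hJ
    positivity
  · have h1 : (1 : ℝ) ≤ J := by exact_mod_cast hJ
    have h2 : (J : ℝ) ≤ (J : ℝ) ^ 3 := le_self_pow₀ h1 (by norm_num)
    change r ^ 2 * (I * J) ≤ r ^ 2 * ((J : ℝ) ^ 3 * I)
    rw [mul_comm (I : ℝ)]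
    gcongr
  intro n m t F1 F2 F3 hsm hz hy fmin hmin x₀ y₀ z₀ hD I J K hI hJ hK hςJ hϖI hΞK α β γ hα hβ hγ
    S _ P _ O hest hbd hbias Ω _ μ _ ξ hξ X hX
  have h : TSG.Problem c F1 F2 F3 := ⟨hsm, hz, hy⟩
  have hO : TSG.GoodOracle c P F1 F2 F3 O (α * β * γ) := ⟨hest, hbd, hbias⟩
  have hS : TSG.Sampling μ P ξ := ⟨hξ.measurable, hξ.indep, hξ.law⟩
  have hI' : (1 : ℝ) ≤ I := by exact_mod_cast hI
  have hJ' : (1 : ℝ) ≤ J := by exact_mod_cast hJ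
  have hT : TSG.Tuned c M (α * β * γ) α β γ J K := by
    refine TSG.tuned_of_le hM (a := √I) (b := √J) (k := √K) (Real.sq_sqrt (Nat.cast_nonneg _)).symm
      (Real.sq_sqrt (Nat.cast_nonneg _)).symm (Real.le_sqrt_of_sq_le (by linarith))
      (Real.one_le_sqrt.2 hJ') (Real.le_sqrt_of_sq_le (by linarith)) ?_ hα hβ hγ
    refine Real.le_sqrt_of_sq_le (le_trans (le_of_eq ?_) hΞK)
    rw [mul_pow, mul_pow, Real.sq_sqrt (Nat.cast_nonneg _), Real.sq_sqrt (Nat.cast_nonneg _)]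
  have hθ1 : α * β * γ ≤ 1 := hT.θ_le_α.trans hT.α_le_one
  have hdirs := hdir h hT.θ_nonneg hθ1 hO hS
  set s : ℕ → Ω → TSG.Vec n × TSG.Vec m × TSG.Vec t := fun i ω =>
    TSG.tsgIter O α β γ J K x₀ y₀ z₀ (fun a => ξ a ω) i with hs
  have hXs : ∀ i, X i = fun ω => (s i ω).1 := fun i => funext fun ω => hX i ω
  have hXm : ∀ i, Measurable (X i) := fun i => by
    rw [hXs i]
    exact (hO.measurable_tsgIter i (fun _ _ _ _ => hξ.measurable _) (fun _ _ _ _ => hξ.measurable _)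
      (fun _ _ _ => hξ.measurable _) (fun _ _ _ => hξ.measurable _)
      (fun _ _ _ => hξ.measurable _)).fst
  simp only [TSG.norm_gradient_sq h]
  refine ⟨fun x => (h.hasFDerivAt_upper x).differentiableAt,
    fun i _ => TSG.integrable_gradSq hdirs.regular (hXm i), ?_⟩
  have key := hdirs.sum_gradSq_le h hO hS hmin hT (s := s) (fun _ _ => rfl) I
  simp only [hXs]
  set G := ∑ i ∈ Finset.range I, ∫ ω, TSG.gradSq F1 F2 F3 (s i ω).1 ∂μ with hG
  have hlyap : TSG.lyapunov F1 F2 F3 fmin (x₀, y₀, z₀) ≤ |D| := by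
    refine le_trans ?_ (le_abs_self D)
    refine le_trans ?_ hD
    have : 0 ≤ ‖z₀ - TSG.zSol F3 x₀ (TSG.ySol F2 F3 x₀)‖ ^ 2 := sq_nonneg _
    simp only [TSG.lyapunov, TSG.mlErr, TSG.llErr, TSG.potential]
    linarith
  have hsI : 0 < √(I : ℝ) := Real.sqrt_pos.2 (by linarith)
  have hsq : √(I : ℝ) ^ 2 = I := Real.sq_sqrt (Nat.cast_nonneg _)
  have hC := TSG.iterConst_nonneg (c := c) hM
  -- `α = 1 / √I` makes the accumulated noise `I * C * α ^ 2` a constant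
  have e1 : (I : ℝ) * (TSG.iterConst c M * α ^ 2) = TSG.iterConst c M := by
    have : (I : ℝ) * α ^ 2 = 1 := by
      rw [hα, div_pow, hsq, one_pow, mul_one_div_cancel (by positivity)]
    rw [mul_left_comm, this, mul_one]
  have e2 : 1 / (I : ℝ) * G = 2 / √I * (α / 2 * G) := by
    have : 1 / (I : ℝ) = 1 / √I ^ 2 := by rw [hsq]
    rw [hα, this]
    field_simp
  calc 1 / (I : ℝ) * G = 2 / √I * (α / 2 * G) := e2
    _ ≤ 2 / √I * (|D| + TSG.iterConst c M) := by
        refine mul_le_mul_of_nonneg_left ?_ (by positivity)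
        linarith
    _ = 2 * (|D| + TSG.iterConst c M) * (1 / √I) := by ring
    _ ≤ 2 * (|D| + TSG.iterConst c M) * (J / √I) := by
        gcongr
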